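/- Consider the class $\mathcal Q^+$ of real, autonomous, multilinear equations on the square lattice for $u:\mathbb Z^2\to\mathbb R$, $$\begin{aligned} &a_1 (u_{n,m} + u_{n+1,m+1}) + a_2 (u_{n+1,m} + u_{n,m+1}) + (\alpha_1-\alpha_2) u_{n,m}u_{n+1,m} + (\alpha_1+\alpha_2) u_{n,m+1}u_{n+1,m+1}\\ &+ (\beta_1-\beta_2) u_{n,m}u_{n,m+1} + (\beta_1+\beta_2) u_{n+1,m}u_{n+1,m+1} + \gamma_1 u_{n,m}u_{n+1,m+1} + \gamma_2 u_{n+1,m}u_{n,m+1}\\ &+ (\xi_1-\xi_3) u_{n,m}u_{n+1,m}u_{n,m+1} + (\xi_1+\xi_3) u_{n,m}u_{n+1,m}u_{n+1,m+1} + (\xi_2-\xi_4) u_{n+1,m}u_{n,m+1}u_{n+1,m+1}\\ &+ (\xi_2+\xi_4) u_{n,m}u_{n,m+1}u_{n+1,m+1} + \zeta u_{n,m} u_{n+1,m} u_{n,m+1} u_{n+1,m+1}=0, \end{aligned}$$ with real coefficients, $a_1,a_2\neq 0$, $|a_1|\neq|a_2|$. *Multiscale expansion.* Let $K=e^{i\kappa}$,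 $\Omega=e^{-i\omega}$ with $\kappa,\omega$ real, and $L_\alpha=a_1(1+K^\alpha\Omega^\alpha)+a_2(K^\alpha+\Omega^\alpha)$. The pair $(\kappa,\omega)$ is called an admissible carrier if $L_1=0$ (dispersion relation), $\sin\kappa\ne0$ (so that $\omega''(\kappa)\neq0$) and $L_2,L_3,L_4\neq0$ (no resonance of the higher harmonics). Insert $$u_{n,m}=\sum_{j\ge1}\varepsilon^{j}\sum_{|\alpha|\le j}K^{\alpha n}\Omega^{\alpha m}u_j^{(\alpha)},\qquad u_j^{(-\alpha)}=\overline{u_j^{(\alpha)}},$$ where the $u_j^{(\alpha)}$ depend on $\xi=\varepsilon(n- v m)$ and on the slow times $m_k=\varepsilon^k m$, $k\geq2$, and where lattice shifts act on the $u^{(\alpha)}_j$ by their Taylor expansions; let $\mathcal W_j^{(\alpha)}$ be the coefficient of $\varepsilon^jK^{\alpha n}\Omega^{\alpha m}$ in the left-hand side of the equation. Write $u(j)=u_j^{(1)}$, treated as independent functions of $\xi$, with the other harmonics being differential polynomials in the $u(j)$ and $\overline{u(j)}$. The equations $\mathcal W_j^{(\alpha)}=0$ for $j\le4$ and all $\alpha$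 amount, for the amplitudes $u(1)$, $u(2)$, to reduced equations of the form $$\partial_{m_2}u(1)=K_2[u(1)],\qquad \partial_{m_3}u(1)=K_3[u(1)],\qquad \partial_{m_2}u(2)=K_2'[u(1)]\,u(2)+f_2(2),$$ where $$K_2[u]=-i\rho_1\Big[u_{\xi\xi}+\tfrac{\rho_2}{\rho_1}|u|^2u\Big],\qquad K_3[u]=B\Big[u_{\xi\xi\xi}+\tfrac{3\rho_2}{\rho_1}|u|^2u_\xi\Big],$$ $K_2'[u]$ is the linearization of $K_2$ at $u$, and $f_2(2)=a\,u_\xi(1)|u(1)|^2+b\,\bar u_\xi(1)u(1)^2$, with $v,\rho_1,B$ real, $\rho_1\ne0$, and $\rho_2,a,b$ complex numbers that depend on the carrier. The equation satisfies the integrability conditions up to order $\varepsilon^4$ (it is $A_2$-integrable) if, for every admissible carrier, $\rho_2$ is real (the $A_1$-condition, order $\varepsilon^3$) and $a,b$ are real (the $A_2$-conditions, order $\varepsilon^4$). **Proposition.** An equation of the class $\mathcal Q^+$ satisfies the integrability conditions up to order $\varepsilon^4$ if and only if its coefficients belong to one of the following two cases: * Case 1 (nine free parameters): $\alpha_2=\beta_2=0$,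 $\xi_1=\xi_2$, $\xi_3=\xi_4$. * Case 4 (eight free parameters): $\alpha_1=\beta_1=\frac{(a_1+a_2)\gamma_1}{2a_1}$, $\gamma_2=\frac{a_2\gamma_1}{a_1}$, $a_1(\xi_1-\xi_2)=-\alpha_2\gamma_1$, $a_1(\xi_3-\xi_4)=\beta_2\gamma_1$, $(\alpha_2,\beta_2)\neq(0,0)$. The two subclasses do not overlap, and each of them is invariant under the restricted Möbius transformations: for all real $C$ and $D\neq 0$, replacing $u$ by $u/(Cu+D)$ at all lattice points and clearing denominators turns an equation of $\mathcal Q^+$ into an equation of $\mathcal Q^+$, and the new equation belongs to Case 1 (respectively Case 4) if and only if the original one does. Nine (eight) free parameters means: $a_1,a_2,\alpha_1,\beta_1,\gamma_1,\gamma_2,\xi_1,\xi_3,\zeta$ can be prescribed arbitrarily in Case 1, and $a_1,a_2,\alpha_2,\beta_2,\gamma_1,\xi_1,\xi_3,\zeta$ in Case 4 (subject to $a_1\neq0$ and $(\alpha_2,\beta_2)\neq(0,0)$), and they determine the other coefficients. -/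

import Mathlib

open scoped LaurentPolynomial

noncomputable section

/-- The thirteen real coefficients of a multilinear equation on the square lattice, with
`x00 = u_{n,m}`, `x10 = u_{n+1,m}`, `x01 = u_{n,m+1}`, `x11 = u_{n+1,m+1}` (see `quad`). -/
@[ext]
structure QCoeffs where
  (a₁ a₂ α₁ α₂ β₁ β₂ γ₁ γ₂ ξ₁ ξ₂ ξ₃ ξ₄ ζ : ℝ)

namespace QCoeffs

/-- The multilinear polynomial `𝒬⁺`, evaluated in any commutative real algebra. -/
def quad (p : QCoeffs) {A : Type*} [CommRing A] [Algebra ℝ A] (x00 x10 x01 x11 : A) : A :=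
  p.a₁ • (x00 + x11) + p.a₂ • (x10 + x01)
  + (p.α₁ - p.α₂) • (x00 * x10) + (p.α₁ + p.α₂) • (x01 * x11)
  + (p.β₁ - p.β₂) • (x00 * x01) + (p.β₁ + p.β₂) • (x10 * x11)
  + p.γ₁ • (x00 * x11) + p.γ₂ • (x10 * x01)
  + (p.ξ₁ - p.ξ₃) • (x00 * x10 * x01) + (p.ξ₁ + p.ξ₃) • (x00 * x10 * x11)
  + (p.ξ₂ - p.ξ₄) • (x10 * x01 * x11) + (p.ξ₂ + p.ξ₄) • (x00 * x01 * x11)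
  + p.ζ • (x00 * x10 * x01 * x11)

/-- Membership in the class `𝒬⁺`: the linear part has a nontrivial dispersion relation. -/
def IsDispersive (p : QCoeffs) : Prop :=
  p.a₁ ≠ 0 ∧ p.a₂ ≠ 0 ∧ |p.a₁| ≠ |p.a₂|

/-- Case 1. -/
def Case1 (p : QCoeffs) : Prop :=
  p.α₂ = 0 ∧ p.β₂ = 0 ∧ p.ξ₁ = p.ξ₂ ∧ p.ξ₃ = p.ξ₄

/-- The restricted Case 4. -/
def Case4 (p : QCoeffs) : Prop :=
  p.α₁ = (p.a₁ + p.a₂) * p.γ₁ / (2 * p.a₁) ∧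
  p.β₁ = (p.a₁ + p.a₂) * p.γ₁ / (2 * p.a₁) ∧
  p.γ₂ = p.a₂ * p.γ₁ / p.a₁ ∧
  p.a₁ * (p.ξ₁ - p.ξ₂) = -(p.α₂ * p.γ₁) ∧
  p.a₁ * (p.ξ₃ - p.ξ₄) = p.β₂ * p.γ₁ ∧
  (p.α₂, p.β₂) ≠ (0, 0)

/-! ### The restricted Möbius transformation -/

/-- The coefficients of the equation obtained by substituting `u / (C u + D)` for `u` at every
lattice point and clearing denominators; `quad_mobius` proves that this is what they are. -/
def mobius (C D : ℝ) (p : QCoeffs) : QCoeffs where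
  a₁ := D ^ 3 * p.a₁
  a₂ := D ^ 3 * p.a₂
  α₁ := D ^ 2 * (p.α₁ + C * (p.a₁ + p.a₂))
  α₂ := D ^ 2 * p.α₂
  β₁ := D ^ 2 * (p.β₁ + C * (p.a₁ + p.a₂))
  β₂ := D ^ 2 * p.β₂
  γ₁ := D ^ 2 * (p.γ₁ + 2 * C * p.a₁)
  γ₂ := D ^ 2 * (p.γ₂ + 2 * C * p.a₂)
  ξ₁ := D * p.ξ₁ + 1 / 2 * C * D *
    (3 * C * (p.a₁ + p.a₂) + p.γ₁ + p.γ₂ + 2 * (p.α₁ - p.α₂ + p.β₁))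
  ξ₂ := D * p.ξ₂ + 1 / 2 * C * D *
    (3 * C * (p.a₁ + p.a₂) + p.γ₁ + p.γ₂ + 2 * (p.α₁ + p.α₂ + p.β₁))
  ξ₃ := D * p.ξ₃ + 1 / 2 * C * D * (C * (p.a₁ - p.a₂) + p.γ₁ - p.γ₂ + 2 * p.β₂)
  ξ₄ := D * p.ξ₄ + 1 / 2 * C * D * (C * (p.a₁ - p.a₂) + p.γ₁ - p.γ₂ - 2 * p.β₂)
  ζ := p.ζ + C ^ 2 * (2 * C * (p.a₁ + p.a₂) + p.γ₁ + p.γ₂ + 2 * (p.α₁ + p.β₁))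
    + 2 * C * (p.ξ₁ + p.ξ₂)

theorem quad_mobius (p : QCoeffs) (C D x y z w : ℝ) (hx : C * x + D ≠ 0) (hy : C * y + D ≠ 0)
    (hz : C * z + D ≠ 0) (hw : C * w + D ≠ 0) :
    (p.mobius C D).quad x y z w =
      (C * x + D) * (C * y + D) * (C * z + D) * (C * w + D) *
        p.quad (x / (C * x + D)) (y / (C * y + D)) (z / (C * z + D)) (w / (C * w + D)) := by
  have key : ∀ a b c d : ℝ, a ≠ 0 → b ≠ 0 → c ≠ 0 → d ≠ 0 →
      a * b * c * d * p.quad (x / a) (y / b) (z / c) (w / d) =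
        p.a₁ * (x * b * c * d + a * b * c * w) + p.a₂ * (a * y * c * d + a * b * z * d)
        + (p.α₁ - p.α₂) * (x * y * c * d) + (p.α₁ + p.α₂) * (a * b * z * w)
        + (p.β₁ - p.β₂) * (x * b * z * d) + (p.β₁ + p.β₂) * (a * y * c * w)
        + p.γ₁ * (x * b * c * w) + p.γ₂ * (a * y * z * d)
        + (p.ξ₁ - p.ξ₃) * (x * y * z * d) + (p.ξ₁ + p.ξ₃) * (x * y * c * w)
        + (p.ξ₂ - p.ξ₄) * (a * y * z * w) + (p.ξ₂ + p.ξ₄) * (x * b * z * w)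
        + p.ζ * (x * y * z * w) := by
    intro a b c d ha hb hc hd
    obtain ⟨x', rfl⟩ : ∃ t, x = t * a := ⟨x / a, by field_simp⟩
    obtain ⟨y', rfl⟩ : ∃ t, y = t * b := ⟨y / b, by field_simp⟩
    obtain ⟨z', rfl⟩ : ∃ t, z = t * c := ⟨z / c, by field_simp⟩
    obtain ⟨w', rfl⟩ : ∃ t, w = t * d := ⟨w / d, by field_simp⟩
    rw [mul_div_cancel_right₀ _ ha, mul_div_cancel_right₀ _ hb, mul_div_cancel_right₀ _ hc,
      mul_div_cancel_right₀ _ hd]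
    simp only [quad, smul_eq_mul]
    ring
  rw [key _ _ _ _ hx hy hz hw]
  simp only [quad, mobius, smul_eq_mul]
  ring

end QCoeffs

/-! ### Differential polynomials in the slowly varying amplitudes -/

/-- Jet variables: `amp j k` is `∂_ξ^k u_j^{(1)}` and `ampBar j k` is its complex conjugate. -/
inductive JetVar where
  | amp (j k : ℕ) : JetVar
  | ampBar (j k : ℕ) : JetVar

/-- Differential polynomials in the amplitudes `u_j^{(1)}` and their conjugates. -/
abbrev DiffPoly : Type := MvPolynomial JetVar ℂ

namespace DiffPoly

/-- `∂_ξ^k u_j^{(1)}`. -/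
def u (j k : ℕ) : DiffPoly := MvPolynomial.X (JetVar.amp j k)

/-- The complex conjugate of `∂_ξ^k u_j^{(1)}`. -/
def ubar (j k : ℕ) : DiffPoly := MvPolynomial.X (JetVar.ampBar j k)

/-- A complex constant. -/
def const (z : ℂ) : DiffPoly := MvPolynomial.C z

/-- Complex conjugation of differential polynomials. -/
def conj : DiffPoly →+* DiffPoly :=
  MvPolynomial.eval₂Hom (MvPolynomial.C.comp (starRingEnd ℂ)) fun
    | .amp j k => ubar j k
    | .ampBar j k => u j k

/-- The total derivative `∂_ξ`. -/
def dξ : Derivation ℂ DiffPoly DiffPoly :=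
  MvPolynomial.mkDerivation ℂ fun
    | .amp j k => u j (k + 1)
    | .ampBar j k => ubar j (k + 1)

/-- The derivative with respect to a slow time along which the amplitudes evolve according to
`∂_t u_j^{(1)} = F j` (and the complex conjugate equations). -/
def flow (F : ℕ → DiffPoly) : Derivation ℂ DiffPoly DiffPoly :=
  MvPolynomial.mkDerivation ℂ fun
    | .amp j k => dξ^[k] (F j)
    | .ampBar j k => dξ^[k] (conj (F j))

/-- The nonlinear Schrödinger flow `K₂[u] = -iρ₁(u_ξξ + (ρ₂/ρ₁)|u|²u)` at `u = u_1^{(1)}`. -/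
def K₂ (ρ₁ : ℝ) (ρ₂ : ℂ) : DiffPoly :=
  const (-Complex.I * ρ₁) * (u 1 2 + const (ρ₂ / ρ₁) * (u 1 0 ^ 2 * ubar 1 0))

/-- The linearization `K₂'[u]v = -iρ₁(v_ξξ + (ρ₂/ρ₁)(u² v̄ + 2|u|²v))` at `u = u_1^{(1)}`,
`v = u_2^{(1)}`. -/
def K₂' (ρ₁ : ℝ) (ρ₂ : ℂ) : DiffPoly :=
  const (-Complex.I * ρ₁) *
    (u 2 2 + const (ρ₂ / ρ₁) * (u 1 0 ^ 2 * ubar 2 0 + 2 * (u 1 0 * ubar 1 0 * u 2 0)))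

/-- The next flow of the hierarchy, `K₃[u] = B(u_ξξξ + (3ρ₂/ρ₁)|u|²u_ξ)` at `u = u_1^{(1)}`. -/
def K₃ (ρ₁ : ℝ) (ρ₂ : ℂ) (B : ℝ) : DiffPoly :=
  const B * (u 1 3 + const (3 * ρ₂ / ρ₁) * (u 1 0 * ubar 1 0 * u 1 1))

/-- The forcing term `f₂(2) = a u_ξ |u|² + b ū_ξ u²` at `u = u_1^{(1)}`. -/
def f₂ (a b : ℂ) : DiffPoly :=
  const a * (u 1 1 * (u 1 0 * ubar 1 0)) + const b * (ubar 1 1 * u 1 0 ^ 2)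

/-- The coefficient of `ε^i` in `exp(ε δ₁ + ε² δ₂ + ε³ δ₃)`, for commuting `δ`'s and `i ≤ 3`.
Since the field starts at order `ε`, only these are needed at the orders `≤ 4` used below. -/
def shiftOp (δ₁ δ₂ δ₃ : Derivation ℂ DiffPoly DiffPoly) (i : ℕ) (f : DiffPoly) : DiffPoly :=
  match i with
  | 0 => f
  | 1 => δ₁ f
  | 2 => (1 / 2 : ℂ) • δ₁ (δ₁ f) + δ₂ f
  | 3 => (1 / 6 : ℂ) • δ₁ (δ₁ (δ₁ f)) + δ₁ (δ₂ f) + δ₃ f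
  | _ => 0

/-- Formal power series in `ε` (the variable of `PowerSeries`) whose coefficients are finite sums
of harmonics; `LaurentPolynomial.T α` stands for the carrier `K^{αn} Ω^{αm}`. -/
abbrev Expansion : Type := PowerSeries (LaurentPolynomial DiffPoly)

/-- The expansion of the field `u = ε w` at a lattice point shifted from `(n, m)`: `op` is the
family of operators describing the effect of the shift on the slowly varying amplitudes
`h ℓ α = u_ℓ^{(α)}`, `|α| ≤ ℓ`, and `z` is the factor which the carrier `K^n Ω^m` acquires. -/
def field (op : ℕ → DiffPoly → DiffPoly) (z : ℂ) (h : ℕ → ℤ → DiffPoly) : Expansion :=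
  PowerSeries.mk fun j =>
    ∑ α ∈ Finset.Icc (-(j : ℤ)) (j : ℤ),
      LaurentPolynomial.C
          (const (z ^ α) * ∑ ℓ ∈ Finset.Icc (max 1 α.natAbs) j, op (j - ℓ) (h ℓ α)) *
        LaurentPolynomial.T α

end DiffPoly

/-! ### The multiscale expansion -/

namespace QCoeffs

/-- `K = e^{iκ}` -/
def carrierK (κ : ℝ) : ℂ := Complex.exp (Complex.I * κ)

/-- `Ω = e^{-iω}` -/
def carrierΩ (ω : ℝ) : ℂ := Complex.exp (-(Complex.I * ω))

/-- The result of applying the linear part of the equation to `(K^n Ω^m)^α`, divided by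
`(K^n Ω^m)^α`. -/
def linSymbol (p : QCoeffs) (κ ω : ℝ) (α : ℕ) : ℂ :=
  p.a₁ * (1 + (carrierK κ * carrierΩ ω) ^ α) + p.a₂ * (carrierK κ ^ α + carrierΩ ω ^ α)

/-- The carrier waves around which one expands up to order `ε⁴`: `(κ, ω)` satisfies the dispersion
relation, the dispersion is nonlinear at `κ` (`ω''(κ) ≠ 0`, i.e. `sin κ ≠ 0`), and the higher
harmonics generated up to this order are not resonant. -/
structure IsCarrier (p : QCoeffs) (κ ω : ℝ) : Prop where
  dispersion : p.linSymbol κ ω 1 = 0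
  sin_ne_zero : Real.sin κ ≠ 0
  nonresonant : ∀ α : ℕ, 2 ≤ α → α ≤ 4 → p.linSymbol κ ω α ≠ 0

open DiffPoly in
/-- The expansion in `ε` of the left-hand side of the equation; its coefficient at `ε^j T^α` is
`𝒲_j^{(α)}`. The slow derivatives are `∂_{n₁} = ∂_ξ` and `∂_{m₁} = -v ∂_ξ`, that is,
`ξ = n₁ - v m₁`, while `∂_{m₂}`, `∂_{m₃}` are the flows with right-hand sides `F₂`, `F₃`. -/
def expansion (p : QCoeffs) (κ ω v : ℝ) (F₂ F₃ : ℕ → DiffPoly) (h : ℕ → ℤ → DiffPoly) :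
    Expansion :=
  let δn₁ := dξ
  let δm₁ := (-v : ℂ) • dξ
  let δm₂ := flow F₂
  let δm₃ := flow F₃
  p.quad
    (field (shiftOp 0 0 0) 1 h)
    (field (shiftOp δn₁ 0 0) (carrierK κ) h)
    (field (shiftOp δm₁ δm₂ δm₃) (carrierΩ ω) h)
    (field (shiftOp (δn₁ + δm₁) δm₂ δm₃) (carrierK κ * carrierΩ ω) h)

open DiffPoly in
/-- The multiscale expansion up to order `ε⁴` around the carrier `(κ, ω)` has the reduced equations
`∂_{t₂} u(1) = K₂[u(1)]`, `∂_{t₃} u(1) = K₃[u(1)]`, `∂_{t₂} u(2) = K₂'[u(1)] u(2) + f₂(2)`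
with the coefficients `ρ₁`, `ρ₂`, `B`, `a`, `b`: with the amplitudes `u(j) = u_j^{(1)}` as
independent functions of `ξ` which evolve in this way, and with the other harmonics suitable
differential polynomials in them, `𝒲_j^{(α)} = 0` for all `j ≤ 4` and all `α`. -/
def HasReduction (p : QCoeffs) (κ ω v ρ₁ : ℝ) (ρ₂ : ℂ) (B : ℝ) (a b : ℂ) : Prop :=
  ρ₁ ≠ 0 ∧
  ∃ (F₂ F₃ : ℕ → DiffPoly) (h : ℕ → ℤ → DiffPoly),
    F₂ 1 = K₂ ρ₁ ρ₂ ∧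
    F₂ 2 = K₂' ρ₁ ρ₂ + f₂ a b ∧
    F₃ 1 = K₃ ρ₁ ρ₂ B ∧
    (∀ j, h j 1 = u j 0) ∧
    (∀ j α, h j (-α) = conj (h j α)) ∧
    ∀ j ≤ 4, PowerSeries.coeff j (p.expansion κ ω v F₂ F₃ h) = 0

/-- The equation satisfies the `A₁`-integrability condition (`ρ₂` is real, for all carriers) and
the `A₂`-integrability conditions (`a` and `b` are real, for all carriers). -/
def IsA2Integrable (p : QCoeffs) : Prop :=
  ∀ κ ω : ℝ, p.IsCarrier κ ω →
    ∃ (v ρ₁ : ℝ) (ρ₂ : ℂ) (B : ℝ) (a b : ℂ),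
      p.HasReduction κ ω v ρ₁ ρ₂ B a b ∧ ρ₂.im = 0 ∧ a.im = 0 ∧ b.im = 0

end QCoeffs

end

/-!
Centre the cell at its middle point: with `K = e^{i(φ + ψ)}` and `Ω = e^{-i(ψ - φ)}` the four
corners carry the factors `e^{-iφ}, e^{iψ}, e^{-iψ}, e^{iφ}` up to a common one, and the shifts of
the slow variable are antisymmetric about the centre. Comparing coefficients up to `ε⁴`, the orders
`1, 2, 3` determine the zeroth and second harmonics, and what is left is a finite system of scalar
equations for the constants of the reduction. The dispersion relation reads
`a₁ cos φ + a₂ cos ψ = 0`, and admissibility makes every leading coefficient invertible, so for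
each carrier the system has exactly one solution.

These scalar equations are invariant under the restricted Möbius transformations, which can be used
to achieve `γ₁ = 0`. Then:

* in Case 1 the equation is preserved by the point reflection of the cell, and in Case 4 by the
  point reflection combined with `u ↦ -u`. The reflection conjugates the scalar equations, so that
  their unique solution is real;
* conversely, along the carriers `cos φ = a₂ x`, `cos ψ = -a₁ x` with `x → 0⁺`, the reality of `ρ₂`
  and `b` becomes two identities that are linear in `sin φ` and `sin ψ` with polynomial coefficients
  in `x`. The signs of the two sines are free, so these polynomials vanish, and their lowest and
  highest coefficients form a regular linear system for the products of `α₁ ± β₁` and `γ₂`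
  with `α₂ ± β₂`, together with the differences `ξ₁ - ξ₂` and `ξ₃ - ξ₄`.
-/

noncomputable section

namespace DiffPoly

/-! ### Coefficients of expansions -/

/-- The coefficient `𝒲_j^{(α)}` of `ε^j T^α`; it is only `ℝ`-linear here because the equation has
real coefficients. -/
def coeffAt (j : ℕ) (α : ℤ) : Expansion →ₗ[ℝ] DiffPoly where
  toFun f := (PowerSeries.coeff j f).coeff α
  map_add' _ _ := rfl
  map_smul' _ _ := rfl

theorem coeffAt_apply (j : ℕ) (α : ℤ) (f : Expansion) :
    coeffAt j α f = (PowerSeries.coeff j f).coeff α := rfl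

theorem coeff_eq_zero_iff (j : ℕ) (f : Expansion) :
    PowerSeries.coeff j f = 0 ↔ ∀ α, coeffAt j α f = 0 :=
  ⟨fun h α => by rw [coeffAt_apply, h]; rfl, fun h => LaurentPolynomial.ext fun α => h α⟩

theorem laurent_coeff_mul (a b : LaurentPolynomial DiffPoly) (β : ℤ) (s : Finset ℤ)
    (hs : ∀ α ∉ s, a.coeff α = 0) :
    (a * b).coeff β = ∑ α ∈ s, a.coeff α * b.coeff (β - α) := by
  rw [AddMonoidAlgebra.coeff_mul_apply_left, Finsupp.sum_of_support_subset (s := s)]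
  · simp only [neg_add_eq_sub]
  · exact fun α hα => by_contra fun h => Finsupp.mem_support_iff.mp hα (hs α h)
  · simp only [zero_mul, implies_true]

/-- Series divisible by `ε^k` in which `ε^j` is accompanied by harmonics `|α| ≤ j` only. -/
def filtration (k : ℕ) : Submodule ℝ Expansion :=
  ⨅ (j : ℕ) (α : ℤ) (_ : j < k ∨ (j : ℤ) < |α|), LinearMap.ker (coeffAt j α)

variable {k l : ℕ} {f g h : Expansion}

theorem mem_filtration :
    f ∈ filtration k ↔ ∀ (j : ℕ) (α : ℤ), j < k ∨ (j : ℤ) < |α| → coeffAt j α f = 0 := by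
  simp only [filtration, Submodule.mem_iInf, LinearMap.mem_ker]

theorem coeffAt_eq_zero_of_lt (hf : f ∈ filtration k) {j : ℕ} (hj : j < k) (α : ℤ) :
    coeffAt j α f = 0 :=
  mem_filtration.mp hf j α (.inl hj)

theorem coeffAt_eq_zero_of_lt_abs (hf : f ∈ filtration k) {j : ℕ} {α : ℤ} (hα : (j : ℤ) < |α|) :
    coeffAt j α f = 0 :=
  mem_filtration.mp hf j α (.inr hα)

theorem filtration_antitone : Antitone filtration := fun _ _ hkl _ hf =>
  mem_filtration.mpr fun j α h => mem_filtration.mp hf j α (h.imp_left (lt_of_lt_of_le · hkl))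

theorem coeffAt_mul (hf : f ∈ filtration k) (g : Expansion) (j : ℕ) (β : ℤ) :
    coeffAt j β (f * g) = ∑ i ∈ Finset.HasAntidiagonal.antidiagonal j,
      ∑ α ∈ Finset.Icc (-(i.1 : ℤ)) i.1, coeffAt i.1 α f * coeffAt i.2 (β - α) g := by
  rw [coeffAt_apply, PowerSeries.coeff_mul, AddMonoidAlgebra.coeff_sum, Finsupp.finsetSum_apply]
  refine Finset.sum_congr rfl fun i _ => laurent_coeff_mul _ _ _ _ fun α hα => ?_
  rw [Finset.mem_Icc, ← abs_le, not_le] at hα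
  exact coeffAt_eq_zero_of_lt_abs hf hα

theorem mul_mem_filtration (hf : f ∈ filtration k) (hg : g ∈ filtration l) :
    f * g ∈ filtration (k + l) := by
  refine mem_filtration.mpr fun j β hjβ => ?_
  rw [coeffAt_mul hf]
  refine Finset.sum_eq_zero fun i hi => Finset.sum_eq_zero fun α hα => ?_
  rw [Finset.HasAntidiagonal.mem_antidiagonal] at hi
  rw [Finset.mem_Icc, ← abs_le] at hα
  by_cases hik : i.1 < k
  · rw [coeffAt_eq_zero_of_lt hf hik, zero_mul]
  · have := abs_sub_abs_le_abs_sub β α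
    rw [mem_filtration.mp hg i.2 (β - α) (by omega), mul_zero]

theorem mul_sub_mul_mem_filtration {n : ℕ} {x x' y y' : Expansion}
    (hx : x - x' ∈ filtration (k + n)) (hx' : x' ∈ filtration k) (hy : y ∈ filtration l)
    (hyy : y - y' ∈ filtration (l + n)) : x * y - x' * y' ∈ filtration (k + l + n) := by
  rw [show x * y - x' * y' = (x - x') * y + x' * (y - y') by ring]
  refine Submodule.add_mem _ ?_ ?_
  · exact (by omega : k + n + l = k + l + n) ▸ mul_mem_filtration hx hy
  · exact (by omega : k + (l + n) = k + l + n) ▸ mul_mem_filtration hx' hyy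

/-- Series of order `ε^k` whose leading coefficient contains only harmonics of the parity of `k`,
as a product of `k` carrier waves does. -/
structure IsWave (k : ℕ) (f : Expansion) : Prop where
  mem_filtration : f ∈ filtration k
  coeffAt_of_odd : ∀ α : ℤ, Odd (α + k) → coeffAt k α f = 0

theorem IsWave.mul (hf : IsWave k f) (hg : IsWave l g) : IsWave (k + l) (f * g) where
  mem_filtration := mul_mem_filtration hf.mem_filtration hg.mem_filtration
  coeffAt_of_odd β hβ := by
    rw [coeffAt_mul hf.mem_filtration]
    refine Finset.sum_eq_zero fun i hi => Finset.sum_eq_zero fun α _ => ?_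
    rw [Finset.HasAntidiagonal.mem_antidiagonal] at hi
    obtain hlt | hlt | ⟨hi₁, hi₂⟩ : i.1 < k ∨ i.2 < l ∨ i.1 = k ∧ i.2 = l := by omega
    · rw [coeffAt_eq_zero_of_lt hf.mem_filtration hlt, zero_mul]
    · rw [coeffAt_eq_zero_of_lt hg.mem_filtration hlt, mul_zero]
    · rw [hi₁, hi₂]
      obtain hα | hα := Int.even_or_odd (α + k)
      · rw [hg.coeffAt_of_odd (β - α) (by grind), mul_zero]
      · rw [hf.coeffAt_of_odd α hα, zero_mul]

theorem IsWave.mono (hf : IsWave l f) (hkl : k ≤ l) : IsWave k f where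
  mem_filtration := filtration_antitone hkl hf.mem_filtration
  coeffAt_of_odd α hα := by
    obtain rfl | hlt := hkl.eq_or_lt
    · exact hf.coeffAt_of_odd α hα
    · exact coeffAt_eq_zero_of_lt hf.mem_filtration hlt α

theorem IsWave.coeffAt_zero (hf : IsWave 1 f) (α : ℤ) : coeffAt 0 α f = 0 :=
  coeffAt_eq_zero_of_lt hf.mem_filtration one_pos α

theorem IsWave.coeffAt_one_zero (hf : IsWave 1 f) : coeffAt 1 0 f = 0 :=
  hf.coeffAt_of_odd 0 (by decide)

section products

theorem Icc_neg_one_one : Finset.Icc (-1 : ℤ) 1 = {-1, 0, 1} := by decide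

theorem Icc_neg_two_two : Finset.Icc (-2 : ℤ) 2 = {-2, -1, 0, 1, 2} := by decide

theorem Icc_neg_three_three : Finset.Icc (-3 : ℤ) 3 = {-3, -2, -1, 0, 1, 2, 3} := by decide

variable (hf : IsWave 1 f) (hg : IsWave 1 g)
include hf hg

theorem coeffAt_two_zero_mul :
    coeffAt 2 0 (f * g) = coeffAt 1 1 f * coeffAt 1 (-1) g + coeffAt 1 (-1) f * coeffAt 1 1 g := by
  rw [coeffAt_mul hf.mem_filtration]
  simp [Finset.Nat.antidiagonal_succ, Icc_neg_one_one, hf.coeffAt_zero, hg.coeffAt_zero,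
    hf.coeffAt_one_zero, add_comm]

theorem coeffAt_two_two_mul : coeffAt 2 2 (f * g) = coeffAt 1 1 f * coeffAt 1 1 g := by
  rw [coeffAt_mul hf.mem_filtration]
  simp [Finset.Nat.antidiagonal_succ, Icc_neg_one_one, hf.coeffAt_zero, hg.coeffAt_zero,
    hf.coeffAt_one_zero, coeffAt_eq_zero_of_lt_abs hg.mem_filtration]

theorem coeffAt_three_zero_mul :
    coeffAt 3 0 (f * g) = coeffAt 1 1 f * coeffAt 2 (-1) g + coeffAt 1 (-1) f * coeffAt 2 1 g
      + coeffAt 2 1 f * coeffAt 1 (-1) g + coeffAt 2 (-1) f * coeffAt 1 1 g := by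
  rw [coeffAt_mul hf.mem_filtration]
  simp [Finset.Nat.antidiagonal_succ, Icc_neg_one_one, Icc_neg_two_two, hf.coeffAt_zero,
    hg.coeffAt_zero, hf.coeffAt_one_zero, hg.coeffAt_one_zero,
    coeffAt_eq_zero_of_lt_abs hg.mem_filtration]
  ring

theorem coeffAt_three_two_mul :
    coeffAt 3 2 (f * g) = coeffAt 1 1 f * coeffAt 2 1 g + coeffAt 2 1 f * coeffAt 1 1 g := by
  rw [coeffAt_mul hf.mem_filtration]
  simp [Finset.Nat.antidiagonal_succ, Icc_neg_one_one, Icc_neg_two_two, hf.coeffAt_zero,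
    hg.coeffAt_zero, hf.coeffAt_one_zero, hg.coeffAt_one_zero,
    coeffAt_eq_zero_of_lt_abs hg.mem_filtration]

theorem coeffAt_three_one_mul :
    coeffAt 3 1 (f * g) = coeffAt 1 1 f * coeffAt 2 0 g + coeffAt 1 (-1) f * coeffAt 2 2 g
      + coeffAt 2 0 f * coeffAt 1 1 g + coeffAt 2 2 f * coeffAt 1 (-1) g := by
  rw [coeffAt_mul hf.mem_filtration]
  simp [Finset.Nat.antidiagonal_succ, Icc_neg_one_one, Icc_neg_two_two, hf.coeffAt_zero,
    hg.coeffAt_zero, hf.coeffAt_one_zero, hg.coeffAt_one_zero,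
    coeffAt_eq_zero_of_lt_abs hg.mem_filtration]
  ring

theorem coeffAt_four_one_mul :
    coeffAt 4 1 (f * g) = coeffAt 1 1 f * coeffAt 3 0 g + coeffAt 1 (-1) f * coeffAt 3 2 g
      + coeffAt 2 (-1) f * coeffAt 2 2 g + coeffAt 2 0 f * coeffAt 2 1 g
      + coeffAt 2 1 f * coeffAt 2 0 g + coeffAt 2 2 f * coeffAt 2 (-1) g
      + coeffAt 3 0 f * coeffAt 1 1 g + coeffAt 3 2 f * coeffAt 1 (-1) g := by
  rw [coeffAt_mul hf.mem_filtration]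
  simp [Finset.Nat.antidiagonal_succ, Icc_neg_one_one, Icc_neg_two_two, Icc_neg_three_three,
    hf.coeffAt_zero, hg.coeffAt_zero, hf.coeffAt_one_zero, hg.coeffAt_one_zero,
    coeffAt_eq_zero_of_lt_abs hg.mem_filtration]
  ring

variable (hh : IsWave 1 h)
include hh

theorem coeffAt_three_one_mul_mul :
    coeffAt 3 1 (f * g * h) =
      coeffAt 1 1 f * coeffAt 1 1 g * coeffAt 1 (-1) h
      + coeffAt 1 1 f * coeffAt 1 (-1) g * coeffAt 1 1 h
      + coeffAt 1 (-1) f * coeffAt 1 1 g * coeffAt 1 1 h := by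
  have hfg : IsWave 2 (f * g) := hf.mul hg
  rw [coeffAt_three_one_mul (hfg.mono one_le_two) hh, coeffAt_two_zero_mul hf hg,
    coeffAt_two_two_mul hf hg]
  simp only [coeffAt_eq_zero_of_lt hfg.mem_filtration one_lt_two]
  ring

theorem coeffAt_four_one_mul_mul :
    coeffAt 4 1 (f * g * h) =
      coeffAt 1 1 f * coeffAt 1 1 g * coeffAt 2 (-1) h
      + coeffAt 1 1 f * coeffAt 1 (-1) g * coeffAt 2 1 h
      + coeffAt 1 (-1) f * coeffAt 1 1 g * coeffAt 2 1 h
      + coeffAt 1 1 f * coeffAt 2 (-1) g * coeffAt 1 1 h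
      + coeffAt 1 1 f * coeffAt 2 1 g * coeffAt 1 (-1) h
      + coeffAt 1 (-1) f * coeffAt 2 1 g * coeffAt 1 1 h
      + coeffAt 2 (-1) f * coeffAt 1 1 g * coeffAt 1 1 h
      + coeffAt 2 1 f * coeffAt 1 (-1) g * coeffAt 1 1 h
      + coeffAt 2 1 f * coeffAt 1 1 g * coeffAt 1 (-1) h := by
  have hfg : IsWave 2 (f * g) := hf.mul hg
  rw [coeffAt_four_one_mul (hfg.mono one_le_two) hh, hfg.coeffAt_of_odd 1 (by decide),
    hfg.coeffAt_of_odd (-1) (by decide), coeffAt_two_zero_mul hf hg, coeffAt_two_two_mul hf hg,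
    coeffAt_three_zero_mul hf hg, coeffAt_three_two_mul hf hg]
  simp only [coeffAt_eq_zero_of_lt hfg.mem_filtration one_lt_two]
  ring

end products

end DiffPoly

namespace QCoeffs

/-! ### Weighted sums over the corners of a cell -/

section sums

variable (p : QCoeffs) {M M' : Type*} [AddCommGroup M] [Module ℝ M] [AddCommGroup M'] [Module ℝ M']

/-- The linear part of the equation; the lattice points `(0,0)`, `(1,0)`, `(0,1)`, `(1,1)` are
numbered `0`, `1`, `2`, `3`. -/
def linSum (x : Fin 4 → M) : M := p.a₁ • (x 0 + x 3) + p.a₂ • (x 1 + x 2)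

/-- The sum over pairs of lattice points, with the quadratic coefficients as weights. -/
def pairSum (B : Fin 4 → Fin 4 → M) : M :=
  (p.α₁ - p.α₂) • B 0 1 + (p.α₁ + p.α₂) • B 2 3 + (p.β₁ - p.β₂) • B 0 2 + (p.β₁ + p.β₂) • B 1 3
    + p.γ₁ • B 0 3 + p.γ₂ • B 1 2

/-- The sum over triples of lattice points, with the cubic coefficients as weights. -/
def tripleSum (B : Fin 4 → Fin 4 → Fin 4 → M) : M :=
  (p.ξ₁ - p.ξ₃) • B 0 1 2 + (p.ξ₁ + p.ξ₃) • B 0 1 3 + (p.ξ₂ - p.ξ₄) • B 1 2 3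
    + (p.ξ₂ + p.ξ₄) • B 0 2 3

theorem quad_eq {A : Type*} [CommRing A] [Algebra ℝ A] (x : Fin 4 → A) :
    p.quad (x 0) (x 1) (x 2) (x 3) = p.linSum x + p.pairSum (fun c d => x c * x d)
      + p.tripleSum (fun c d e => x c * x d * x e) + p.ζ • (x 0 * x 1 * x 2 * x 3) := by
  simp only [quad, linSum, pairSum, tripleSum]
  abel

theorem map_quad {A A' : Type*} [CommRing A] [Algebra ℝ A] [CommRing A'] [Algebra ℝ A']
    (φ : A →ₐ[ℝ] A') (x y z w : A) : φ (p.quad x y z w) = p.quad (φ x) (φ y) (φ z) (φ w) := by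
  simp only [quad, map_add, map_smul, map_mul]

theorem map_linSum (φ : M →ₗ[ℝ] M') (x : Fin 4 → M) :
    φ (p.linSum x) = p.linSum fun c => φ (x c) := by
  simp only [linSum, map_add, map_smul]

theorem map_pairSum (φ : M →ₗ[ℝ] M') (B : Fin 4 → Fin 4 → M) :
    φ (p.pairSum B) = p.pairSum fun c d => φ (B c d) := by
  simp only [pairSum, map_add, map_smul]

theorem map_tripleSum (φ : M →ₗ[ℝ] M') (B : Fin 4 → Fin 4 → Fin 4 → M) :
    φ (p.tripleSum B) = p.tripleSum fun c d e => φ (B c d e) := by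
  simp only [tripleSum, map_add, map_smul]

theorem linSum_add (x y : Fin 4 → M) :
    p.linSum (fun c => x c + y c) = p.linSum x + p.linSum y := by
  simp only [linSum, smul_add]; abel

theorem pairSum_add (B B' : Fin 4 → Fin 4 → M) :
    p.pairSum (fun c d => B c d + B' c d) = p.pairSum B + p.pairSum B' := by
  simp only [pairSum, smul_add]; abel

theorem tripleSum_add (B B' : Fin 4 → Fin 4 → Fin 4 → M) :
    p.tripleSum (fun c d e => B c d e + B' c d e) = p.tripleSum B + p.tripleSum B' := by
  simp only [tripleSum, smul_add]; abel

theorem linSum_sub (x y : Fin 4 → M) :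
    p.linSum (fun c => x c - y c) = p.linSum x - p.linSum y := by
  simp only [linSum, smul_add, smul_sub]; abel

theorem pairSum_sub (B B' : Fin 4 → Fin 4 → M) :
    p.pairSum (fun c d => B c d - B' c d) = p.pairSum B - p.pairSum B' := by
  simp only [pairSum, smul_sub]; abel

theorem tripleSum_sub (B B' : Fin 4 → Fin 4 → Fin 4 → M) :
    p.tripleSum (fun c d e => B c d e - B' c d e) = p.tripleSum B - p.tripleSum B' := by
  simp only [tripleSum, smul_sub]; abel

variable {S : Submodule ℝ M}

theorem linSum_mem {x : Fin 4 → M} (hx : ∀ c, x c ∈ S) : p.linSum x ∈ S :=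
  S.add_mem (S.smul_mem _ (S.add_mem (hx 0) (hx 3))) (S.smul_mem _ (S.add_mem (hx 1) (hx 2)))

theorem pairSum_mem {B : Fin 4 → Fin 4 → M} (hB : ∀ c d, B c d ∈ S) : p.pairSum B ∈ S := by
  unfold pairSum
  refine S.add_mem (S.add_mem (S.add_mem (S.add_mem (S.add_mem ?_ ?_) ?_) ?_) ?_) ?_ <;>
  exact S.smul_mem _ (hB _ _)

theorem tripleSum_mem {B : Fin 4 → Fin 4 → Fin 4 → M} (hB : ∀ c d e, B c d e ∈ S) :
    p.tripleSum B ∈ S := by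
  unfold tripleSum
  refine S.add_mem (S.add_mem (S.add_mem ?_ ?_) ?_) ?_ <;> exact S.smul_mem _ (hB _ _ _)

end sums

end QCoeffs

namespace DiffPoly

/-! ### Complex conjugation -/

@[simp] theorem conj_C (z : ℂ) : conj (MvPolynomial.C z) = MvPolynomial.C (starRingEnd ℂ z) := by
  simp [conj]

@[simp] theorem conj_const (z : ℂ) : conj (const z) = const (starRingEnd ℂ z) := conj_C z

@[simp] theorem conj_u (j k : ℕ) : conj (u j k) = ubar j k := by simp [conj, u]

@[simp] theorem conj_ubar (j k : ℕ) : conj (ubar j k) = u j k := by simp [conj, ubar]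

theorem conj_conj (f : DiffPoly) : conj (conj f) = f := by
  suffices h : conj.comp conj = RingHom.id DiffPoly from DFunLike.congr_fun h f
  refine MvPolynomial.ringHom_ext (fun z => ?_) fun i => ?_
  · simp
  · cases i with
    | amp j k => exact (congrArg conj (conj_u j k)).trans (conj_ubar j k)
    | ampBar j k => exact (congrArg conj (conj_ubar j k)).trans (conj_u j k)

/-- Complex conjugation as a real-linear algebra automorphism of the coefficients. -/
def conjₐ : DiffPoly →ₐ[ℝ] DiffPoly where
  toRingHom := conj
  commutes' r := (conj_C _).trans (congrArg MvPolynomial.C (Complex.conj_ofReal r))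

theorem conj_smul (r : ℝ) (f : DiffPoly) : conj (r • f) = r • conj f := map_smul conjₐ r f

theorem conj_complex_smul (z : ℂ) (f : DiffPoly) : conj (z • f) = starRingEnd ℂ z • conj f := by
  rw [MvPolynomial.smul_eq_C_mul, MvPolynomial.smul_eq_C_mul, map_mul, conj_C]

theorem conj_derivation (D : Derivation ℂ DiffPoly DiffPoly)
    (hD : ∀ i, conj (D (MvPolynomial.X i)) = D (conj (MvPolynomial.X i))) (f : DiffPoly) :
    conj (D f) = D (conj f) := by
  induction f using MvPolynomial.induction_on with
  | C a => rw [conj_C, MvPolynomial.derivation_C, MvPolynomial.derivation_C, map_zero]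
  | add f g hf hg => rw [map_add, map_add, map_add, map_add, hf, hg]
  | mul_X f i hf =>
    rw [Derivation.leibniz, map_mul conj, Derivation.leibniz, map_add, smul_eq_mul, smul_eq_mul,
      smul_eq_mul, smul_eq_mul, map_mul, map_mul, hD, hf]

@[simp] theorem dξ_u (j k : ℕ) : dξ (u j k) = u j (k + 1) := by
  rw [u, dξ, MvPolynomial.mkDerivation_X]

@[simp] theorem dξ_ubar (j k : ℕ) : dξ (ubar j k) = ubar j (k + 1) := by
  rw [ubar, dξ, MvPolynomial.mkDerivation_X]

@[simp] theorem dξ_const (z : ℂ) : dξ (const z) = 0 := MvPolynomial.derivation_C _ _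

theorem flow_u (F : ℕ → DiffPoly) (j k : ℕ) : flow F (u j k) = dξ^[k] (F j) := by
  rw [u, flow, MvPolynomial.mkDerivation_X]

theorem flow_ubar (F : ℕ → DiffPoly) (j k : ℕ) : flow F (ubar j k) = dξ^[k] (conj (F j)) := by
  rw [ubar, flow, MvPolynomial.mkDerivation_X]

theorem conj_dξ (f : DiffPoly) : conj (dξ f) = dξ (conj f) := by
  refine conj_derivation dξ (fun i => ?_) f
  cases i with
  | amp j k => rw [← u, dξ_u, conj_u, conj_u, dξ_ubar]
  | ampBar j k => rw [← ubar, dξ_ubar, conj_ubar, conj_ubar, dξ_u]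

theorem conj_dξ_iterate (k : ℕ) (f : DiffPoly) : conj (dξ^[k] f) = dξ^[k] (conj f) :=
  (Function.Semiconj.iterate_right conj_dξ k) f

theorem conj_flow (F : ℕ → DiffPoly) (f : DiffPoly) : conj (flow F f) = flow F (conj f) := by
  refine conj_derivation _ (fun i => ?_) f
  cases i with
  | amp j k => rw [← u, conj_u, flow_u, flow_ubar, conj_dξ_iterate]
  | ampBar j k => rw [← ubar, conj_ubar, flow_u, flow_ubar, conj_dξ_iterate, conj_conj]

theorem conj_shiftOp {δ₁ δ₂ δ₃ : Derivation ℂ DiffPoly DiffPoly}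
    (h₁ : ∀ f, conj (δ₁ f) = δ₁ (conj f)) (h₂ : ∀ f, conj (δ₂ f) = δ₂ (conj f))
    (h₃ : ∀ f, conj (δ₃ f) = δ₃ (conj f)) (i : ℕ) (f : DiffPoly) :
    conj (shiftOp δ₁ δ₂ δ₃ i f) = shiftOp δ₁ δ₂ δ₃ i (conj f) := by
  match i with
  | 0 => rfl
  | 1 => exact h₁ f
  | 2 => simp [shiftOp, conj_complex_smul, h₁, h₂, map_ofNat]
  | 3 => simp [shiftOp, conj_complex_smul, h₁, h₂, h₃, map_ofNat]
  | _ + 4 => simp [shiftOp]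

/-- Complex conjugation of expansions; it exchanges the harmonics `α` and `-α` since the carrier
has absolute value one, so its fixed points are the expansions of real fields. -/
def reflect : Expansion →ₐ[ℝ] Expansion :=
  PowerSeries.mapAlgHom ((AddMonoidAlgebra.mapAlgHom ℤ conjₐ).comp
    ((LaurentPolynomial.invert (R := DiffPoly)).toAlgHom.restrictScalars ℝ))

theorem coeffAt_reflect (j : ℕ) (α : ℤ) (f : Expansion) :
    coeffAt j α (reflect f) = conj (coeffAt j (-α) f) := by
  rw [coeffAt_apply, reflect, PowerSeries.mapAlgHom_apply, PowerSeries.coeff_map]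
  exact congrArg conj (LaurentPolynomial.invert_apply _ _)

theorem reflect_eq_self_iff {f : Expansion} :
    reflect f = f ↔ ∀ j α, coeffAt j (-α) f = conj (coeffAt j α f) := by
  refine ⟨fun h j α => ?_, fun h => PowerSeries.ext fun j => LaurentPolynomial.ext fun α => ?_⟩
  · conv_lhs => rw [← h, coeffAt_reflect, neg_neg]
  · exact (coeffAt_reflect j α f).trans (by rw [← h, neg_neg, coeffAt_apply])

/-! ### The field at the corners of a cell -/

/-- The operators describing a shift which acts by `s ∂_ξ` on the first slow scale, and by `t` times
the flows `F₂` and `F₃` on the next ones. -/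
def cornerOp (F₂ F₃ : ℕ → DiffPoly) (s t : ℝ) : ℕ → DiffPoly → DiffPoly :=
  shiftOp ((s : ℂ) • dξ) ((t : ℂ) • flow F₂) ((t : ℂ) • flow F₃)

theorem conj_cornerOp (F₂ F₃ : ℕ → DiffPoly) (s t : ℝ) (i : ℕ) (f : DiffPoly) :
    conj (cornerOp F₂ F₃ s t i f) = cornerOp F₂ F₃ s t i (conj f) := by
  refine conj_shiftOp (fun f => ?_) (fun f => ?_) (fun f => ?_) i f <;>
  simp [conj_smul, conj_dξ, conj_flow]

/-- Multiplication of constants with a fixed differential polynomial. -/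
def constMul (f : DiffPoly) : ℂ →ₗ[ℝ] DiffPoly :=
  (LinearMap.mulRight ℝ f).comp ((Algebra.linearMap ℂ DiffPoly).restrictScalars ℝ)

variable (op : ℕ → DiffPoly → DiffPoly) (z : ℂ) (h : ℕ → ℤ → DiffPoly)

theorem coeffAt_field (j : ℕ) (β : ℤ) :
    coeffAt j β (field op z h) =
      const (z ^ β) * ∑ ℓ ∈ Finset.Icc (max 1 β.natAbs) j, op (j - ℓ) (h ℓ β) := by
  have coeff_C_mul_T (c : DiffPoly) (α : ℤ) :
      (LaurentPolynomial.C c * LaurentPolynomial.T α).coeff β = if α = β then c else 0 := by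
    rw [← LaurentPolynomial.single_eq_C_mul_T]
    exact Finsupp.single_apply
  rw [coeffAt_apply, field, PowerSeries.coeff_mk, AddMonoidAlgebra.coeff_sum,
    Finsupp.finsetSum_apply]
  simp only [coeff_C_mul_T, Finset.sum_ite_eq', Finset.mem_Icc]
  split_ifs with hβ
  · rfl
  · rw [Finset.Icc_eq_empty (by omega), Finset.sum_empty, mul_zero]

theorem field_mem_filtration : field op z h ∈ filtration 1 := by
  refine mem_filtration.mpr fun j α hjα => ?_
  rw [Int.abs_eq_natAbs] at hjα
  rw [coeffAt_field, Finset.Icc_eq_empty (by omega), Finset.sum_empty, mul_zero]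

variable {op z h}

theorem reflect_field (hop : ∀ i f, conj (op i f) = op i (conj f)) (hz : starRingEnd ℂ z = z⁻¹)
    (hh : ∀ j α, h j (-α) = conj (h j α)) : reflect (field op z h) = field op z h := by
  refine reflect_eq_self_iff.mpr fun j α => ?_
  simp only [coeffAt_field, map_mul, conj_const, map_sum, map_zpow₀, hz, Int.natAbs_neg, zpow_neg,
    inv_zpow, hh, hop]

variable {h' : ℕ → ℤ → DiffPoly} {n : ℕ} (hh : ∀ ℓ ≤ n, ∀ α, h ℓ α = h' ℓ α)
include hh

theorem sum_op_congr (m j : ℕ) (hj : j ≤ n) (i : ℕ) (α : ℤ) :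
    ∑ ℓ ∈ Finset.Icc m j, op (i - ℓ) (h ℓ α) = ∑ ℓ ∈ Finset.Icc m j, op (i - ℓ) (h' ℓ α) :=
  Finset.sum_congr rfl fun ℓ hℓ => by rw [hh ℓ ((Finset.mem_Icc.mp hℓ).2.trans hj)]

theorem field_sub_field_mem_filtration :
    field op z h - field op z h' ∈ filtration (n + 1) := by
  refine mem_filtration.mpr fun j α hjα => ?_
  rw [map_sub, coeffAt_field, coeffAt_field, sub_eq_zero]
  obtain hj | hα := hjα
  · rw [sum_op_congr hh _ _ (Nat.lt_succ_iff.mp hj)]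
  · rw [Int.abs_eq_natAbs] at hα
    rw [Finset.Icc_eq_empty (by omega), Finset.sum_empty, Finset.sum_empty]

theorem coeffAt_field_sub_field (hop : ∀ f, op 0 f = f) {α : ℤ} (hα : α.natAbs ≤ n + 1) :
    coeffAt (n + 1) α (field op z h - field op z h') =
      const (z ^ α) * (h (n + 1) α - h' (n + 1) α) := by
  rw [map_sub, coeffAt_field, coeffAt_field, Finset.sum_Icc_succ_top (by omega),
    Finset.sum_Icc_succ_top (by omega), Nat.sub_self, hop, hop, sum_op_congr hh _ _ le_rfl,
    ← mul_sub, add_sub_add_left_eq_sub]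

end DiffPoly

namespace QCoeffs

open DiffPoly

variable (p : QCoeffs)

theorem quad_mem_filtration {x : Fin 4 → Expansion} (hx : ∀ c, x c ∈ filtration 1) :
    p.quad (x 0) (x 1) (x 2) (x 3) ∈ filtration 1 := by
  have mul_mem {k : ℕ} {y y' : Expansion} (hy : y ∈ filtration (k + 1)) (hy' : y' ∈ filtration 1) :
      y * y' ∈ filtration 1 := filtration_antitone (by omega) (mul_mem_filtration hy hy')
  have hxx c d := mul_mem (hx c) (hx d)
  have hxxx c d e := mul_mem (hxx c d) (hx e)
  rw [quad_eq]
  exact add_mem (add_mem (add_mem (p.linSum_mem hx) (p.pairSum_mem hxx)) (p.tripleSum_mem hxxx))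
    (Submodule.smul_mem _ _ (mul_mem (hxxx 0 1 2) (hx 3)))

/-- The nonlinear terms raise the order in `ε`, so that a perturbation of the fields enters the
equation to leading order through its linear part only. -/
theorem quad_sub_quad_sub_linSum_mem_filtration {n : ℕ} {x x' : Fin 4 → Expansion}
    (hx : ∀ c, x c ∈ filtration 1) (hx' : ∀ c, x' c ∈ filtration 1)
    (hsub : ∀ c, x c - x' c ∈ filtration (1 + n)) :
    p.quad (x 0) (x 1) (x 2) (x 3) - p.quad (x' 0) (x' 1) (x' 2) (x' 3)
      - p.linSum (fun c => x c - x' c) ∈ filtration (2 + n) := by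
  have hxx' c d := mul_mem_filtration (hx' c) (hx' d)
  have hxx c d := mul_sub_mul_mem_filtration (hsub c) (hx' c) (hx d) (hsub d)
  have hxxx c d e := mul_sub_mul_mem_filtration (hxx c d) (hxx' c d) (hx e) (hsub e)
  have hxxxx := mul_sub_mul_mem_filtration (hxxx 0 1 2)
    (mul_mem_filtration (hxx' 0 1) (hx' 2)) (hx 3) (hsub 3)
  have hexpand : p.quad (x 0) (x 1) (x 2) (x 3) - p.quad (x' 0) (x' 1) (x' 2) (x' 3)
      - p.linSum (fun c => x c - x' c) =
      p.pairSum (fun c d => x c * x d - x' c * x' d)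
        + p.tripleSum (fun c d e => x c * x d * x e - x' c * x' d * x' e)
        + p.ζ • (x 0 * x 1 * x 2 * x 3 - x' 0 * x' 1 * x' 2 * x' 3) := by
    rw [quad_eq, quad_eq, linSum_sub, pairSum_sub, tripleSum_sub, smul_sub]
    abel
  rw [hexpand]
  exact add_mem (add_mem (p.pairSum_mem hxx)
    (p.tripleSum_mem fun c d e => filtration_antitone (by omega) (hxxx c d e)))
    (Submodule.smul_mem _ _ (filtration_antitone (by omega) hxxxx))

/-- The left-hand side of the equation, for a field with carrier factors `z` and slow shifts `s`,
`t` at the four lattice points. -/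
def cornerExpansion (p : QCoeffs) (z : Fin 4 → ℂ) (s t : Fin 4 → ℝ) (F₂ F₃ : ℕ → DiffPoly)
    (h : ℕ → ℤ → DiffPoly) : Expansion :=
  p.quad (field (cornerOp F₂ F₃ (s 0) (t 0)) (z 0) h) (field (cornerOp F₂ F₃ (s 1) (t 1)) (z 1) h)
    (field (cornerOp F₂ F₃ (s 2) (t 2)) (z 2) h) (field (cornerOp F₂ F₃ (s 3) (t 3)) (z 3) h)

theorem expansion_eq_cornerExpansion (κ ω v : ℝ) (F₂ F₃ : ℕ → DiffPoly) (h : ℕ → ℤ → DiffPoly) :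
    p.expansion κ ω v F₂ F₃ h =
      p.cornerExpansion ![1, carrierK κ, carrierΩ ω, carrierK κ * carrierΩ ω] ![0, 1, -v, 1 - v]
        ![0, 0, 1, 1] F₂ F₃ h := by
  have hshift : dξ + (-(v : ℂ)) • dξ = ((1 - v : ℝ) : ℂ) • dξ := by
    push_cast
    module
  simp only [expansion, cornerExpansion, cornerOp, hshift]
  simp

theorem linSum_const (x : Fin 4 → ℂ) (f : DiffPoly) :
    p.linSum (fun c => const (x c) * f) = const (p.linSum x) * f :=
  (p.map_linSum (constMul f) x).symm

theorem conj_linSum (x : Fin 4 → ℂ) :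
    starRingEnd ℂ (p.linSum x) = p.linSum fun c => starRingEnd ℂ (x c) :=
  p.map_linSum Complex.conjAe.toLinearMap x

section harmonics

variable {p} {z : Fin 4 → ℂ} {s t : Fin 4 → ℝ} {F₂ F₃ : ℕ → DiffPoly} {h : ℕ → ℤ → DiffPoly}

theorem cornerExpansion_mem_filtration : p.cornerExpansion z s t F₂ F₃ h ∈ filtration 1 :=
  p.quad_mem_filtration (x := fun c => field (cornerOp F₂ F₃ (s c) (t c)) (z c) h)
    fun _ => field_mem_filtration _ _ _

theorem cornerExpansion_sub_mem_filtration {h' : ℕ → ℤ → DiffPoly} {n : ℕ}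
    (hh : ∀ ℓ ≤ n, ∀ α, h ℓ α = h' ℓ α) :
    p.cornerExpansion z s t F₂ F₃ h - p.cornerExpansion z s t F₂ F₃ h'
      - p.linSum (fun c => field (cornerOp F₂ F₃ (s c) (t c)) (z c) h
        - field (cornerOp F₂ F₃ (s c) (t c)) (z c) h') ∈ filtration (2 + n) :=
  p.quad_sub_quad_sub_linSum_mem_filtration
    (x := fun c => field (cornerOp F₂ F₃ (s c) (t c)) (z c) h)
    (x' := fun c => field (cornerOp F₂ F₃ (s c) (t c)) (z c) h')
    (fun _ => field_mem_filtration _ _ _) (fun _ => field_mem_filtration _ _ _)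
    fun _ => add_comm n 1 ▸ field_sub_field_mem_filtration hh

theorem coeffAt_cornerExpansion_congr {h' : ℕ → ℤ → DiffPoly} {n : ℕ}
    (hh : ∀ ℓ ≤ n, ∀ α, h ℓ α = h' ℓ α) {j : ℕ} (hj : j ≤ n) (α : ℤ) :
    coeffAt j α (p.cornerExpansion z s t F₂ F₃ h) =
      coeffAt j α (p.cornerExpansion z s t F₂ F₃ h') := by
  have hlin : p.linSum (fun c => field (cornerOp F₂ F₃ (s c) (t c)) (z c) h
      - field (cornerOp F₂ F₃ (s c) (t c)) (z c) h') ∈ filtration (n + 1) :=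
    p.linSum_mem fun _ => field_sub_field_mem_filtration hh
  have hrest := coeffAt_eq_zero_of_lt (cornerExpansion_sub_mem_filtration (p := p) (z := z)
    (s := s) (t := t) (F₂ := F₂) (F₃ := F₃) hh) (by omega : j < 2 + n) α
  rwa [map_sub, coeffAt_eq_zero_of_lt hlin (Nat.lt_succ_of_le hj), sub_zero, map_sub,
    sub_eq_zero] at hrest

theorem coeffAt_cornerExpansion_succ {h' : ℕ → ℤ → DiffPoly} {n : ℕ}
    (hh : ∀ ℓ ≤ n, ∀ α, h ℓ α = h' ℓ α) {α : ℤ} (hα : α.natAbs ≤ n + 1) :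
    coeffAt (n + 1) α (p.cornerExpansion z s t F₂ F₃ h) =
      coeffAt (n + 1) α (p.cornerExpansion z s t F₂ F₃ h')
        + const (p.linSum fun c => z c ^ α) * (h (n + 1) α - h' (n + 1) α) := by
  have hrest := coeffAt_eq_zero_of_lt (cornerExpansion_sub_mem_filtration (p := p) (z := z)
    (s := s) (t := t) (F₂ := F₂) (F₃ := F₃) hh) (by omega : n + 1 < 2 + n) α
  rw [map_sub, map_linSum, map_sub, sub_eq_zero, sub_eq_iff_eq_add'] at hrest
  rw [hrest]
  simp only [coeffAt_field_sub_field hh (op := cornerOp F₂ F₃ _ _) (fun _ => rfl) hα, linSum_const]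

/-- The first harmonics are the free amplitudes `u(j)`, and the field is real. -/
structure IsAnsatz (h : ℕ → ℤ → DiffPoly) : Prop where
  first : ∀ j, h j 1 = u j 0
  neg : ∀ j α, h j (-α) = conj (h j α)

theorem IsAnsatz.neg_first (hh : IsAnsatz h) (j : ℕ) : h j (-1) = ubar j 0 := by
  rw [hh.neg, hh.first, conj_u]

theorem reflect_cornerExpansion (hz : ∀ c, starRingEnd ℂ (z c) = (z c)⁻¹) (hh : IsAnsatz h) :
    reflect (p.cornerExpansion z s t F₂ F₃ h) = p.cornerExpansion z s t F₂ F₃ h := by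
  simp only [cornerExpansion, map_quad, reflect_field (conj_cornerOp _ _ _ _) (hz _) hh.neg]

theorem conj_linSum_zpow (hz : ∀ c, starRingEnd ℂ (z c) = (z c)⁻¹) (α : ℤ) :
    starRingEnd ℂ (p.linSum fun c => z c ^ α) = p.linSum fun c => z c ^ (-α) := by
  simp only [conj_linSum, map_zpow₀, hz, inv_zpow, zpow_neg]

/-- The harmonic which, when it replaces `f α`, solves the equation with linear symbol `L` and
residue `W`; the first harmonics are resonant and stay free. -/
def solvedHarmonic (L : ℤ → ℂ) (W f : ℤ → DiffPoly) (α : ℤ) : DiffPoly :=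
  if α = 1 ∨ α = -1 then f α else f α - const (L α)⁻¹ * W α

theorem IsAnsatz.update_solvedHarmonic (hh : IsAnsatz h) {L : ℤ → ℂ} {W : ℤ → DiffPoly}
    (hL : ∀ α, starRingEnd ℂ (L α) = L (-α)) (hW : ∀ α, W (-α) = conj (W α)) (n : ℕ) :
    IsAnsatz (Function.update h n (solvedHarmonic L W (h n))) where
  first j := by
    obtain rfl | hj := eq_or_ne j n
    · rw [Function.update_self, solvedHarmonic, if_pos (.inl rfl), hh.first]
    · rw [Function.update_of_ne hj, hh.first]
  neg j α := by
    obtain rfl | hj := eq_or_ne j n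
    · simp only [Function.update_self, solvedHarmonic, apply_ite conj, map_sub, map_mul,
        conj_const, map_inv₀, hL, hW, hh.neg, neg_eq_iff_eq_neg, neg_neg, or_comm (a := α = -1)]
    · rw [Function.update_of_ne hj, hh.neg]

theorem exists_isAnsatz : ∃ h, IsAnsatz h :=
  ⟨fun j α => if α = 1 then u j 0 else if α = -1 then ubar j 0 else 0, fun j => if_pos rfl,
    fun j α => by split_ifs <;> first | omega | simp⟩

theorem exists_isAnsatz_succ (hz : ∀ c, starRingEnd ℂ (z c) = (z c)⁻¹) (hh : IsAnsatz h) {n : ℕ}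
    (hL : ∀ α : ℤ, α ≠ 1 → α ≠ -1 → α.natAbs ≤ n + 1 → p.linSum (fun c => z c ^ α) ≠ 0) :
    ∃ h', IsAnsatz h' ∧ (∀ ℓ ≤ n, ∀ α, h' ℓ α = h ℓ α) ∧
      ∀ α, α ≠ 1 → α ≠ -1 → coeffAt (n + 1) α (p.cornerExpansion z s t F₂ F₃ h') = 0 := by
  set W := fun α => coeffAt (n + 1) α (p.cornerExpansion z s t F₂ F₃ h)
  set L := fun α : ℤ => p.linSum fun c => z c ^ α
  set h' := Function.update h (n + 1) (solvedHarmonic L W (h (n + 1)))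
  have hagree : ∀ ℓ ≤ n, ∀ α, h' ℓ α = h ℓ α := fun ℓ hℓ α =>
    congrFun (Function.update_of_ne (Nat.lt_succ_of_le hℓ).ne _ _) α
  refine ⟨h', hh.update_solvedHarmonic (conj_linSum_zpow hz)
    (reflect_eq_self_iff.mp (reflect_cornerExpansion hz hh) (n + 1)) (n + 1), hagree,
    fun α hα hα' => ?_⟩
  by_cases hle : α.natAbs ≤ n + 1
  · have hcancel : const (L α) * const (L α)⁻¹ = 1 := by
      rw [const, const, ← MvPolynomial.C_mul, mul_inv_cancel₀ (hL α hα hα' hle), MvPolynomial.C_1]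
    rw [coeffAt_cornerExpansion_succ hagree hle]
    simp only [h', Function.update_self, solvedHarmonic, hα, hα', or_self, if_false,
      sub_sub_cancel_left, mul_neg]
    linear_combination (-W α) * hcancel
  · exact coeffAt_eq_zero_of_lt_abs cornerExpansion_mem_filtration
      (by rw [Int.abs_eq_natAbs]; omega)

theorem exists_harmonics (p : QCoeffs) (s t : Fin 4 → ℝ) (F₂ F₃ : ℕ → DiffPoly)
    (hz : ∀ c, starRingEnd ℂ (z c) = (z c)⁻¹) (N : ℕ)
    (hL : ∀ α : ℤ, α ≠ 1 → α ≠ -1 → α.natAbs ≤ N → p.linSum (fun c => z c ^ α) ≠ 0) :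
    ∃ h, IsAnsatz h ∧
      ∀ j ≤ N, ∀ α, α ≠ 1 → α ≠ -1 → coeffAt j α (p.cornerExpansion z s t F₂ F₃ h) = 0 := by
  induction N with
  | zero =>
    obtain ⟨h, hh⟩ := exists_isAnsatz
    exact ⟨h, hh, fun j hj α _ _ =>
      coeffAt_eq_zero_of_lt cornerExpansion_mem_filtration (Nat.lt_one_iff.mpr (by omega)) α⟩
  | succ n ih =>
    obtain ⟨h, hh, hsolved⟩ := ih fun α hα hα' hle => hL α hα hα' (by omega)
    obtain ⟨h', hh', hagree, htop⟩ := exists_isAnsatz_succ (s := s) (t := t) (F₂ := F₂) (F₃ := F₃)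
      hz hh hL
    refine ⟨h', hh', fun j hj α hα hα' => ?_⟩
    obtain hj | rfl := Nat.le_succ_iff.mp hj
    · rw [coeffAt_cornerExpansion_congr hagree hj, hsolved j hj α hα hα']
    · exact htop α hα hα'

end harmonics

end QCoeffs

namespace DiffPoly

theorem const_one : const 1 = 1 := MvPolynomial.C_1

theorem const_two : const 2 = 2 := map_ofNat MvPolynomial.C 2

theorem const_add (z w : ℂ) : const (z + w) = const z + const w := MvPolynomial.C_add

theorem const_mul (z w : ℂ) : const (z * w) = const z * const w := MvPolynomial.C_mul

theorem const_pow (z : ℂ) (n : ℕ) : const (z ^ n) = const z ^ n := MvPolynomial.C_pow z n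

theorem IsWave.coeffAt_eq_zero {k : ℕ} {f : Expansion} (hf : IsWave k f) {j : ℕ} {α : ℤ}
    (hj : j < k ∨ j = k ∧ Odd (α + k)) : coeffAt j α f = 0 := by
  obtain hlt | ⟨rfl, hα⟩ := hj
  · exact coeffAt_eq_zero_of_lt hf.mem_filtration hlt α
  · exact hf.coeffAt_of_odd α hα

end DiffPoly

namespace QCoeffs

open DiffPoly

variable (p : QCoeffs)

section waves

variable {x : Fin 4 → Expansion} (hx : ∀ c, IsWave 1 (x c)) {j : ℕ} {α : ℤ}
include hx

theorem coeffAt_quad_of_four (hj : j < 4 ∨ j = 4 ∧ Odd (α + 4)) :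
    coeffAt j α (p.quad (x 0) (x 1) (x 2) (x 3)) =
      p.linSum (fun c => coeffAt j α (x c)) + p.pairSum (fun c d => coeffAt j α (x c * x d))
        + p.tripleSum fun c d e => coeffAt j α (x c * x d * x e) := by
  rw [quad_eq, map_add, map_add, map_add, map_linSum, map_pairSum, map_tripleSum, map_smul,
    ((((hx 0).mul (hx 1)).mul (hx 2)).mul (hx 3)).coeffAt_eq_zero hj, smul_zero, add_zero]

theorem coeffAt_quad_of_three (hj : j < 3 ∨ j = 3 ∧ Odd (α + 3)) :
    coeffAt j α (p.quad (x 0) (x 1) (x 2) (x 3)) =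
      p.linSum (fun c => coeffAt j α (x c)) + p.pairSum fun c d => coeffAt j α (x c * x d) := by
  have triple_eq_zero (c d e : Fin 4) : coeffAt j α (x c * x d * x e) = 0 :=
    (((hx c).mul (hx d)).mul (hx e)).coeffAt_eq_zero hj
  rw [p.coeffAt_quad_of_four hx (by omega)]
  simp [triple_eq_zero, tripleSum]

theorem coeffAt_quad_of_two (hj : j < 2 ∨ j = 2 ∧ Odd (α + 2)) :
    coeffAt j α (p.quad (x 0) (x 1) (x 2) (x 3)) = p.linSum fun c => coeffAt j α (x c) := by
  have pair_eq_zero (c d : Fin 4) : coeffAt j α (x c * x d) = 0 :=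
    ((hx c).mul (hx d)).coeffAt_eq_zero hj
  rw [p.coeffAt_quad_of_three hx (by omega)]
  simp [pair_eq_zero, pairSum]

end waves

theorem linSum_const_add (x : Fin 4 → ℂ) (f : DiffPoly) (y : Fin 4 → DiffPoly) :
    p.linSum (fun c => const (x c) * f + y c) = const (p.linSum x) * f + p.linSum y := by
  rw [linSum_add, linSum_const]

theorem pairSum_const (B : Fin 4 → Fin 4 → ℂ) (f : DiffPoly) :
    p.pairSum (fun c d => const (B c d) * f) = const (p.pairSum B) * f :=
  (p.map_pairSum (constMul f) B).symm

theorem pairSum_const_add (B : Fin 4 → Fin 4 → ℂ) (f : DiffPoly) (B' : Fin 4 → Fin 4 → DiffPoly) :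
    p.pairSum (fun c d => const (B c d) * f + B' c d)
      = const (p.pairSum B) * f + p.pairSum B' := by
  rw [pairSum_add, pairSum_const]

theorem tripleSum_const (B : Fin 4 → Fin 4 → Fin 4 → ℂ) (f : DiffPoly) :
    p.tripleSum (fun c d e => const (B c d e) * f) = const (p.tripleSum B) * f :=
  (p.map_tripleSum (constMul f) B).symm

theorem tripleSum_const_add (B : Fin 4 → Fin 4 → Fin 4 → ℂ) (f : DiffPoly)
    (B' : Fin 4 → Fin 4 → Fin 4 → DiffPoly) :
    p.tripleSum (fun c d e => const (B c d e) * f + B' c d e)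
      = const (p.tripleSum B) * f + p.tripleSum B' := by
  rw [tripleSum_add, tripleSum_const]

theorem mul_linSum (w : ℂ) (y : Fin 4 → ℂ) : w * p.linSum y = p.linSum fun c => w * y c :=
  p.map_linSum (LinearMap.mulLeft ℝ w) y

end QCoeffs

/-! ### The field at a corner of the cell -/

namespace DiffPoly

section cornerOp

variable (F₂ F₃ : ℕ → DiffPoly) (s t : ℝ) (f : DiffPoly)

theorem cornerOp_zero : cornerOp F₂ F₃ s t 0 f = f := rfl

theorem cornerOp_one : cornerOp F₂ F₃ s t 1 f = const s * dξ f := by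
  simp [cornerOp, shiftOp, const, Algebra.smul_def]

theorem cornerOp_two :
    cornerOp F₂ F₃ s t 2 f =
      const (s ^ 2) * (const (1 / 2) * dξ (dξ f)) + const t * flow F₂ f := by
  simp only [cornerOp, shiftOp, const, Derivation.smul_apply, Derivation.map_smul]
  simp only [MvPolynomial.smul_eq_C_mul, MvPolynomial.C_pow]
  ring

theorem cornerOp_three :
    cornerOp F₂ F₃ s t 3 f = const (s ^ 3) * (const (1 / 6) * dξ (dξ (dξ f)))
      + const (s * t) * dξ (flow F₂ f) + const t * flow F₃ f := by
  simp only [cornerOp, shiftOp, const, Derivation.smul_apply, Derivation.map_smul]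
  simp only [MvPolynomial.smul_eq_C_mul, MvPolynomial.C_pow, MvPolynomial.C_mul]
  ring

end cornerOp

/-- The field at a corner of the cell, where the carrier is multiplied by `z` and the slow
variables are shifted by `s` and `t`. -/
def cornerField (F₂ F₃ : ℕ → DiffPoly) (z : ℂ) (s t : ℝ) (h : ℕ → ℤ → DiffPoly) : Expansion :=
  field (cornerOp F₂ F₃ s t) z h

open QCoeffs (IsAnsatz)

section cornerField

variable {F₂ F₃ : ℕ → DiffPoly} {z : ℂ} {s t : ℝ} {h : ℕ → ℤ → DiffPoly}

theorem coeffAt_one_cornerField (α : ℤ) (hα : α.natAbs ≤ 1) :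
    coeffAt 1 α (cornerField F₂ F₃ z s t h) = const (z ^ α) * h 1 α := by
  rw [cornerField, coeffAt_field, max_eq_left hα, Finset.Icc_self, Finset.sum_singleton,
    Nat.sub_self, cornerOp_zero]

theorem isWave_cornerField (h10 : h 1 0 = 0) : IsWave 1 (cornerField F₂ F₃ z s t h) where
  mem_filtration := field_mem_filtration _ _ _
  coeffAt_of_odd α hα := by
    obtain hlt | hle := lt_or_ge 1 α.natAbs
    · exact coeffAt_eq_zero_of_lt_abs (field_mem_filtration _ _ _)
        (by rw [Int.abs_eq_natAbs]; omega)
    · obtain rfl : α = 0 := by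
        rw [Nat.cast_one, Int.odd_iff] at hα
        omega
      rw [coeffAt_one_cornerField 0 hle, h10, mul_zero]

theorem coeffAt_two_two_cornerField :
    coeffAt 2 2 (cornerField F₂ F₃ z s t h) = const (z ^ 2) * h 2 2 := by
  rw [cornerField, coeffAt_field]
  simp [cornerOp_zero]

theorem coeffAt_three_two_cornerField :
    coeffAt 3 2 (cornerField F₂ F₃ z s t h) =
      const (z ^ 2) * (h 3 2 + const s * dξ (h 2 2)) := by
  have hIcc : Finset.Icc 2 3 = {2, 3} := by decide
  rw [cornerField, coeffAt_field]
  simp [hIcc, cornerOp_zero, cornerOp_one, add_comm]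

theorem coeffAt_two_zero_cornerField (h10 : h 1 0 = 0) :
    coeffAt 2 0 (cornerField F₂ F₃ z s t h) = h 2 0 := by
  have hIcc : Finset.Icc 1 2 = {1, 2} := by decide
  rw [cornerField, coeffAt_field]
  simp [hIcc, h10, cornerOp_zero, cornerOp_one, const_one]

theorem coeffAt_three_zero_cornerField (h10 : h 1 0 = 0) :
    coeffAt 3 0 (cornerField F₂ F₃ z s t h) = h 3 0 + const s * dξ (h 2 0) := by
  have hIcc : Finset.Icc 1 3 = {1, 2, 3} := by decide
  rw [cornerField, coeffAt_field]
  simp [hIcc, h10, cornerOp_zero, cornerOp_one, cornerOp_two, const_one, add_comm]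

variable (hh : IsAnsatz h)
include hh

theorem coeffAt_one_one_cornerField :
    coeffAt 1 1 (cornerField F₂ F₃ z s t h) = const z * u 1 0 := by
  rw [coeffAt_one_cornerField 1 le_rfl, hh.first, zpow_one]

theorem coeffAt_one_neg_one_cornerField :
    coeffAt 1 (-1) (cornerField F₂ F₃ z s t h) = const z⁻¹ * ubar 1 0 := by
  rw [coeffAt_one_cornerField (-1) le_rfl, hh.neg_first, zpow_neg_one]

theorem coeffAt_two_one_cornerField :
    coeffAt 2 1 (cornerField F₂ F₃ z s t h) = const z * (u 2 0 + const s * u 1 1) := by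
  have hIcc : Finset.Icc 1 2 = {1, 2} := by decide
  rw [cornerField, coeffAt_field]
  simp [hIcc, hh.first, cornerOp_zero, cornerOp_one, add_comm]

theorem coeffAt_two_neg_one_cornerField :
    coeffAt 2 (-1) (cornerField F₂ F₃ z s t h) = const z⁻¹ * (ubar 2 0 + const s * ubar 1 1) := by
  have hIcc : Finset.Icc 1 2 = {1, 2} := by decide
  rw [cornerField, coeffAt_field]
  simp [hIcc, hh.neg_first, cornerOp_zero, cornerOp_one, add_comm]

theorem coeffAt_three_one_cornerField :
    coeffAt 3 1 (cornerField F₂ F₃ z s t h) =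
      const z * (u 3 0 + const s * u 2 1 + const (s ^ 2) * (const (1 / 2) * u 1 2)
        + const t * F₂ 1) := by
  have hIcc : Finset.Icc 1 3 = {1, 2, 3} := by decide
  rw [cornerField, coeffAt_field]
  simp [hIcc, hh.first, cornerOp_zero, cornerOp_one, cornerOp_two, flow_u, -mul_eq_mul_left_iff]
  ring

theorem coeffAt_four_one_cornerField :
    coeffAt 4 1 (cornerField F₂ F₃ z s t h) =
      const z * (u 4 0 + const s * u 3 1 + const (s ^ 2) * (const (1 / 2) * u 2 2)
        + const t * F₂ 2 + const (s ^ 3) * (const (1 / 6) * u 1 3)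
        + const (s * t) * dξ (F₂ 1) + const t * F₃ 1) := by
  have hIcc : Finset.Icc 1 4 = {1, 2, 3, 4} := by decide
  rw [cornerField, coeffAt_field]
  simp [hIcc, hh.first, cornerOp_zero, cornerOp_one, cornerOp_two, cornerOp_three, flow_u,
    -mul_eq_mul_left_iff]
  ring

end cornerField

/-! ### The products of two and three corner fields -/

section products

variable {F₂ F₃ : ℕ → DiffPoly} {h : ℕ → ℤ → DiffPoly} (hh : IsAnsatz h) (h10 : h 1 0 = 0)
  (z : Fin 4 → ℂ) (s t : Fin 4 → ℝ) (c d e : Fin 4)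

local notation "x" => fun c => cornerField F₂ F₃ (z c) (s c) (t c) h

include hh h10

theorem coeffAt_two_zero_cornerField_mul :
    coeffAt 2 0 (x c * x d) = const (z c * (z d)⁻¹ + z d * (z c)⁻¹) * (u 1 0 * ubar 1 0) := by
  rw [coeffAt_two_zero_mul (isWave_cornerField h10) (isWave_cornerField h10)]
  simp only [coeffAt_one_one_cornerField hh, coeffAt_one_neg_one_cornerField hh, const_add,
    const_mul]
  ring

theorem coeffAt_two_two_cornerField_mul :
    coeffAt 2 2 (x c * x d) = const (z c * z d) * u 1 0 ^ 2 := by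
  rw [coeffAt_two_two_mul (isWave_cornerField h10) (isWave_cornerField h10)]
  simp only [coeffAt_one_one_cornerField hh, const_mul]
  ring

theorem coeffAt_three_zero_cornerField_mul :
    coeffAt 3 0 (x c * x d) =
      const (z c * (z d)⁻¹ + z d * (z c)⁻¹) * (u 1 0 * ubar 2 0 + u 2 0 * ubar 1 0)
      + (const (z c * (z d)⁻¹ * s c + z d * (z c)⁻¹ * s d) * (u 1 1 * ubar 1 0)
      + const (z c * (z d)⁻¹ * s d + z d * (z c)⁻¹ * s c) * (u 1 0 * ubar 1 1)) := by
  rw [coeffAt_three_zero_mul (isWave_cornerField h10) (isWave_cornerField h10)]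
  simp only [coeffAt_one_one_cornerField hh, coeffAt_one_neg_one_cornerField hh,
    coeffAt_two_one_cornerField hh, coeffAt_two_neg_one_cornerField hh, const_add, const_mul]
  ring

theorem coeffAt_three_two_cornerField_mul :
    coeffAt 3 2 (x c * x d) =
      const (z c * z d) * (2 * u 1 0 * u 2 0)
      + const (z c * z d * (s c + s d)) * (u 1 0 * u 1 1) := by
  rw [coeffAt_three_two_mul (isWave_cornerField h10) (isWave_cornerField h10)]
  simp only [coeffAt_one_one_cornerField hh, coeffAt_two_one_cornerField hh, const_add, const_mul]
  ring

theorem coeffAt_three_one_cornerField_mul_mul :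
    coeffAt 3 1 (x c * x d * x e) =
      const (z c * z d * (z e)⁻¹ + z c * z e * (z d)⁻¹ + z d * z e * (z c)⁻¹)
        * (u 1 0 ^ 2 * ubar 1 0) := by
  rw [coeffAt_three_one_mul_mul (isWave_cornerField h10) (isWave_cornerField h10)
    (isWave_cornerField h10)]
  simp only [coeffAt_one_one_cornerField hh, coeffAt_one_neg_one_cornerField hh, const_add,
    const_mul]
  ring

theorem coeffAt_four_one_cornerField_mul_mul :
    coeffAt 4 1 (x c * x d * x e) =
      const (z c * z d * (z e)⁻¹ + z c * z e * (z d)⁻¹ + z d * z e * (z c)⁻¹)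
        * (2 * (u 1 0 * ubar 1 0 * u 2 0) + u 1 0 ^ 2 * ubar 2 0)
      + (const (z c * z d * (z e)⁻¹ * (s c + s d) + z c * z e * (z d)⁻¹ * (s c + s e)
          + z d * z e * (z c)⁻¹ * (s d + s e)) * (u 1 1 * (u 1 0 * ubar 1 0))
      + const (z c * z d * (z e)⁻¹ * s e + z c * z e * (z d)⁻¹ * s d + z d * z e * (z c)⁻¹ * s c)
        * (ubar 1 1 * u 1 0 ^ 2)) := by
  rw [coeffAt_four_one_mul_mul (isWave_cornerField h10) (isWave_cornerField h10)
    (isWave_cornerField h10)]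
  simp only [coeffAt_one_one_cornerField hh, coeffAt_one_neg_one_cornerField hh,
    coeffAt_two_one_cornerField hh, coeffAt_two_neg_one_cornerField hh, const_add, const_mul]
  ring

variable {μ ν : ℂ} (h20 : h 2 0 = const μ * (u 1 0 * ubar 1 0)) (h22 : h 2 2 = const ν * u 1 0 ^ 2)
include h20 h22

theorem coeffAt_three_one_cornerField_mul :
    coeffAt 3 1 (x c * x d) =
      const (μ * (z c + z d) + ν * (z c ^ 2 * (z d)⁻¹ + z d ^ 2 * (z c)⁻¹))
        * (u 1 0 ^ 2 * ubar 1 0) := by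
  rw [coeffAt_three_one_mul (isWave_cornerField h10) (isWave_cornerField h10)]
  simp only [coeffAt_one_one_cornerField hh, coeffAt_one_neg_one_cornerField hh,
    coeffAt_two_zero_cornerField h10, coeffAt_two_two_cornerField, h20, h22, const_add, const_mul]
  ring

theorem coeffAt_four_one_cornerField_mul {σ σ' τ : ℂ}
    (h30 : h 3 0 = const μ * (u 1 0 * ubar 2 0 + u 2 0 * ubar 1 0) + const σ * (u 1 1 * ubar 1 0)
      + const σ' * (u 1 0 * ubar 1 1))
    (h32 : h 3 2 = const ν * (2 * u 1 0 * u 2 0) + const τ * (u 1 0 * u 1 1)) :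
    coeffAt 4 1 (x c * x d) =
      const (μ * (z c + z d) + ν * (z c ^ 2 * (z d)⁻¹ + z d ^ 2 * (z c)⁻¹))
          * (2 * (u 1 0 * ubar 1 0 * u 2 0) + u 1 0 ^ 2 * ubar 2 0)
      + (const (μ * (s c + s d) * (z c + z d) + σ * (z c + z d)
        + 2 * ν * (z c ^ 2 * (z d)⁻¹ * s c + z d ^ 2 * (z c)⁻¹ * s d)
        + τ * (z c ^ 2 * (z d)⁻¹ + z d ^ 2 * (z c)⁻¹)) * (u 1 1 * (u 1 0 * ubar 1 0))
      + const (μ * (z c * s d + z d * s c) + σ' * (z c + z d)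
        + ν * (z c ^ 2 * (z d)⁻¹ * s d + z d ^ 2 * (z c)⁻¹ * s c))
        * (ubar 1 1 * u 1 0 ^ 2)) := by
  have dξ_h20 : dξ (h 2 0) = const μ * (u 1 1 * ubar 1 0 + u 1 0 * ubar 1 1) := by
    simp [h20, mul_add, mul_comm, add_comm]
  have dξ_h22 : dξ (h 2 2) = const ν * (2 * u 1 0 * u 1 1) := by
    simp [h22, Derivation.leibniz_pow, mul_assoc]
  rw [coeffAt_four_one_mul (isWave_cornerField h10) (isWave_cornerField h10)]
  simp only [coeffAt_one_one_cornerField hh, coeffAt_one_neg_one_cornerField hh,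
    coeffAt_two_one_cornerField hh, coeffAt_two_neg_one_cornerField hh,
    coeffAt_two_zero_cornerField h10, coeffAt_two_two_cornerField,
    coeffAt_three_zero_cornerField h10, coeffAt_three_two_cornerField, dξ_h20, dξ_h22]
  simp only [h20, h22, h30, h32, const_add, const_mul, const_pow, const_two]
  ring

end products

end DiffPoly

/-! ### The coefficients of the equation up to order four -/

namespace QCoeffs

open DiffPoly

variable (p : QCoeffs)

/-- The coefficient of `|u|²u` in `𝒲_3^{(1)}`, when the harmonics of order two are `μ |u|²` and
`ν u²`. -/
def cubicCoeff (z : Fin 4 → ℂ) (μ ν : ℂ) : ℂ :=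
  p.pairSum (fun c d => μ * (z c + z d) + ν * (z c ^ 2 * (z d)⁻¹ + z d ^ 2 * (z c)⁻¹))
    + p.tripleSum (fun c d e =>
        z c * z d * (z e)⁻¹ + z c * z e * (z d)⁻¹ + z d * z e * (z c)⁻¹)

/-- The coefficient of `u_ξ |u|²` in `𝒲_4^{(1)}`, when moreover the harmonics of order three contain
the terms `σ u_ξ ū` and `τ u u_ξ`. -/
def cubicCoeffDeriv (z s : Fin 4 → ℂ) (μ ν σ τ : ℂ) : ℂ :=
  p.pairSum (fun c d => μ * (s c + s d) * (z c + z d) + σ * (z c + z d)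
      + 2 * ν * (z c ^ 2 * (z d)⁻¹ * s c + z d ^ 2 * (z c)⁻¹ * s d)
      + τ * (z c ^ 2 * (z d)⁻¹ + z d ^ 2 * (z c)⁻¹))
    + p.tripleSum (fun c d e => z c * z d * (z e)⁻¹ * (s c + s d)
        + z c * z e * (z d)⁻¹ * (s c + s e) + z d * z e * (z c)⁻¹ * (s d + s e))

/-- The coefficient of `ū_ξ u²` in `𝒲_4^{(1)}`, when moreover the zeroth harmonic of order three
contains the term `σ u ū_ξ`. -/
def cubicCoeffConjDeriv (z s : Fin 4 → ℂ) (μ ν σ : ℂ) : ℂ :=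
  p.pairSum (fun c d => μ * (z c * s d + z d * s c) + σ * (z c + z d)
      + ν * (z c ^ 2 * (z d)⁻¹ * s d + z d ^ 2 * (z c)⁻¹ * s c))
    + p.tripleSum (fun c d e => z c * z d * (z e)⁻¹ * s e
        + z c * z e * (z d)⁻¹ * s d + z d * z e * (z c)⁻¹ * s c)

section expansion

variable {z : Fin 4 → ℂ} {s t : Fin 4 → ℝ} {F₂ F₃ : ℕ → DiffPoly} {h : ℕ → ℤ → DiffPoly}

theorem cornerExpansion_eq_quad :
    p.cornerExpansion z s t F₂ F₃ h =
      p.quad (cornerField F₂ F₃ (z 0) (s 0) (t 0) h) (cornerField F₂ F₃ (z 1) (s 1) (t 1) h)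
        (cornerField F₂ F₃ (z 2) (s 2) (t 2) h) (cornerField F₂ F₃ (z 3) (s 3) (t 3) h) :=
  rfl

theorem coeffAt_one_cornerExpansion {α : ℤ} (hα : α.natAbs ≤ 1) :
    coeffAt 1 α (p.cornerExpansion z s t F₂ F₃ h) =
      const (p.linSum fun c => z c ^ α) * h 1 α := by
  have hquad := coeffAt_eq_zero_of_lt (p.quad_sub_quad_sub_linSum_mem_filtration (n := 0)
    (x := fun c => cornerField F₂ F₃ (z c) (s c) (t c) h) (x' := 0)
    (fun _ => field_mem_filtration _ _ _) (fun _ => zero_mem _)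
    fun c => sub_mem (field_mem_filtration _ _ _) (zero_mem _)) one_lt_two α
  have hzero : p.quad (0 : Expansion) 0 0 0 = 0 := by simp [quad]
  simp only [Pi.zero_apply, hzero, sub_zero, map_sub, map_linSum, sub_eq_zero] at hquad
  rw [cornerExpansion_eq_quad, hquad]
  simp only [coeffAt_one_cornerField α hα, linSum_const]

variable (hh : IsAnsatz h) (h10 : h 1 0 = 0)
include hh h10

theorem coeffAt_two_zero_cornerExpansion :
    coeffAt 2 0 (p.cornerExpansion z s t F₂ F₃ h) = const (p.linSum fun _ => 1) * h 2 0
      + const (p.pairSum fun c d => z c * (z d)⁻¹ + z d * (z c)⁻¹) * (u 1 0 * ubar 1 0) := by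
  rw [cornerExpansion_eq_quad, p.coeffAt_quad_of_three (x := fun c => cornerField _ _ (z c) _ _ _)
    (fun _ => isWave_cornerField h10) (by decide)]
  simp only [coeffAt_two_zero_cornerField h10, coeffAt_two_zero_cornerField_mul hh h10 z s t,
    pairSum_const, ← linSum_const, const_one, one_mul]

theorem coeffAt_two_two_cornerExpansion :
    coeffAt 2 2 (p.cornerExpansion z s t F₂ F₃ h) = const (p.linSum fun c => z c ^ 2) * h 2 2
      + const (p.pairSum fun c d => z c * z d) * u 1 0 ^ 2 := by
  rw [cornerExpansion_eq_quad, p.coeffAt_quad_of_three (x := fun c => cornerField _ _ (z c) _ _ _)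
    (fun _ => isWave_cornerField h10) (by decide)]
  simp only [coeffAt_two_two_cornerField, coeffAt_two_two_cornerField_mul hh h10 z s t,
    linSum_const, pairSum_const]

theorem coeffAt_two_one_cornerExpansion :
    coeffAt 2 1 (p.cornerExpansion z s t F₂ F₃ h) = const (p.linSum z) * u 2 0
      + const (p.linSum fun c => z c * s c) * u 1 1 := by
  rw [cornerExpansion_eq_quad, p.coeffAt_quad_of_two (x := fun c => cornerField _ _ (z c) _ _ _)
    (fun _ => isWave_cornerField h10) (by decide)]
  simp only [coeffAt_two_one_cornerField hh, mul_add, linSum_add, ← linSum_const, const_mul,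
    mul_assoc]

variable {μ ν : ℂ} (h20 : h 2 0 = const μ * (u 1 0 * ubar 1 0)) (h22 : h 2 2 = const ν * u 1 0 ^ 2)

include h20 in
theorem coeffAt_three_zero_cornerExpansion :
    coeffAt 3 0 (p.cornerExpansion z s t F₂ F₃ h) = const (p.linSum fun _ => 1) * h 3 0
      + const (p.pairSum fun c d => z c * (z d)⁻¹ + z d * (z c)⁻¹)
        * (u 1 0 * ubar 2 0 + u 2 0 * ubar 1 0)
      + const (μ * p.linSum (fun c => (s c : ℂ))
          + p.pairSum fun c d => z c * (z d)⁻¹ * s c + z d * (z c)⁻¹ * s d) * (u 1 1 * ubar 1 0)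
      + const (μ * p.linSum (fun c => (s c : ℂ))
          + p.pairSum fun c d => z c * (z d)⁻¹ * s d + z d * (z c)⁻¹ * s c)
        * (u 1 0 * ubar 1 1) := by
  have field_eq (c : Fin 4) : h 3 0 + const (s c) * dξ (h 2 0) =
      const 1 * h 3 0 + (const (μ * s c) * (u 1 1 * ubar 1 0)
        + const (μ * s c) * (u 1 0 * ubar 1 1)) := by
    simp [h20, const_one, const_mul, -mul_eq_mul_left_iff]
    ring
  rw [cornerExpansion_eq_quad, p.coeffAt_quad_of_three (x := fun c => cornerField _ _ (z c) _ _ _)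
    (fun _ => isWave_cornerField h10) (by decide)]
  simp only [coeffAt_three_zero_cornerField h10, field_eq,
    coeffAt_three_zero_cornerField_mul hh h10 z s t, linSum_const, pairSum_const, linSum_const_add,
    pairSum_const_add, mul_linSum]
  simp only [const_add]
  ring

include h22

theorem coeffAt_three_two_cornerExpansion :
    coeffAt 3 2 (p.cornerExpansion z s t F₂ F₃ h) = const (p.linSum fun c => z c ^ 2) * h 3 2
      + const (p.pairSum fun c d => z c * z d) * (2 * u 1 0 * u 2 0)
      + const (2 * ν * p.linSum (fun c => z c ^ 2 * s c)
          + p.pairSum fun c d => z c * z d * (s c + s d)) * (u 1 0 * u 1 1) := by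
  have field_eq (c : Fin 4) : const (z c ^ 2) * (h 3 2 + const (s c) * dξ (h 2 2)) =
      const (z c ^ 2) * h 3 2 + const (2 * ν * (z c ^ 2 * s c)) * (u 1 0 * u 1 1) := by
    simp [h22, const_mul, const_pow, const_two, Derivation.leibniz_pow, -mul_eq_mul_left_iff]
    ring
  rw [cornerExpansion_eq_quad, p.coeffAt_quad_of_three (x := fun c => cornerField _ _ (z c) _ _ _)
    (fun _ => isWave_cornerField h10) (by decide)]
  simp only [coeffAt_three_two_cornerField, field_eq,
    coeffAt_three_two_cornerField_mul hh h10 z s t, linSum_const, pairSum_const, linSum_const_add,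
    pairSum_const_add, mul_linSum]
  simp only [const_add]
  ring

include h20

theorem coeffAt_three_one_cornerExpansion :
    coeffAt 3 1 (p.cornerExpansion z s t F₂ F₃ h) = const (p.linSum z) * u 3 0
      + const (p.linSum fun c => z c * s c) * u 2 1
      + const (p.linSum fun c => z c * s c ^ 2) * (const (1 / 2) * u 1 2)
      + const (p.linSum fun c => z c * t c) * F₂ 1
      + const (p.cubicCoeff z μ ν) * (u 1 0 ^ 2 * ubar 1 0) := by
  have field_eq (c : Fin 4) : coeffAt 3 1 (cornerField F₂ F₃ (z c) (s c) (t c) h) =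
      const (z c) * u 3 0 + (const (z c * s c) * u 2 1
        + (const (z c * s c ^ 2) * (const (1 / 2) * u 1 2) + const (z c * t c) * F₂ 1)) := by
    simp only [coeffAt_three_one_cornerField hh, const_mul]
    ring
  rw [cornerExpansion_eq_quad, p.coeffAt_quad_of_four (x := fun c => cornerField _ _ (z c) _ _ _)
    (fun _ => isWave_cornerField h10) (by decide)]
  simp only [field_eq, coeffAt_three_one_cornerField_mul hh h10 z s t _ _ h20 h22,
    coeffAt_three_one_cornerField_mul_mul hh h10 z s t, linSum_const, pairSum_const,
    tripleSum_const, linSum_const_add, cubicCoeff]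
  simp only [const_add]
  ring

theorem coeffAt_four_one_cornerExpansion {σ σ' τ : ℂ}
    (h30 : h 3 0 = const μ * (u 1 0 * ubar 2 0 + u 2 0 * ubar 1 0) + const σ * (u 1 1 * ubar 1 0)
      + const σ' * (u 1 0 * ubar 1 1))
    (h32 : h 3 2 = const ν * (2 * u 1 0 * u 2 0) + const τ * (u 1 0 * u 1 1)) :
    coeffAt 4 1 (p.cornerExpansion z s t F₂ F₃ h) = const (p.linSum z) * u 4 0
      + const (p.linSum fun c => z c * s c) * u 3 1
      + const (p.linSum fun c => z c * s c ^ 2) * (const (1 / 2) * u 2 2)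
      + const (p.linSum fun c => z c * t c) * F₂ 2
      + const (p.linSum fun c => z c * s c ^ 3) * (const (1 / 6) * u 1 3)
      + const (p.linSum fun c => z c * (s c * t c)) * dξ (F₂ 1)
      + const (p.linSum fun c => z c * t c) * F₃ 1
      + const (p.cubicCoeff z μ ν) * (2 * (u 1 0 * ubar 1 0 * u 2 0) + u 1 0 ^ 2 * ubar 2 0)
      + const (p.cubicCoeffDeriv z (fun c => s c) μ ν σ τ) * (u 1 1 * (u 1 0 * ubar 1 0))
      + const (p.cubicCoeffConjDeriv z (fun c => s c) μ ν σ') * (ubar 1 1 * u 1 0 ^ 2) := by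
  have field_eq (c : Fin 4) : coeffAt 4 1 (cornerField F₂ F₃ (z c) (s c) (t c) h) =
      const (z c) * u 4 0 + (const (z c * s c) * u 3 1
        + (const (z c * s c ^ 2) * (const (1 / 2) * u 2 2) + (const (z c * t c) * F₂ 2
        + (const (z c * s c ^ 3) * (const (1 / 6) * u 1 3)
        + (const (z c * (s c * t c)) * dξ (F₂ 1) + const (z c * t c) * F₃ 1))))) := by
    simp only [coeffAt_four_one_cornerField hh, const_mul]
    ring
  rw [cornerExpansion_eq_quad, p.coeffAt_quad_of_four (x := fun c => cornerField _ _ (z c) _ _ _)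
    (fun _ => isWave_cornerField h10) (by decide)]
  simp only [field_eq, coeffAt_four_one_cornerField_mul hh h10 z s t _ _ h20 h22 h30 h32,
    coeffAt_four_one_cornerField_mul_mul hh h10 z s t, linSum_const, pairSum_const,
    tripleSum_const, linSum_const_add, pairSum_const_add, tripleSum_const_add, cubicCoeff,
    cubicCoeffDeriv, cubicCoeffConjDeriv]
  simp only [const_add]
  ring

end expansion

end QCoeffs

/-! ### The reduced equations as scalar equations -/

namespace QCoeffs

open DiffPoly

/-- The slave harmonics up to order three: the zeroth and the second harmonic are the differential
polynomials in the amplitudes with coefficients `μ`, `ν` at order two and with the additional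
coefficients `σ`, `σ'`, `τ` at order three. -/
structure HasSlaveHarmonics (h : ℕ → ℤ → DiffPoly) (μ ν σ σ' τ : ℂ) : Prop where
  one_zero : h 1 0 = 0
  two_zero : h 2 0 = const μ * (u 1 0 * ubar 1 0)
  two_two : h 2 2 = const ν * u 1 0 ^ 2
  three_zero : h 3 0 = const μ * (u 1 0 * ubar 2 0 + u 2 0 * ubar 1 0)
    + const σ * (u 1 1 * ubar 1 0) + const σ' * (u 1 0 * ubar 1 1)
  three_two : h 3 2 = const ν * (2 * u 1 0 * u 2 0) + const τ * (u 1 0 * u 1 1)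

/-- The linear equations which determine the coefficients `μ`, `ν`, `σ`, `σ'`, `τ` of the slave
harmonics, when the carrier is multiplied by `z c` and the slow variable `ξ` is shifted by `s c` at
the corner `c` of the cell. -/
structure SlaveEqs (p : QCoeffs) (z s : Fin 4 → ℂ) (μ ν σ σ' τ : ℂ) : Prop where
  eq_μ : p.linSum (fun _ => (1 : ℂ)) * μ
    + p.pairSum (fun c d => z c * (z d)⁻¹ + z d * (z c)⁻¹) = 0
  eq_ν : p.linSum (fun c => z c ^ 2) * ν + p.pairSum (fun c d => z c * z d) = 0
  eq_σ : p.linSum (fun _ => (1 : ℂ)) * σ + (μ * p.linSum s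
    + p.pairSum fun c d => z c * (z d)⁻¹ * s c + z d * (z c)⁻¹ * s d) = 0
  eq_σ' : p.linSum (fun _ => (1 : ℂ)) * σ' + (μ * p.linSum s
    + p.pairSum fun c d => z c * (z d)⁻¹ * s d + z d * (z c)⁻¹ * s c) = 0
  eq_τ : p.linSum (fun c => z c ^ 2) * τ + (2 * ν * p.linSum (fun c => z c ^ 2 * s c)
    + p.pairSum fun c d => z c * z d * (s c + s d)) = 0

/-- The scalar equations to which the multiscale expansion up to order `ε⁴` amounts: those for the
slave harmonics together with the vanishing of the coefficients of the monomials `u_ξ`, `u_ξξ`,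
`|u|²u`, `u_ξξξ`, `u_ξ |u|²`, `ū_ξ u²` in the first harmonic. -/
structure ReducedEqs (p : QCoeffs) (z s t : Fin 4 → ℂ) (ρ₁ ρ₂ B a b μ ν σ σ' τ : ℂ) : Prop
    extends p.SlaveEqs z s μ ν σ σ' τ where
  velocity : p.linSum (fun c => z c * s c) = 0
  dispersion₂ : p.linSum (fun c => z c * t c) * (-Complex.I * ρ₁)
    + p.linSum (fun c => z c * s c ^ 2) * (1 / 2) = 0
  cubic : p.linSum (fun c => z c * t c) * (-Complex.I * ρ₂) + p.cubicCoeff z μ ν = 0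
  dispersion₃ : p.linSum (fun c => z c * t c) * B
    + p.linSum (fun c => z c * (s c * t c)) * (-Complex.I * ρ₁)
    + p.linSum (fun c => z c * s c ^ 3) * (1 / 6) = 0
  deriv : p.linSum (fun c => z c * t c) * (3 * B * ρ₂ / ρ₁ + a)
    + 2 * p.linSum (fun c => z c * (s c * t c)) * (-Complex.I * ρ₂)
    + p.cubicCoeffDeriv z s μ ν σ τ = 0
  conjDeriv : p.linSum (fun c => z c * t c) * b
    + p.linSum (fun c => z c * (s c * t c)) * (-Complex.I * ρ₂)
    + p.cubicCoeffConjDeriv z s μ ν σ' = 0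

theorem exists_slaveEqs (p : QCoeffs) {z : Fin 4 → ℂ} (s : Fin 4 → ℂ)
    (hL₀ : p.linSum (fun _ => (1 : ℂ)) ≠ 0) (hL₂ : p.linSum (fun c => z c ^ 2) ≠ 0) :
    ∃ μ ν σ σ' τ : ℂ, p.SlaveEqs z s μ ν σ σ' τ := by
  have solve {L : ℂ} (hL : L ≠ 0) (Q : ℂ) : ∃ x, L * x + Q = 0 :=
    ⟨-Q / L, by rw [mul_div_cancel₀ _ hL, neg_add_cancel]⟩
  obtain ⟨μ, hμ⟩ := solve hL₀ _
  obtain ⟨ν, hν⟩ := solve hL₂ _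
  obtain ⟨σ, hσ⟩ := solve hL₀ _
  obtain ⟨σ', hσ'⟩ := solve hL₀ _
  obtain ⟨τ, hτ⟩ := solve hL₂ _
  exact ⟨μ, ν, σ, σ', τ, hμ, hν, hσ, hσ', hτ⟩

end QCoeffs

namespace DiffPoly

theorem const_zero : const 0 = 0 := MvPolynomial.C_0

theorem const_mul_left_cancel {L : ℂ} (hL : L ≠ 0) {f g : DiffPoly}
    (h : const L * f = const L * g) : f = g :=
  mul_left_cancel₀ (MvPolynomial.C_ne_zero.mpr hL) h

theorem const_mul_const_add_const {L x Q : ℂ} (h : L * x + Q = 0) :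
    const L * const x + const Q = 0 := by
  rw [← const_mul, ← const_add, h, const_zero]

/-- Evaluation of differential polynomials at prescribed values `x` of the amplitudes and `y` of
their conjugates, which need not be conjugate to each other. -/
def evalAt (x y : ℕ → ℕ → ℂ) : DiffPoly →+* ℂ :=
  MvPolynomial.eval fun
    | .amp j k => x j k
    | .ampBar j k => y j k

section evalAt

variable (x y : ℕ → ℕ → ℂ)

theorem evalAt_const (z : ℂ) : evalAt x y (const z) = z := by simp [evalAt, const]

theorem evalAt_u (j k : ℕ) : evalAt x y (u j k) = x j k := by simp [evalAt, u]

theorem evalAt_ubar (j k : ℕ) : evalAt x y (ubar j k) = y j k := by simp [evalAt, ubar]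

end evalAt

end DiffPoly

namespace QCoeffs

open DiffPoly

section reduction

variable (p : QCoeffs) {z : Fin 4 → ℂ} {s t : Fin 4 → ℝ} {F₂ F₃ : ℕ → DiffPoly}
  {h : ℕ → ℤ → DiffPoly} {ρ₁ B : ℝ} {ρ₂ a b μ ν σ σ' τ : ℂ}

theorem SlaveEqs.hasSlaveHarmonics (H : p.SlaveEqs z (fun c => s c) μ ν σ σ' τ) (hh : IsAnsatz h)
    (hL₀ : p.linSum (fun _ => (1 : ℂ)) ≠ 0) (hL₂ : p.linSum (fun c => z c ^ 2) ≠ 0)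
    (hW : ∀ j ≤ 3, ∀ α, α ≠ 1 → α ≠ -1 →
      coeffAt j α (p.cornerExpansion z s t F₂ F₃ h) = 0) :
    HasSlaveHarmonics h μ ν σ σ' τ := by
  have hμ := const_mul_const_add_const H.eq_μ
  have hν := const_mul_const_add_const H.eq_ν
  have h10 : h 1 0 = 0 := by
    have e := hW 1 (by norm_num) 0 (by norm_num) (by norm_num)
    simp only [p.coeffAt_one_cornerExpansion (α := 0) (by norm_num), zpow_zero] at e
    exact const_mul_left_cancel hL₀ (e.trans (mul_zero _).symm)
  have h20 : h 2 0 = const μ * (u 1 0 * ubar 1 0) := by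
    have e := hW 2 (by norm_num) 0 (by norm_num) (by norm_num)
    rw [p.coeffAt_two_zero_cornerExpansion hh h10] at e
    exact const_mul_left_cancel hL₀ (by linear_combination e - u 1 0 * ubar 1 0 * hμ)
  have h22 : h 2 2 = const ν * u 1 0 ^ 2 := by
    have e := hW 2 (by norm_num) 2 (by norm_num) (by norm_num)
    rw [p.coeffAt_two_two_cornerExpansion hh h10] at e
    exact const_mul_left_cancel hL₂ (by linear_combination e - u 1 0 ^ 2 * hν)
  refine ⟨h10, h20, h22, const_mul_left_cancel hL₀ ?_, const_mul_left_cancel hL₂ ?_⟩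
  · have e := hW 3 le_rfl 0 (by norm_num) (by norm_num)
    rw [p.coeffAt_three_zero_cornerExpansion hh h10 h20] at e
    linear_combination e - (u 1 0 * ubar 2 0 + u 2 0 * ubar 1 0) * hμ
      - u 1 1 * ubar 1 0 * const_mul_const_add_const H.eq_σ
      - u 1 0 * ubar 1 1 * const_mul_const_add_const H.eq_σ'
  · have e := hW 3 le_rfl 2 (by norm_num) (by norm_num)
    rw [p.coeffAt_three_two_cornerExpansion hh h10 h22] at e
    linear_combination e - 2 * u 1 0 * u 2 0 * hν
      - u 1 0 * u 1 1 * const_mul_const_add_const H.eq_τ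

section flows

variable (hh : IsAnsatz h) (hslave : HasSlaveHarmonics h μ ν σ σ' τ) (hS : p.linSum z = 0)
  (hρ : ρ₁ ≠ 0) (hF₂ : F₂ 1 = K₂ ρ₁ ρ₂)
include hh hslave hS hρ hF₂

theorem coeffAt_three_one_of_flows :
    coeffAt 3 1 (p.cornerExpansion z s t F₂ F₃ h) =
      const (p.linSum fun c => z c * s c) * u 2 1
      + const (p.linSum (fun c => z c * t c) * (-Complex.I * ρ₁)
          + p.linSum (fun c => z c * s c ^ 2) * (1 / 2)) * u 1 2
      + const (p.linSum (fun c => z c * t c) * (-Complex.I * ρ₂) + p.cubicCoeff z μ ν)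
          * (u 1 0 ^ 2 * ubar 1 0) := by
  have hρ₂ : const (-Complex.I * ρ₁) * const (ρ₂ / ρ₁) = const (-Complex.I * ρ₂) := by
    rw [← const_mul, mul_assoc, mul_div_cancel₀ _ (Complex.ofReal_ne_zero.mpr hρ)]
  rw [p.coeffAt_three_one_cornerExpansion hh hslave.one_zero hslave.two_zero hslave.two_two, hF₂,
    K₂, hS, const_zero]
  simp only [const_add, const_mul _ (-Complex.I * ρ₂), ← hρ₂, const_mul _ (-Complex.I * ρ₁),
    const_mul _ (1 / 2)]
  ring

theorem coeffAt_four_one_of_flows (hF₂' : F₂ 2 = K₂' ρ₁ ρ₂ + f₂ a b) (hF₃ : F₃ 1 = K₃ ρ₁ ρ₂ B) :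
    coeffAt 4 1 (p.cornerExpansion z s t F₂ F₃ h) =
      const (p.linSum fun c => z c * s c) * u 3 1
      + const (p.linSum (fun c => z c * t c) * (-Complex.I * ρ₁)
          + p.linSum (fun c => z c * s c ^ 2) * (1 / 2)) * u 2 2
      + const (p.linSum (fun c => z c * t c) * (-Complex.I * ρ₂) + p.cubicCoeff z μ ν)
          * (2 * (u 1 0 * ubar 1 0 * u 2 0) + u 1 0 ^ 2 * ubar 2 0)
      + const (p.linSum (fun c => z c * t c) * B
          + p.linSum (fun c => z c * (s c * t c)) * (-Complex.I * ρ₁)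
          + p.linSum (fun c => z c * s c ^ 3) * (1 / 6)) * u 1 3
      + const (p.linSum (fun c => z c * t c) * (3 * B * ρ₂ / ρ₁ + a)
          + 2 * p.linSum (fun c => z c * (s c * t c)) * (-Complex.I * ρ₂)
          + p.cubicCoeffDeriv z (fun c => s c) μ ν σ τ) * (u 1 1 * (u 1 0 * ubar 1 0))
      + const (p.linSum (fun c => z c * t c) * b
          + p.linSum (fun c => z c * (s c * t c)) * (-Complex.I * ρ₂)
          + p.cubicCoeffConjDeriv z (fun c => s c) μ ν σ') * (ubar 1 1 * u 1 0 ^ 2) := by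
  have hρ₂ : const (-Complex.I * ρ₁) * const (ρ₂ / ρ₁) = const (-Complex.I * ρ₂) := by
    rw [← const_mul, mul_assoc, mul_div_cancel₀ _ (Complex.ofReal_ne_zero.mpr hρ)]
  have hB : const B * const (3 * ρ₂ / ρ₁) = const (3 * B * ρ₂ / ρ₁) := by
    rw [← const_mul, mul_div_assoc', mul_left_comm, mul_assoc]
  have dξ_K₂ : dξ (K₂ ρ₁ ρ₂) = const (-Complex.I * ρ₁) * (u 1 3 + const (ρ₂ / ρ₁)
      * (2 * (u 1 1 * (u 1 0 * ubar 1 0)) + ubar 1 1 * u 1 0 ^ 2)) := by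
    simp [K₂, Derivation.leibniz_pow, -mul_eq_mul_left_iff]
    ring
  rw [p.coeffAt_four_one_cornerExpansion hh hslave.one_zero hslave.two_zero hslave.two_two
    hslave.three_zero hslave.three_two, hF₂, dξ_K₂, hF₂', hF₃, K₂', K₃, f₂, hS, const_zero]
  simp only [const_add, const_mul _ (-Complex.I * ρ₂), ← hρ₂, const_mul _ (-Complex.I * ρ₁),
    const_mul _ (1 / 2), const_mul _ (1 / 6), const_mul _ (_ + _ : ℂ), const_mul 2, const_mul _ b,
    ← hB, const_two, const_mul _ (B : ℂ)]
  ring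

end flows

theorem reducedEqs_of_expansion (hρ : ρ₁ ≠ 0) (hF₂ : F₂ 1 = K₂ ρ₁ ρ₂)
    (hF₂' : F₂ 2 = K₂' ρ₁ ρ₂ + f₂ a b) (hF₃ : F₃ 1 = K₃ ρ₁ ρ₂ B) (hh : IsAnsatz h)
    (hS : p.linSum z = 0) (hL₀ : p.linSum (fun _ => (1 : ℂ)) ≠ 0)
    (hL₂ : p.linSum (fun c => z c ^ 2) ≠ 0)
    (hW : ∀ j ≤ 4, ∀ α, coeffAt j α (p.cornerExpansion z s t F₂ F₃ h) = 0) :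
    ∃ μ ν σ σ' τ : ℂ, p.ReducedEqs z (fun c => s c) (fun c => t c) ρ₁ ρ₂ B a b μ ν σ σ' τ := by
  obtain ⟨μ, ν, σ, σ', τ, H⟩ := p.exists_slaveEqs (fun c => (s c : ℂ)) hL₀ hL₂
  have hslave := H.hasSlaveHarmonics p hh hL₀ hL₂ fun j hj α _ _ => hW j (by omega) α
  have three_one (x y) := congrArg (evalAt x y)
    ((p.coeffAt_three_one_of_flows hh hslave hS hρ hF₂).symm.trans (hW 3 (by norm_num) 1))
  have four_one (x y) := congrArg (evalAt x y)
    ((p.coeffAt_four_one_of_flows hh hslave hS hρ hF₂ hF₂' hF₃).symm.trans (hW 4 le_rfl 1))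
  simp only [map_add, map_mul, map_zero, map_pow, evalAt_const, evalAt_u, evalAt_ubar]
    at three_one four_one
  -- Each of the six jets annihilates all monomials but one.
  refine ⟨μ, ν, σ, σ', τ, H, ?_, ?_, ?_, ?_, ?_, ?_⟩
  · simpa using three_one (fun j _ => if j = 2 then 1 else 0) 0
  · simpa using three_one (fun _ k => if k = 2 then 1 else 0) 0
  · simpa using three_one (fun j k => if j = 1 ∧ k = 0 then 1 else 0) 1
  · simpa using four_one (fun j _ => if j = 1 then 1 else 0) 0
  · simpa using four_one (fun j k => if j = 1 ∧ k ≤ 1 then 1 else 0)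
      (fun j k => if j = 1 ∧ k = 0 then 1 else 0)
  · simpa using four_one (fun j k => if j = 1 ∧ k = 0 then 1 else 0)
      (fun _ k => if k = 1 then 1 else 0)

theorem ReducedEqs.coeffAt_one_cornerExpansion
    (H : p.ReducedEqs z (fun c => s c) (fun c => t c) ρ₁ ρ₂ B a b μ ν σ σ' τ) (hρ : ρ₁ ≠ 0)
    (hF₂ : F₂ 1 = K₂ ρ₁ ρ₂) (hF₂' : F₂ 2 = K₂' ρ₁ ρ₂ + f₂ a b) (hF₃ : F₃ 1 = K₃ ρ₁ ρ₂ B)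
    (hh : IsAnsatz h) (hslave : HasSlaveHarmonics h μ ν σ σ' τ) (hS : p.linSum z = 0) {j : ℕ}
    (hj : j ≤ 4) : coeffAt j 1 (p.cornerExpansion z s t F₂ F₃ h) = 0 := by
  interval_cases j
  · exact coeffAt_eq_zero_of_lt p.cornerExpansion_mem_filtration one_pos 1
  · rw [p.coeffAt_one_cornerExpansion (by norm_num)]
    simp only [zpow_one, hS, const_zero, zero_mul]
  · rw [p.coeffAt_two_one_cornerExpansion hh hslave.one_zero, hS, H.velocity]
    simp only [const_zero, zero_mul, add_zero]
  · rw [p.coeffAt_three_one_of_flows hh hslave hS hρ hF₂, H.velocity, H.dispersion₂, H.cubic]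
    simp only [const_zero, zero_mul, add_zero]
  · rw [p.coeffAt_four_one_of_flows hh hslave hS hρ hF₂ hF₂' hF₃, H.velocity, H.dispersion₂,
      H.cubic, H.dispersion₃, H.deriv, H.conjDeriv]
    simp only [const_zero, zero_mul, add_zero]

theorem ReducedEqs.exists_expansion
    (H : p.ReducedEqs z (fun c => s c) (fun c => t c) ρ₁ ρ₂ B a b μ ν σ σ' τ) (hρ : ρ₁ ≠ 0)
    (hz : ∀ c, starRingEnd ℂ (z c) = (z c)⁻¹) (hS : p.linSum z = 0)
    (hL : ∀ α : ℤ, α ≠ 1 → α ≠ -1 → α.natAbs ≤ 4 → p.linSum (fun c => z c ^ α) ≠ 0) :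
    ∃ (F₂ F₃ : ℕ → DiffPoly) (h : ℕ → ℤ → DiffPoly), F₂ 1 = K₂ ρ₁ ρ₂ ∧
      F₂ 2 = K₂' ρ₁ ρ₂ + f₂ a b ∧ F₃ 1 = K₃ ρ₁ ρ₂ B ∧ IsAnsatz h ∧
      ∀ j ≤ 4, ∀ α, coeffAt j α (p.cornerExpansion z s t F₂ F₃ h) = 0 := by
  have hL₀ : p.linSum (fun _ => (1 : ℂ)) ≠ 0 := by
    simpa only [zpow_zero] using hL 0 (by norm_num) (by norm_num) (by norm_num)
  have hL₂ : p.linSum (fun c => z c ^ 2) ≠ 0 := by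
    exact_mod_cast hL 2 (by norm_num) (by norm_num) (by norm_num)
  let F₂ : ℕ → DiffPoly := fun j => if j = 1 then K₂ ρ₁ ρ₂ else K₂' ρ₁ ρ₂ + f₂ a b
  let F₃ : ℕ → DiffPoly := fun _ => K₃ ρ₁ ρ₂ B
  obtain ⟨h, hh, hW⟩ := p.exists_harmonics s t F₂ F₃ hz 4 hL
  have hslave := H.hasSlaveHarmonics p hh hL₀ hL₂ fun j hj α => hW j (by omega) α
  have first {j : ℕ} (hj : j ≤ 4) : coeffAt j 1 (p.cornerExpansion z s t F₂ F₃ h) = 0 :=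
    H.coeffAt_one_cornerExpansion p hρ rfl rfl rfl hh hslave hS hj
  refine ⟨F₂, F₃, h, rfl, rfl, rfl, hh, fun j hj α => ?_⟩
  rcases eq_or_ne α 1 with rfl | hα
  · exact first hj
  rcases eq_or_ne α (-1) with rfl | hα'
  · rw [reflect_eq_self_iff.mp (p.reflect_cornerExpansion hz hh), first hj, map_zero]
  · exact hW j hj α hα hα'

end reduction

end QCoeffs

/-! ### Invariance of the reduced equations -/

namespace QCoeffs

theorem mul_pairSum (p : QCoeffs) (w : ℂ) (y : Fin 4 → Fin 4 → ℂ) :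
    w * p.pairSum y = p.pairSum fun c d => w * y c d :=
  p.map_pairSum (LinearMap.mulLeft ℝ w) y

theorem mul_tripleSum (p : QCoeffs) (w : ℂ) (y : Fin 4 → Fin 4 → Fin 4 → ℂ) :
    w * p.tripleSum y = p.tripleSum fun c d e => w * y c d e :=
  p.map_tripleSum (LinearMap.mulLeft ℝ w) y

section gauge

variable {p : QCoeffs} {z s t : Fin 4 → ℂ} {ρ₁ ρ₂ B a b μ ν σ σ' τ : ℂ}

section mul_carrier

variable {A : ℂ} (hA : A ≠ 0)
include hA

theorem SlaveEqs.mul_carrier (H : p.SlaveEqs z s μ ν σ σ' τ) :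
    p.SlaveEqs (fun c => A * z c) s μ ν σ σ' τ := by
  have ratio (c d : Fin 4) : A * z c * (A * z d)⁻¹ = z c * (z d)⁻¹ := by
    rw [← div_eq_mul_inv, mul_div_mul_left _ _ hA, div_eq_mul_inv]
  have product (c d : Fin 4) : A * z c * (A * z d) = A ^ 2 * (z c * z d) := by ring
  refine ⟨?_, ?_, ?_, ?_, ?_⟩
  · simpa only [ratio] using H.eq_μ
  · simp only [mul_pow, product, ← mul_linSum, ← mul_pairSum]
    linear_combination A ^ 2 * H.eq_ν
  · simpa only [ratio] using H.eq_σ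
  · simpa only [ratio] using H.eq_σ'
  · simp only [mul_pow, product, mul_assoc (A ^ 2), ← mul_linSum, ← mul_pairSum]
    linear_combination A ^ 2 * H.eq_τ

theorem cubicCoeff_mul_carrier :
    p.cubicCoeff (fun c => A * z c) μ ν = A * p.cubicCoeff z μ ν := by
  rw [cubicCoeff, cubicCoeff, mul_add, mul_pairSum, mul_tripleSum]
  congr <;> funext <;> field_simp

theorem cubicCoeffDeriv_mul_carrier :
    p.cubicCoeffDeriv (fun c => A * z c) s μ ν σ τ = A * p.cubicCoeffDeriv z s μ ν σ τ := by
  rw [cubicCoeffDeriv, cubicCoeffDeriv, mul_add, mul_pairSum, mul_tripleSum]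
  congr <;> funext <;> field_simp

theorem cubicCoeffConjDeriv_mul_carrier :
    p.cubicCoeffConjDeriv (fun c => A * z c) s μ ν σ = A * p.cubicCoeffConjDeriv z s μ ν σ := by
  rw [cubicCoeffConjDeriv, cubicCoeffConjDeriv, mul_add, mul_pairSum, mul_tripleSum]
  congr <;> funext <;> field_simp

theorem ReducedEqs.mul_carrier (H : p.ReducedEqs z s t ρ₁ ρ₂ B a b μ ν σ σ' τ) :
    p.ReducedEqs (fun c => A * z c) s t ρ₁ ρ₂ B a b μ ν σ σ' τ := by
  refine ⟨H.toSlaveEqs.mul_carrier hA, ?_, ?_, ?_, ?_, ?_, ?_⟩ <;>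
    simp only [mul_assoc A, ← mul_linSum, cubicCoeff_mul_carrier hA,
      cubicCoeffDeriv_mul_carrier hA, cubicCoeffConjDeriv_mul_carrier hA]
  · linear_combination A * H.velocity
  · linear_combination A * H.dispersion₂
  · linear_combination A * H.cubic
  · linear_combination A * H.dispersion₃
  · linear_combination A * H.deriv
  · linear_combination A * H.conjDeriv

end mul_carrier

section add_shift

variable (r q : ℂ)

theorem SlaveEqs.add_shift (H : p.SlaveEqs z s μ ν σ σ' τ) :
    p.SlaveEqs z (fun c => r + s c) μ ν σ σ' τ where
  eq_μ := H.eq_μ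
  eq_ν := H.eq_ν
  eq_σ := by
    linear_combination (norm := (simp only [linSum, pairSum, Complex.real_smul]; ring))
      H.eq_σ + r * H.eq_μ
  eq_σ' := by
    linear_combination (norm := (simp only [linSum, pairSum, Complex.real_smul]; ring))
      H.eq_σ' + r * H.eq_μ
  eq_τ := by
    linear_combination (norm := (simp only [linSum, pairSum, Complex.real_smul]; ring))
      H.eq_τ + 2 * r * H.eq_ν

theorem cubicCoeffDeriv_add_shift :
    p.cubicCoeffDeriv z (fun c => r + s c) μ ν σ τ =
      p.cubicCoeffDeriv z s μ ν σ τ + 2 * r * p.cubicCoeff z μ ν := by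
  simp only [cubicCoeffDeriv, cubicCoeff, pairSum, tripleSum, Complex.real_smul]
  ring

theorem cubicCoeffConjDeriv_add_shift :
    p.cubicCoeffConjDeriv z (fun c => r + s c) μ ν σ =
      p.cubicCoeffConjDeriv z s μ ν σ + r * p.cubicCoeff z μ ν := by
  simp only [cubicCoeffConjDeriv, cubicCoeff, pairSum, tripleSum, Complex.real_smul]
  ring

theorem ReducedEqs.add_shift (H : p.ReducedEqs z s t ρ₁ ρ₂ B a b μ ν σ σ' τ)
    (hS : p.linSum z = 0) :
    p.ReducedEqs z (fun c => r + s c) (fun c => q + t c) ρ₁ ρ₂ B a b μ ν σ σ' τ := by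
  have linSum_s : p.linSum (fun c => z c * (r + s c)) = 0 := by
    simp only [mul_add, mul_comm _ r, linSum_add, ← mul_linSum, hS, H.velocity, mul_zero, add_zero]
  have linSum_t : p.linSum (fun c => z c * (q + t c)) = p.linSum fun c => z c * t c := by
    simp only [mul_add, mul_comm _ q, linSum_add, ← mul_linSum, hS, mul_zero, zero_add]
  have linSum_s_sq : p.linSum (fun c => z c * (r + s c) ^ 2) =
      p.linSum fun c => z c * s c ^ 2 := by
    linear_combination (norm := (simp only [linSum, Complex.real_smul]; ring))
      r ^ 2 * hS + 2 * r * H.velocity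
  have linSum_s_cube : p.linSum (fun c => z c * (r + s c) ^ 3) =
      p.linSum (fun c => z c * s c ^ 3) + 3 * r * p.linSum fun c => z c * s c ^ 2 := by
    linear_combination (norm := (simp only [linSum, Complex.real_smul]; ring))
      r ^ 3 * hS + 3 * r ^ 2 * H.velocity
  have linSum_s_t : p.linSum (fun c => z c * ((r + s c) * (q + t c))) =
      p.linSum (fun c => z c * (s c * t c)) + r * p.linSum fun c => z c * t c := by
    linear_combination (norm := (simp only [linSum, Complex.real_smul]; ring))
      r * q * hS + q * H.velocity
  refine ⟨H.toSlaveEqs.add_shift r, linSum_s, ?_, ?_, ?_, ?_, ?_⟩ <;>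
    simp only [linSum_t, linSum_s_sq, linSum_s_cube, linSum_s_t, cubicCoeffDeriv_add_shift,
      cubicCoeffConjDeriv_add_shift]
  · exact H.dispersion₂
  · exact H.cubic
  · linear_combination H.dispersion₃ + r * H.dispersion₂
  · linear_combination H.deriv + 2 * r * H.cubic
  · linear_combination H.conjDeriv + r * H.cubic

end add_shift

theorem reducedEqs_gauge_iff (hS : p.linSum z = 0) {A : ℂ} (hA : A ≠ 0) (r q : ℂ) :
    p.ReducedEqs (fun c => A * z c) (fun c => r + s c) (fun c => q + t c)
      ρ₁ ρ₂ B a b μ ν σ σ' τ ↔ p.ReducedEqs z s t ρ₁ ρ₂ B a b μ ν σ σ' τ := by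
  refine ⟨fun H => ?_, fun H => (H.add_shift r q hS).mul_carrier hA⟩
  have H' := H.mul_carrier (inv_ne_zero hA)
  simp only [inv_mul_cancel_left₀ hA] at H'
  simpa only [neg_add_cancel_left] using H'.add_shift (-r) (-q) hS

end gauge

/-- The factors which the carrier acquires at the four lattice points, relative to the centre of
the cell; for the carrier with `K = AD`, `Ω = A/D`. -/
def centred (A D : ℂ) : Fin 4 → ℂ := ![A⁻¹, D, D⁻¹, A]

/-- Shifts of a slow variable to the four lattice points, relative to the centre of the cell. -/
def shifts (s t : ℂ) : Fin 4 → ℂ := ![-s, t, -t, s]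

section mobius

variable {p : QCoeffs} {A D s t r q : ℂ} {ρ₁ ρ₂ B a b μ ν σ σ' τ : ℂ}

theorem linSum_mobius (C : ℝ) (y : Fin 4 → ℂ) : (p.mobius C 1).linSum y = p.linSum y := by
  simp [linSum, QCoeffs.mobius]

theorem linSum_centred :
    p.linSum (centred A D) = p.a₁ * (A + A⁻¹) + p.a₂ * (D + D⁻¹) := by
  simp only [centred, linSum, Complex.real_smul, Matrix.cons_val]
  ring

theorem linSum_centred_mul_shifts :
    p.linSum (fun c => centred A D c * shifts s t c) =
      p.a₁ * (s * (A - A⁻¹)) + p.a₂ * (t * (D - D⁻¹)) := by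
  simp only [centred, shifts, linSum, Complex.real_smul, Matrix.cons_val]
  ring

variable (hA : A ≠ 0) (hD : D ≠ 0) (hS : p.linSum (centred A D) = 0)
  (H : p.SlaveEqs (centred A D) (shifts s t) μ ν σ σ' τ) (C : ℝ)
include hA hD hS H

theorem cubicCoeff_mobius :
    (p.mobius C 1).cubicCoeff (centred A D) (μ + 2 * C) (ν + C) =
      p.cubicCoeff (centred A D) μ ν := by
  have hμ := H.eq_μ
  have hν := H.eq_ν
  rw [linSum_centred] at hS
  linear_combination
    (norm := (simp only [QCoeffs.mobius, centred, cubicCoeff, linSum, pairSum, tripleSum,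
      Complex.real_smul, Matrix.cons_val, inv_inv]; push_cast; field_simp; ring))
    C * (A + A⁻¹ + D + D⁻¹) * (hμ + hν)
      + (2 * C * μ + C * ν * (A ^ 2 + A⁻¹ ^ 2 + D ^ 2 + D⁻¹ ^ 2 - 2)
        + C ^ 2 * (1 + (A ^ 2 + A⁻¹ ^ 2 + D ^ 2 + D⁻¹ ^ 2) / 2
          + 3 * (A + A⁻¹ + D + D⁻¹) ^ 2 / 2)) * hS

variable (hv : p.linSum (fun c => centred A D c * shifts s t c) = 0)
include hv

theorem SlaveEqs.mobius :
    (p.mobius C 1).SlaveEqs (centred A D) (shifts s t) (μ + 2 * C) (ν + C) σ σ' τ := by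
  obtain ⟨hμ, hν, hσ, hσ', hτ⟩ := H
  rw [linSum_centred] at hS
  rw [linSum_centred_mul_shifts] at hv
  refine ⟨?_, ?_, ?_, ?_, ?_⟩ <;>
    simp only [QCoeffs.mobius, centred, shifts, linSum, pairSum, Complex.real_smul,
      Matrix.cons_val, inv_inv] at hμ hν hσ hσ' hτ ⊢ <;>
    push_cast at hμ hν hσ hσ' hτ ⊢
  · linear_combination (norm := (field_simp; ring))
      hμ + 2 * C * (A + A⁻¹ + D + D⁻¹) * hS
  · linear_combination (norm := (field_simp; ring))
      hν + C * (A + A⁻¹ + D + D⁻¹) * hS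
  · linear_combination (norm := (field_simp; ring))
      hσ + C * ((A + A⁻¹ + D + D⁻¹) * hv + (s * (A - A⁻¹) + t * (D - D⁻¹)) * hS)
  · linear_combination (norm := (field_simp; ring))
      hσ' - C * ((A + A⁻¹ + D + D⁻¹) * hv + (s * (A - A⁻¹) + t * (D - D⁻¹)) * hS)
  · linear_combination (norm := (field_simp; ring))
      hτ + C * ((A + A⁻¹ + D + D⁻¹) * hv + (s * (A - A⁻¹) + t * (D - D⁻¹)) * hS)

theorem cubicCoeffDeriv_mobius :
    (p.mobius C 1).cubicCoeffDeriv (centred A D) (shifts s t) (μ + 2 * C) (ν + C) σ τ =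
      p.cubicCoeffDeriv (centred A D) (shifts s t) μ ν σ τ := by
  have hμ := H.eq_μ
  have hσ := H.eq_σ
  have hτ := H.eq_τ
  rw [linSum_centred] at hS
  rw [linSum_centred_mul_shifts] at hv
  linear_combination
    (norm := (simp only [QCoeffs.mobius, centred, shifts, cubicCoeffDeriv, linSum, pairSum,
      tripleSum, Complex.real_smul, Matrix.cons_val, inv_inv]; push_cast; field_simp; ring))
    C * (A + A⁻¹ + D + D⁻¹) * (hτ + hσ) + C * (s * (A - A⁻¹) + t * (D - D⁻¹)) * hμ
      + C * ((2 * σ + 2 * ν * (s * (A ^ 2 - A⁻¹ ^ 2) + t * (D ^ 2 - D⁻¹ ^ 2))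
          + τ * (A ^ 2 + A⁻¹ ^ 2 + D ^ 2 + D⁻¹ ^ 2) - 2 * τ) * hS - 4 * ν * hv)
      + C ^ 2 * ((s * (A ^ 2 - A⁻¹ ^ 2) + t * (D ^ 2 - D⁻¹ ^ 2)
          + 2 * (A + A⁻¹ + D + D⁻¹) * (s * (A - A⁻¹) + t * (D - D⁻¹))) * hS
        + ((A + A⁻¹ + D + D⁻¹) ^ 2 - 2) * hv)

theorem cubicCoeffConjDeriv_mobius :
    (p.mobius C 1).cubicCoeffConjDeriv (centred A D) (shifts s t) (μ + 2 * C) (ν + C) σ' =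
      p.cubicCoeffConjDeriv (centred A D) (shifts s t) μ ν σ' := by
  have hν := H.eq_ν
  have hσ' := H.eq_σ'
  rw [linSum_centred] at hS
  rw [linSum_centred_mul_shifts] at hv
  linear_combination
    (norm := (simp only [QCoeffs.mobius, centred, shifts, cubicCoeffConjDeriv, linSum, pairSum,
      tripleSum, Complex.real_smul, Matrix.cons_val, inv_inv]; push_cast; field_simp; ring))
    C * (A + A⁻¹ + D + D⁻¹) * hσ' - C * (s * (A - A⁻¹) + t * (D - D⁻¹)) * hν
      + C * (2 * σ' * hS
        - (ν * (A ^ 2 + A⁻¹ ^ 2 + D ^ 2 + D⁻¹ ^ 2) + 2 * μ + 2 * ν) * hv)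
      - C ^ 2 * ((A + A⁻¹ + D + D⁻¹) * (s * (A - A⁻¹) + t * (D - D⁻¹)) * hS
        + ((A ^ 2 + A⁻¹ ^ 2 + D ^ 2 + D⁻¹ ^ 2) / 2 + (A + A⁻¹ + D + D⁻¹) ^ 2 / 2 + 3) * hv)

omit H hv in
theorem ReducedEqs.mobius
    (H : p.ReducedEqs (centred A D) (shifts s t) (shifts r q) ρ₁ ρ₂ B a b μ ν σ σ' τ) :
    (p.mobius C 1).ReducedEqs (centred A D) (shifts s t) (shifts r q) ρ₁ ρ₂ B a b
      (μ + 2 * C) (ν + C) σ σ' τ := by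
  refine ⟨H.toSlaveEqs.mobius hA hD hS C H.velocity, ?_, ?_, ?_, ?_, ?_, ?_⟩ <;>
    simp only [linSum_mobius, cubicCoeff_mobius hA hD hS H.toSlaveEqs,
      cubicCoeffDeriv_mobius hA hD hS H.toSlaveEqs C H.velocity,
      cubicCoeffConjDeriv_mobius hA hD hS H.toSlaveEqs C H.velocity]
  exacts [H.velocity, H.dispersion₂, H.cubic, H.dispersion₃, H.deriv, H.conjDeriv]

end mobius

end QCoeffs

/-! ### Carriers -/

namespace QCoeffs

open DiffPoly

/-- The unimodular number `e^{iφ}`; a carrier has `K = e^{i(φ+ψ)}` and `Ω = e^{i(φ-ψ)}` with half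
angles `φ` and `ψ`, that is, `κ = φ + ψ` and `ω = ψ - φ`. -/
def phase (φ : ℝ) : ℂ := Complex.exp (φ * Complex.I)

theorem phase_ne_zero (φ : ℝ) : phase φ ≠ 0 := Complex.exp_ne_zero _

theorem phase_add (φ ψ : ℝ) : phase (φ + ψ) = phase φ * phase ψ := by
  rw [phase, phase, phase, ← Complex.exp_add, Complex.ofReal_add, add_mul]

theorem phase_neg (φ : ℝ) : phase (-φ) = (phase φ)⁻¹ := by
  rw [phase, phase, ← Complex.exp_neg, Complex.ofReal_neg, neg_mul]

theorem conj_phase (φ : ℝ) : starRingEnd ℂ (phase φ) = (phase φ)⁻¹ := by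
  rw [phase, ← Complex.exp_conj, ← Complex.exp_neg]
  simp

theorem phase_eq (φ : ℝ) : phase φ = Real.cos φ + Real.sin φ * Complex.I := by
  rw [phase, Complex.exp_mul_I, Complex.ofReal_cos, Complex.ofReal_sin]

theorem inv_phase_eq (φ : ℝ) : (phase φ)⁻¹ = Real.cos φ - Real.sin φ * Complex.I := by
  rw [← phase_neg, phase_eq, Real.cos_neg, Real.sin_neg, Complex.ofReal_neg, neg_mul,
    sub_eq_add_neg]

theorem carrierK_add (φ ψ : ℝ) : carrierK (φ + ψ) = phase φ * phase ψ := by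
  rw [← phase_add, carrierK, phase, mul_comm]

theorem carrierΩ_sub (φ ψ : ℝ) : carrierΩ (ψ - φ) = phase φ * (phase ψ)⁻¹ := by
  rw [← phase_neg, ← phase_add, carrierΩ, phase]
  congr 1
  push_cast
  ring

theorem exists_half_angles (κ ω : ℝ) : ∃ φ ψ, κ = φ + ψ ∧ ω = ψ - φ :=
  ⟨(κ - ω) / 2, (κ + ω) / 2, by ring, by ring⟩

theorem carrier_factors (φ ψ : ℝ) :
    ![1, carrierK (φ + ψ), carrierΩ (ψ - φ), carrierK (φ + ψ) * carrierΩ (ψ - φ)] =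
      fun c => phase φ * centred (phase φ) (phase ψ) c := by
  have hφ := phase_ne_zero φ
  have hψ := phase_ne_zero ψ
  funext c
  fin_cases c <;> simp [centred, carrierK_add, carrierΩ_sub, hφ]
  field_simp

theorem conj_centred_phase (φ ψ : ℝ) (c : Fin 4) :
    starRingEnd ℂ (centred (phase φ) (phase ψ) c) = (centred (phase φ) (phase ψ) c)⁻¹ := by
  fin_cases c <;> simp [centred, conj_phase]

theorem linSymbol_eq_linSum (p : QCoeffs) (κ ω : ℝ) (α : ℕ) :
    p.linSymbol κ ω α = p.linSum fun c =>
      ![1, carrierK κ, carrierΩ ω, carrierK κ * carrierΩ ω] c ^ α := by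
  simp only [linSymbol, linSum, Matrix.cons_val, one_pow, Complex.real_smul]

theorem linSymbol_half_angles (p : QCoeffs) (φ ψ : ℝ) (α : ℕ) :
    p.linSymbol (φ + ψ) (ψ - φ) α =
      phase φ ^ α * p.linSum fun c => centred (phase φ) (phase ψ) c ^ α := by
  simp only [linSymbol_eq_linSum, carrier_factors, mul_linSum, mul_pow]

theorem IsDispersive.add_ne_zero {p : QCoeffs} (hp : p.IsDispersive) : p.a₁ + p.a₂ ≠ 0 := by
  intro h
  apply hp.2.2
  rw [eq_neg_of_add_eq_zero_left h, abs_neg]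

theorem IsDispersive.sq_sub_sq_ne_zero {p : QCoeffs} (hp : p.IsDispersive) :
    p.a₁ ^ 2 - p.a₂ ^ 2 ≠ 0 :=
  sub_ne_zero.2 fun h => hp.2.2 (sq_eq_sq_iff_abs_eq_abs _ _ |>.1 h)

theorem linSum_one (p : QCoeffs) : p.linSum (fun _ => (1 : ℂ)) = (2 * (p.a₁ + p.a₂) : ℝ) := by
  simp only [linSum, Complex.real_smul]
  push_cast
  ring

section carrier

variable {p : QCoeffs} {φ ψ : ℝ}

theorem IsCarrier.linSum_centred_eq_zero (hc : p.IsCarrier (φ + ψ) (ψ - φ)) :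
    p.linSum (centred (phase φ) (phase ψ)) = 0 := by
  simpa [linSymbol_half_angles, phase_ne_zero] using hc.dispersion

theorem IsCarrier.linSum_centred_pow_ne_zero (hp : p.IsDispersive)
    (hc : p.IsCarrier (φ + ψ) (ψ - φ)) {α : ℕ} (hα : α ≠ 1) (hα₄ : α ≤ 4) :
    p.linSum (fun c => centred (phase φ) (phase ψ) c ^ α) ≠ 0 := by
  rcases Nat.eq_zero_or_pos α with rfl | hα₀
  · simp only [pow_zero, linSum_one]
    exact Complex.ofReal_ne_zero.2 (mul_ne_zero two_ne_zero hp.add_ne_zero)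
  · have h := hc.nonresonant α (by omega) hα₄
    rw [linSymbol_half_angles] at h
    exact right_ne_zero_of_mul h

theorem IsCarrier.linSum_one_ne_zero (hp : p.IsDispersive) (hc : p.IsCarrier (φ + ψ) (ψ - φ)) :
    p.linSum (fun _ => (1 : ℂ)) ≠ 0 := by
  simpa only [pow_zero] using hc.linSum_centred_pow_ne_zero hp zero_ne_one (Nat.zero_le 4)

theorem IsCarrier.linSum_centred_zpow_ne_zero (hp : p.IsDispersive)
    (hc : p.IsCarrier (φ + ψ) (ψ - φ)) (α : ℤ) (hα : α ≠ 1) (hα' : α ≠ -1) (hα₄ : α.natAbs ≤ 4) :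
    p.linSum (fun c => centred (phase φ) (phase ψ) c ^ α) ≠ 0 := by
  have hpow := hc.linSum_centred_pow_ne_zero hp (α := α.natAbs) (by omega) hα₄
  rcases Int.natAbs_eq α with h | h <;> rw [h]
  · simpa only [zpow_natCast] using hpow
  · rw [← p.conj_linSum_zpow (conj_centred_phase φ ψ)]
    simpa only [zpow_natCast, ne_eq, map_eq_zero] using hpow

theorem corner_shifts_ξ (v : ℝ) : (fun c => ((![0, 1, -v, 1 - v] : Fin 4 → ℝ) c : ℂ)) =
    fun c => (1 - v) / 2 + shifts ((1 - v) / 2) ((1 + v) / 2) c := by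
  funext c
  fin_cases c <;> simp [shifts] <;> ring

theorem corner_shifts_m : (fun c => ((![0, 0, 1, 1] : Fin 4 → ℝ) c : ℂ)) =
    fun c => 1 / 2 + shifts (1 / 2) (-1 / 2) c := by
  funext c
  fin_cases c <;> norm_num [shifts]

theorem hasReduction_iff_cornerExpansion {v ρ₁ B : ℝ} {ρ₂ a b : ℂ} :
    p.HasReduction (φ + ψ) (ψ - φ) v ρ₁ ρ₂ B a b ↔ ρ₁ ≠ 0 ∧
      ∃ (F₂ F₃ : ℕ → DiffPoly) (h : ℕ → ℤ → DiffPoly), F₂ 1 = K₂ ρ₁ ρ₂ ∧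
        F₂ 2 = K₂' ρ₁ ρ₂ + f₂ a b ∧ F₃ 1 = K₃ ρ₁ ρ₂ B ∧ IsAnsatz h ∧
        ∀ j ≤ 4, ∀ α, coeffAt j α (p.cornerExpansion
          (fun c => phase φ * centred (phase φ) (phase ψ) c)
          ![0, 1, -v, 1 - v] ![0, 0, 1, 1] F₂ F₃ h) = 0 := by
  simp only [HasReduction, expansion_eq_cornerExpansion, carrier_factors, coeff_eq_zero_iff]
  exact and_congr_right fun _ => exists₃_congr fun _ _ _ => and_congr_right fun _ =>
    and_congr_right fun _ => and_congr_right fun _ =>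
      ⟨fun ⟨first, neg, hW⟩ => ⟨⟨first, neg⟩, hW⟩, fun ⟨hh, hW⟩ => ⟨hh.first, hh.neg, hW⟩⟩

theorem IsCarrier.hasReduction_iff (hp : p.IsDispersive) (hc : p.IsCarrier (φ + ψ) (ψ - φ))
    {v ρ₁ B : ℝ} {ρ₂ a b : ℂ} : p.HasReduction (φ + ψ) (ψ - φ) v ρ₁ ρ₂ B a b ↔ ρ₁ ≠ 0 ∧
      ∃ μ ν σ σ' τ : ℂ, p.ReducedEqs (centred (phase φ) (phase ψ))
        (shifts ((1 - v) / 2) ((1 + v) / 2)) (shifts (1 / 2) (-1 / 2)) ρ₁ ρ₂ B a b μ ν σ σ' τ := by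
  have hS := hc.linSum_centred_eq_zero
  have hφ := phase_ne_zero φ
  have hz (c : Fin 4) : starRingEnd ℂ (phase φ * centred (phase φ) (phase ψ) c) =
      (phase φ * centred (phase φ) (phase ψ) c)⁻¹ := by
    rw [map_mul, conj_phase, conj_centred_phase, mul_inv]
  have hS' : p.linSum (fun c => phase φ * centred (phase φ) (phase ψ) c) = 0 := by
    rw [← mul_linSum, hS, mul_zero]
  have hL (α : ℤ) (hα : α ≠ 1) (hα' : α ≠ -1) (hα₄ : α.natAbs ≤ 4) :
      p.linSum (fun c => (phase φ * centred (phase φ) (phase ψ) c) ^ α) ≠ 0 := by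
    simp only [mul_zpow, ← mul_linSum]
    exact mul_ne_zero (zpow_ne_zero _ hφ) (hc.linSum_centred_zpow_ne_zero hp α hα hα' hα₄)
  have hL₂ : p.linSum (fun c => (phase φ * centred (phase φ) (phase ψ) c) ^ 2) ≠ 0 := by
    exact_mod_cast hL 2 (by norm_num) (by norm_num) (by norm_num)
  simp only [hasReduction_iff_cornerExpansion,
    ← reducedEqs_gauge_iff hS hφ ((1 - v) / 2) (1 / 2), ← corner_shifts_ξ, ← corner_shifts_m]
  refine and_congr_right fun hρ => ⟨?_, ?_⟩
  · rintro ⟨F₂, F₃, h, hF₂, hF₂', hF₃, hh, hW⟩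
    exact p.reducedEqs_of_expansion hρ hF₂ hF₂' hF₃ hh hS' (hc.linSum_one_ne_zero hp) hL₂ hW
  · rintro ⟨μ, ν, σ, σ', τ, H⟩
    exact H.exists_expansion p hρ hz hS' hL

end carrier

/-! ### Möbius invariance -/

theorem IsDispersive.mobius {p : QCoeffs} (hp : p.IsDispersive) (C : ℝ) {D : ℝ} (hD : D ≠ 0) :
    (p.mobius C D).IsDispersive := by
  obtain ⟨ha₁, ha₂, habs⟩ := hp
  have hD₃ : D ^ 3 ≠ 0 := pow_ne_zero 3 hD
  refine ⟨mul_ne_zero hD₃ ha₁, mul_ne_zero hD₃ ha₂, ?_⟩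
  simp only [QCoeffs.mobius, abs_mul]
  exact fun h => habs (mul_left_cancel₀ (abs_ne_zero.2 hD₃) h)

theorem isCarrier_mobius {p : QCoeffs} (C κ ω : ℝ) :
    (p.mobius C 1).IsCarrier κ ω ↔ p.IsCarrier κ ω := by
  have linSymbol_mobius : (p.mobius C 1).linSymbol κ ω = p.linSymbol κ ω := by
    funext α
    simp [linSymbol, QCoeffs.mobius]
  constructor <;> rintro ⟨dispersion, sin_ne_zero, nonresonant⟩
  · exact ⟨linSymbol_mobius ▸ dispersion, sin_ne_zero, linSymbol_mobius ▸ nonresonant⟩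
  · exact ⟨linSymbol_mobius ▸ dispersion, sin_ne_zero, linSymbol_mobius ▸ nonresonant⟩

theorem IsA2Integrable.mobius {p : QCoeffs} (hp : p.IsDispersive) (h : p.IsA2Integrable) (C : ℝ) :
    (p.mobius C 1).IsA2Integrable := by
  intro κ ω hc
  obtain ⟨φ, ψ, rfl, rfl⟩ := exists_half_angles κ ω
  have hc' := (isCarrier_mobius C _ _).1 hc
  obtain ⟨v, ρ₁, ρ₂, B, a, b, hred, hreal⟩ := h _ _ hc'
  refine ⟨v, ρ₁, ρ₂, B, a, b, (hc.hasReduction_iff (hp.mobius C one_ne_zero)).2 ?_, hreal⟩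
  obtain ⟨hρ, μ, ν, σ, σ', τ, H⟩ := (hc'.hasReduction_iff hp).1 hred
  exact ⟨hρ, _, _, _, _, _,
    H.mobius (phase_ne_zero φ) (phase_ne_zero ψ) hc'.linSum_centred_eq_zero C⟩

theorem mobius_mobius_neg (p : QCoeffs) (C : ℝ) : (p.mobius C 1).mobius (-C) 1 = p := by
  ext <;> simp only [QCoeffs.mobius] <;> ring

theorem isA2Integrable_mobius {p : QCoeffs} (hp : p.IsDispersive) (C : ℝ) :
    (p.mobius C 1).IsA2Integrable ↔ p.IsA2Integrable :=
  ⟨fun h => p.mobius_mobius_neg C ▸ h.mobius (hp.mobius C one_ne_zero) (-C),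
    fun h => h.mobius hp C⟩

theorem case1_mobius (p : QCoeffs) (C : ℝ) {D : ℝ} (hD : D ≠ 0) :
    (p.mobius C D).Case1 ↔ p.Case1 := by
  simp only [Case1, QCoeffs.mobius, mul_eq_zero, pow_eq_zero_iff two_ne_zero, hD, false_or]
  refine and_congr_right fun hα₂ => and_congr_right fun hβ₂ => ?_
  simp [hα₂, hβ₂, hD]

theorem case4_mobius {p : QCoeffs} (hp : p.a₁ ≠ 0) (C : ℝ) {D : ℝ} (hD : D ≠ 0) :
    (p.mobius C D).Case4 ↔ p.Case4 := by
  have shifted_iff (x : ℝ) : D ^ 2 * (x + C * (p.a₁ + p.a₂)) = (D ^ 3 * p.a₁ + D ^ 3 * p.a₂) *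
      (D ^ 2 * (p.γ₁ + 2 * C * p.a₁)) / (2 * (D ^ 3 * p.a₁)) ↔
      x = (p.a₁ + p.a₂) * p.γ₁ / (2 * p.a₁) := by
    field_simp
    constructor <;> intro h <;> linear_combination h
  simp only [Case4, QCoeffs.mobius, shifted_iff]
  refine and_congr_right fun _ => and_congr_right fun _ =>
    and_congr ?_ (and_congr ?_ (and_congr ?_ ?_))
  · field_simp
    constructor <;> intro h <;> linear_combination h
  · rw [← mul_right_inj' (pow_ne_zero 4 hD) (b := p.a₁ * (p.ξ₁ - p.ξ₂))]
    constructor <;> intro h <;> linear_combination h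
  · rw [← mul_right_inj' (pow_ne_zero 4 hD) (b := p.a₁ * (p.ξ₃ - p.ξ₄))]
    constructor <;> intro h <;> linear_combination h
  · simp [hD]

end QCoeffs

/-! ### Reversible equations are integrable -/

namespace QCoeffs

/-- The point reflection of the cell multiplies the quadratic part of the equation by `ε` and
preserves the cubic part. -/
structure IsReversible (p : QCoeffs) (ε : ℂ) : Prop where
  mul_self : ε * ε = 1
  pair : ∀ B : Fin 4 → Fin 4 → ℂ, (∀ c d, B c d = B d c) →
    p.pairSum (fun c d => B c.rev d.rev) = ε * p.pairSum B
  triple : ∀ B : Fin 4 → Fin 4 → Fin 4 → ℂ, (∀ c d e, B c d e = B e d c) →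
    p.tripleSum (fun c d e => B c.rev d.rev e.rev) = p.tripleSum B

theorem Case1.isReversible {p : QCoeffs} (h : p.Case1) : p.IsReversible 1 := by
  obtain ⟨hα₂, hβ₂, hξ₁, hξ₃⟩ := h
  refine ⟨one_mul 1, fun B hB => ?_, fun B hB => ?_⟩
  · simp only [pairSum, hα₂, hβ₂, Complex.real_smul, Fin.rev, Fin.isValue]
    simp [hB 3 2, hB 1 0, hB 3 1, hB 2 0, hB 3 0, hB 2 1]
    ring
  · simp only [tripleSum, hξ₁, hξ₃, Complex.real_smul, Fin.rev, Fin.isValue]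
    simp [hB 3 2 1, hB 3 2 0, hB 2 1 0, hB 3 1 0]
    ring

theorem Case4.isReversible {p : QCoeffs} (h : p.Case4) (ha₁ : p.a₁ ≠ 0) (hγ₁ : p.γ₁ = 0) :
    p.IsReversible (-1) := by
  obtain ⟨hα₁, hβ₁, hγ₂, hξ₁, hξ₃, -⟩ := h
  simp only [hγ₁, mul_zero, zero_div, neg_zero, mul_eq_zero, ha₁, false_or,
    sub_eq_zero] at hα₁ hβ₁ hγ₂ hξ₁ hξ₃
  refine ⟨by norm_num, fun B hB => ?_, fun B hB => ?_⟩
  · simp only [pairSum, hα₁, hβ₁, hγ₂, hγ₁, Complex.real_smul, Fin.rev, Fin.isValue]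
    simp [hB 3 2, hB 1 0, hB 3 1, hB 2 0]
    ring
  · simp only [tripleSum, hξ₁, hξ₃, Complex.real_smul, Fin.rev, Fin.isValue]
    simp [hB 3 2 1, hB 3 2 0, hB 2 1 0, hB 3 1 0]
    ring

section reversal

variable {p : QCoeffs} {ε : ℂ}

theorem conj_linSum_of_rev {x : Fin 4 → ℂ} (η : ℂ)
    (hx : ∀ c, starRingEnd ℂ (x c) = η * x c.rev) :
    starRingEnd ℂ (p.linSum x) = η * p.linSum x := by
  simp [linSum, hx, Fin.rev]
  ring

theorem IsReversible.conj_pairSum (hp : p.IsReversible ε) {B : Fin 4 → Fin 4 → ℂ} (η : ℂ)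
    (hB : ∀ c d, B c d = B d c) (hB' : ∀ c d, starRingEnd ℂ (B c d) = η * B c.rev d.rev) :
    starRingEnd ℂ (p.pairSum B) = ε * η * p.pairSum B :=
  calc starRingEnd ℂ (p.pairSum B) = p.pairSum fun c d => η * B c.rev d.rev := by
        simp [pairSum, hB']
    _ = ε * η * p.pairSum B := by
        rw [← mul_pairSum, hp.pair B hB]
        ring

theorem IsReversible.conj_tripleSum (hp : p.IsReversible ε) {B : Fin 4 → Fin 4 → Fin 4 → ℂ}
    (η : ℂ) (hB : ∀ c d e, B c d e = B e d c)
    (hB' : ∀ c d e, starRingEnd ℂ (B c d e) = η * B c.rev d.rev e.rev) :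
    starRingEnd ℂ (p.tripleSum B) = η * p.tripleSum B :=
  calc starRingEnd ℂ (p.tripleSum B) = p.tripleSum fun c d e => η * B c.rev d.rev e.rev := by
        simp [tripleSum, hB']
    _ = η * p.tripleSum B := by rw [← mul_tripleSum, hp.triple B hB]

theorem conj_eq_mul_of_linear_eq {L Q x η : ℂ} (hL : L ≠ 0) (hL' : starRingEnd ℂ L = L)
    (hQ : starRingEnd ℂ Q = η * Q) (h : L * x + Q = 0) : starRingEnd ℂ x = η * x := by
  have h' := congrArg (starRingEnd ℂ) h
  simp only [map_add, map_mul, map_zero, hL', hQ] at h'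
  apply mul_left_cancel₀ hL
  linear_combination h' - η * h

variable {z s t : Fin 4 → ℂ} {μ ν σ σ' τ : ℂ} (hp : p.IsReversible ε)
  (hz : ∀ c, starRingEnd ℂ (z c) = z c.rev) (hs : ∀ c, starRingEnd ℂ (s c) = -s c.rev)
include hp hz

theorem IsReversible.conj_cubicCoeff (hμ : starRingEnd ℂ μ = ε * μ)
    (hν : starRingEnd ℂ ν = ε * ν) :
    starRingEnd ℂ (p.cubicCoeff z μ ν) = p.cubicCoeff z μ ν := by
  rw [cubicCoeff, map_add, hp.conj_pairSum ε, hp.conj_tripleSum 1, hp.mul_self, one_mul, one_mul]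
  · exact fun _ _ _ => by ring
  · exact fun _ _ _ => by simp [hz]
  · exact fun _ _ => by ring
  · exact fun _ _ => by simp [hz, hμ, hν]; ring

include hs

theorem IsReversible.conj_cubicCoeffDeriv (hμ : starRingEnd ℂ μ = ε * μ)
    (hν : starRingEnd ℂ ν = ε * ν) (hσ : starRingEnd ℂ σ = -ε * σ)
    (hτ : starRingEnd ℂ τ = -ε * τ) :
    starRingEnd ℂ (p.cubicCoeffDeriv z s μ ν σ τ) = -p.cubicCoeffDeriv z s μ ν σ τ := by
  rw [cubicCoeffDeriv, map_add, hp.conj_pairSum (-ε), hp.conj_tripleSum (-1), mul_neg, hp.mul_self]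
  · ring
  · exact fun _ _ _ => by ring
  · exact fun _ _ _ => by simp [hz, hs]; ring
  · exact fun _ _ => by ring
  · exact fun _ _ => by simp [hz, hs, hμ, hν, hσ, hτ, map_ofNat]; ring

theorem IsReversible.conj_cubicCoeffConjDeriv (hμ : starRingEnd ℂ μ = ε * μ)
    (hν : starRingEnd ℂ ν = ε * ν) (hσ : starRingEnd ℂ σ = -ε * σ) :
    starRingEnd ℂ (p.cubicCoeffConjDeriv z s μ ν σ) = -p.cubicCoeffConjDeriv z s μ ν σ := by
  rw [cubicCoeffConjDeriv, map_add, hp.conj_pairSum (-ε), hp.conj_tripleSum (-1), mul_neg,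
    hp.mul_self]
  · ring
  · exact fun _ _ _ => by ring
  · exact fun _ _ _ => by simp [hz, hs]; ring
  · exact fun _ _ => by ring
  · exact fun _ _ => by simp [hz, hs, hμ, hν, hσ]; ring

theorem IsReversible.conj_slaveEqs (H : p.SlaveEqs z s μ ν σ σ' τ)
    (hL₀ : p.linSum (fun _ => (1 : ℂ)) ≠ 0) (hL₂ : p.linSum (fun c => z c ^ 2) ≠ 0) :
    starRingEnd ℂ μ = ε * μ ∧ starRingEnd ℂ ν = ε * ν ∧ starRingEnd ℂ σ = -ε * σ ∧
      starRingEnd ℂ σ' = -ε * σ' ∧ starRingEnd ℂ τ = -ε * τ := by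
  have conj_L₀ : starRingEnd ℂ (p.linSum fun _ => (1 : ℂ)) = p.linSum fun _ => (1 : ℂ) := by
    rw [conj_linSum_of_rev 1 fun _ => by simp, one_mul]
  have conj_L₂ : starRingEnd ℂ (p.linSum fun c => z c ^ 2) = p.linSum fun c => z c ^ 2 := by
    rw [conj_linSum_of_rev 1 fun _ => by simp [hz], one_mul]
  have conj_linSum_s : starRingEnd ℂ (p.linSum s) = -1 * p.linSum s :=
    conj_linSum_of_rev _ fun _ => by simp [hs]
  have conj_linSum_sq_mul : starRingEnd ℂ (p.linSum fun c => z c ^ 2 * s c) =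
      -1 * p.linSum fun c => z c ^ 2 * s c :=
    conj_linSum_of_rev _ fun _ => by simp [hz, hs]
  have hμ : starRingEnd ℂ μ = ε * μ := by
    refine conj_eq_mul_of_linear_eq hL₀ conj_L₀ ?_ H.eq_μ
    rw [hp.conj_pairSum 1 (fun _ _ => by ring) fun _ _ => by simp [hz], mul_one]
  have hν : starRingEnd ℂ ν = ε * ν := by
    refine conj_eq_mul_of_linear_eq hL₂ conj_L₂ ?_ H.eq_ν
    rw [hp.conj_pairSum 1 (fun _ _ => by ring) fun _ _ => by simp [hz], mul_one]
  refine ⟨hμ, hν, conj_eq_mul_of_linear_eq hL₀ conj_L₀ ?_ H.eq_σ,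
    conj_eq_mul_of_linear_eq hL₀ conj_L₀ ?_ H.eq_σ',
    conj_eq_mul_of_linear_eq hL₂ conj_L₂ ?_ H.eq_τ⟩
  · rw [map_add, map_mul, hμ, conj_linSum_s, hp.conj_pairSum (-1) (fun _ _ => by ring)
      fun _ _ => by simp [hz, hs]; ring]
    ring
  · rw [map_add, map_mul, hμ, conj_linSum_s, hp.conj_pairSum (-1) (fun _ _ => by ring)
      fun _ _ => by simp [hz, hs]; ring]
    ring
  · rw [map_add, map_mul, map_mul, map_ofNat, hν, conj_linSum_sq_mul,
      hp.conj_pairSum (-1) (fun _ _ => by ring) fun _ _ => by simp [hz, hs]; ring]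
    ring

theorem IsReversible.im_eq_zero_of_reducedEqs {ρ₁ B : ℝ} {ρ₂ a b : ℂ}
    (H : p.ReducedEqs z s t ρ₁ ρ₂ B a b μ ν σ σ' τ) (ht : ∀ c, starRingEnd ℂ (t c) = -t c.rev)
    (hL₀ : p.linSum (fun _ => (1 : ℂ)) ≠ 0) (hL₂ : p.linSum (fun c => z c ^ 2) ≠ 0)
    (hT : p.linSum (fun c => z c * t c) ≠ 0) : ρ₂.im = 0 ∧ a.im = 0 ∧ b.im = 0 := by
  obtain ⟨hμ, hν, hσ, hσ', hτ⟩ := hp.conj_slaveEqs hz hs H.toSlaveEqs hL₀ hL₂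
  have conj_linSum_t : starRingEnd ℂ (p.linSum fun c => z c * t c) =
      -1 * p.linSum fun c => z c * t c :=
    conj_linSum_of_rev _ fun _ => by simp [hz, ht]
  have conj_linSum_s_t : starRingEnd ℂ (p.linSum fun c => z c * (s c * t c)) =
      1 * p.linSum fun c => z c * (s c * t c) :=
    conj_linSum_of_rev _ fun _ => by simp [hz, hs, ht]
  have cubic := congrArg (starRingEnd ℂ) H.cubic
  have deriv := congrArg (starRingEnd ℂ) H.deriv
  have conjDeriv := congrArg (starRingEnd ℂ) H.conjDeriv
  simp only [map_add, map_mul, map_neg, map_div₀, map_zero, map_ofNat, conj_linSum_t,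
    conj_linSum_s_t, hp.conj_cubicCoeff hz hμ hν, hp.conj_cubicCoeffDeriv hz hs hμ hν hσ hτ,
    hp.conj_cubicCoeffConjDeriv hz hs hμ hν hσ', Complex.conj_I, Complex.conj_ofReal]
    at cubic deriv conjDeriv
  have hρ₂ : starRingEnd ℂ ρ₂ = ρ₂ := by
    apply mul_left_cancel₀ (mul_ne_zero hT Complex.I_ne_zero)
    linear_combination H.cubic - cubic
  rw [hρ₂] at deriv conjDeriv
  refine ⟨Complex.conj_eq_iff_im.1 hρ₂, Complex.conj_eq_iff_im.1 ?_, Complex.conj_eq_iff_im.1 ?_⟩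
  · apply mul_left_cancel₀ hT
    linear_combination -H.deriv - deriv
  · apply mul_left_cancel₀ hT
    linear_combination -H.conjDeriv - conjDeriv

end reversal

section phase

variable (p : QCoeffs) (φ ψ : ℝ) (s t r q : ℂ)

theorem linSum_centred_phase :
    p.linSum (centred (phase φ) (phase ψ)) = 2 * (p.a₁ * Real.cos φ + p.a₂ * Real.cos ψ) := by
  simp only [linSum_centred, inv_phase_eq]
  simp only [phase_eq]
  ring

theorem linSum_centred_phase_mul_shifts :
    p.linSum (fun c => centred (phase φ) (phase ψ) c * shifts s t c) =
      2 * Complex.I * (p.a₁ * Real.sin φ * s + p.a₂ * Real.sin ψ * t) := by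
  simp only [linSum_centred_mul_shifts, inv_phase_eq]
  simp only [phase_eq]
  ring

theorem linSum_centred_phase_mul_shifts_mul_shifts :
    p.linSum (fun c => centred (phase φ) (phase ψ) c * (shifts s t c * shifts r q c)) =
      2 * (p.a₁ * Real.cos φ * (s * r) + p.a₂ * Real.cos ψ * (t * q)) := by
  simp only [linSum, centred, shifts, Complex.real_smul, Matrix.cons_val, inv_phase_eq]
  simp only [phase_eq]
  ring

theorem linSum_centred_phase_mul_shifts_pow_three :
    p.linSum (fun c => centred (phase φ) (phase ψ) c * shifts s t c ^ 3) =
      2 * Complex.I * (p.a₁ * Real.sin φ * s ^ 3 + p.a₂ * Real.sin ψ * t ^ 3) := by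
  simp only [linSum, centred, shifts, Complex.real_smul, Matrix.cons_val, inv_phase_eq]
  simp only [phase_eq]
  ring

theorem linSum_centred_phase_mul_half_shifts :
    p.linSum (fun c => centred (phase φ) (phase ψ) c * shifts (1 / 2) (-1 / 2) c) =
      Complex.I * (p.a₁ * Real.sin φ - p.a₂ * Real.sin ψ : ℝ) := by
  rw [linSum_centred_phase_mul_shifts]
  push_cast
  ring

end phase

section carrier

variable {p : QCoeffs} {φ ψ : ℝ}

theorem IsCarrier.cos_eq (hc : p.IsCarrier (φ + ψ) (ψ - φ)) :
    p.a₁ * Real.cos φ + p.a₂ * Real.cos ψ = 0 := by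
  have h := hc.linSum_centred_eq_zero
  rw [linSum_centred_phase, mul_eq_zero] at h
  exact_mod_cast h.resolve_left two_ne_zero

theorem IsCarrier.cos_ne_zero (hp : p.IsDispersive) (hc : p.IsCarrier (φ + ψ) (ψ - φ)) :
    Real.cos φ ≠ 0 := by
  intro hφ
  have hψ := hc.cos_eq
  rw [hφ, mul_zero, zero_add, mul_eq_zero, or_iff_right hp.2.1] at hψ
  apply hc.sin_ne_zero
  rw [Real.sin_add, hφ, hψ, mul_zero, zero_mul, add_zero]

theorem sin_ne_zero_of_cos_eq (hp : p.IsDispersive)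
    (h : p.a₁ * Real.cos φ + p.a₂ * Real.cos ψ = 0) :
    p.a₁ * Real.sin φ - p.a₂ * Real.sin ψ ≠ 0 ∧ p.a₁ * Real.sin φ + p.a₂ * Real.sin ψ ≠ 0 := by
  have product : (p.a₁ * Real.sin φ - p.a₂ * Real.sin ψ) * (p.a₁ * Real.sin φ + p.a₂ * Real.sin ψ)
      = p.a₁ ^ 2 - p.a₂ ^ 2 := by
    linear_combination p.a₁ ^ 2 * Real.sin_sq_add_cos_sq φ - p.a₂ ^ 2 * Real.sin_sq_add_cos_sq ψ
      - (p.a₁ * Real.cos φ - p.a₂ * Real.cos ψ) * h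
  rw [← mul_ne_zero_iff, product]
  exact hp.sq_sub_sq_ne_zero

theorem IsCarrier.linSum_half_shifts_ne_zero (hp : p.IsDispersive)
    (hc : p.IsCarrier (φ + ψ) (ψ - φ)) :
    p.linSum (fun c => centred (phase φ) (phase ψ) c * shifts (1 / 2) (-1 / 2) c) ≠ 0 := by
  rw [linSum_centred_phase_mul_half_shifts]
  exact mul_ne_zero Complex.I_ne_zero
    (Complex.ofReal_ne_zero.2 (sin_ne_zero_of_cos_eq hp hc.cos_eq).1)

theorem IsCarrier.exists_real_dispersion (hp : p.IsDispersive)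
    (hc : p.IsCarrier (φ + ψ) (ψ - φ)) : ∃ v ρ₁ B : ℝ, ρ₁ ≠ 0 ∧
      v * (p.a₁ * Real.sin φ - p.a₂ * Real.sin ψ) = p.a₁ * Real.sin φ + p.a₂ * Real.sin ψ ∧
      ρ₁ * (p.a₁ * Real.sin φ - p.a₂ * Real.sin ψ) = p.a₁ * Real.cos φ * v ∧
      B * (p.a₁ * Real.sin φ - p.a₂ * Real.sin ψ) = ρ₁ * (p.a₁ * Real.cos φ)
        - 1 / 3 * (p.a₁ * Real.sin φ * ((1 - v) / 2) ^ 3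
          + p.a₂ * Real.sin ψ * ((1 + v) / 2) ^ 3) := by
  obtain ⟨hsub, hadd⟩ := sin_ne_zero_of_cos_eq hp hc.cos_eq
  refine ⟨_, _, _, ?_, div_mul_cancel₀ _ hsub, div_mul_cancel₀ _ hsub, div_mul_cancel₀ _ hsub⟩
  exact div_ne_zero
    (mul_ne_zero (mul_ne_zero hp.1 (hc.cos_ne_zero hp)) (div_ne_zero hadd hsub)) hsub

theorem IsCarrier.exists_reducedEqs (hp : p.IsDispersive) (hc : p.IsCarrier (φ + ψ) (ψ - φ)) :
    ∃ (v ρ₁ B : ℝ) (ρ₂ a b μ ν σ σ' τ : ℂ), ρ₁ ≠ 0 ∧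
      p.ReducedEqs (centred (phase φ) (phase ψ)) (shifts ((1 - v) / 2) ((1 + v) / 2))
        (shifts (1 / 2) (-1 / 2)) ρ₁ ρ₂ B a b μ ν σ σ' τ := by
  have hT := hc.linSum_half_shifts_ne_zero hp
  obtain ⟨v, ρ₁, B, hρ₁, velocity, dispersion₂, dispersion₃⟩ := hc.exists_real_dispersion hp
  have cos_eq := congrArg Complex.ofReal hc.cos_eq
  replace velocity := congrArg Complex.ofReal velocity
  replace dispersion₂ := congrArg Complex.ofReal dispersion₂
  replace dispersion₃ := congrArg Complex.ofReal dispersion₃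
  push_cast at cos_eq velocity dispersion₂ dispersion₃
  obtain ⟨μ, ν, σ, σ', τ, H⟩ := p.exists_slaveEqs (z := centred (phase φ) (phase ψ))
    (shifts ((1 - v) / 2) ((1 + v) / 2)) (hc.linSum_one_ne_zero hp)
    (hc.linSum_centred_pow_ne_zero hp (by norm_num) (by norm_num))
  have solve (Q R : ℂ) : ∃ x, p.linSum (fun c =>
      centred (phase φ) (phase ψ) c * shifts (1 / 2) (-1 / 2) c) * (Q + x) + R = 0 :=
    ⟨-R / _ - Q, by rw [add_sub_cancel, mul_div_cancel₀ _ hT, neg_add_cancel]⟩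
  obtain ⟨w, hw⟩ := solve 0 (p.cubicCoeff (centred (phase φ) (phase ψ)) μ ν)
  obtain ⟨ρ₂, rfl⟩ : ∃ ρ₂, w = -Complex.I * ρ₂ := ⟨Complex.I * w, by ring_nf; simp⟩
  obtain ⟨a, ha⟩ := solve _ _
  obtain ⟨b, hb⟩ := solve 0 _
  refine ⟨v, ρ₁, B, ρ₂, a, b, μ, ν, σ, σ', τ, hρ₁, H, ?_, ?_, ?_, ?_, ?_, ?_⟩
  · rw [linSum_centred_phase_mul_shifts]
    push_cast
    linear_combination -Complex.I * velocity
  · simp only [sq]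
    rw [linSum_centred_phase_mul_half_shifts, linSum_centred_phase_mul_shifts_mul_shifts]
    push_cast
    linear_combination dispersion₂ + ((1 + v) / 2) ^ 2 * cos_eq
      - (p.a₁ * Complex.sin φ - p.a₂ * Complex.sin ψ) * ρ₁ * Complex.I_sq
  · linear_combination hw
  · rw [linSum_centred_phase_mul_half_shifts, linSum_centred_phase_mul_shifts_mul_shifts,
      linSum_centred_phase_mul_shifts_pow_three]
    push_cast
    linear_combination Complex.I * dispersion₃ + Complex.I * ρ₁ * ((1 + v) / 2) * cos_eq
  · rw [add_assoc]
    exact ha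
  · rw [zero_add] at hb
    rw [add_assoc]
    exact hb

theorem IsReversible.isA2Integrable {ε : ℂ} (h : p.IsReversible ε) (hp : p.IsDispersive) :
    p.IsA2Integrable := by
  intro κ ω hc
  obtain ⟨φ, ψ, rfl, rfl⟩ := exists_half_angles κ ω
  obtain ⟨v, ρ₁, B, ρ₂, a, b, μ, ν, σ, σ', τ, hρ, H⟩ := hc.exists_reducedEqs hp
  refine ⟨v, ρ₁, ρ₂, B, a, b, (hc.hasReduction_iff hp).2 ⟨hρ, _, _, _, _, _, H⟩,
    h.im_eq_zero_of_reducedEqs (fun c => ?_) (fun c => ?_) H (fun c => ?_)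
    (hc.linSum_one_ne_zero hp) (hc.linSum_centred_pow_ne_zero hp (by norm_num) (by norm_num))
    (hc.linSum_half_shifts_ne_zero hp)⟩
  · fin_cases c <;> simp [centred, conj_phase, Fin.rev]
  · fin_cases c <;> simp [shifts, Fin.rev, map_ofNat]
  · fin_cases c <;> simp [shifts, Fin.rev, map_ofNat]

end carrier

end QCoeffs

/-! ### The reality conditions as polynomial identities -/

namespace QCoeffs

/-- For `γ₁ = 0`, the imaginary part of the coefficient of `|u|²u`, up to a nonzero real factor, at
the carrier with half angles `φ` and `ψ`, where `c = cos φ`, `d = cos ψ`, `X = sin φ`,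
`Y = sin ψ`. -/
def cubicIm (p : QCoeffs) (c d X Y : ℝ) : ℝ :=
  let S := p.α₁ + p.β₁
  let H := p.α₁ - p.β₁
  let U := p.α₂ - p.β₂
  let V := p.α₂ + p.β₂
  (2 * c * d + 1) * (4 * S * c * d - 4 * H * X * Y + 2 * p.γ₂ * (d ^ 2 - Y ^ 2))
      * (2 * (V * X - U * Y))
    - ((2 * S * c * d + 2 * H * X * Y + p.γ₂)
        * (2 * V * X * (2 * c * d - (d ^ 2 - Y ^ 2)) - 2 * U * Y * (2 * c * d - (c ^ 2 - X ^ 2)))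
      + 2 * (V * X * d - U * Y * c)
        * (2 * S * ((c ^ 2 - X ^ 2) * d + (d ^ 2 - Y ^ 2) * c) - 4 * H * X * Y * (c + d)
          + 2 * p.γ₂ * d * (d ^ 2 - 3 * Y ^ 2)))
    - 2 * (p.a₁ + p.a₂) * (2 * c * d + 1)
      * ((p.ξ₁ - p.ξ₂ - p.ξ₃ + p.ξ₄) * X * (1 - 2 * (d ^ 2 - Y ^ 2))
        + (p.ξ₁ - p.ξ₂ + p.ξ₃ - p.ξ₄) * Y * (2 * (c ^ 2 - X ^ 2) - 1))

/-- For `γ₁ = 0`, the real part of the coefficient of `ū_ξ u²`, up to a nonzero real factor, at the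
carrier with half angles `φ` and `ψ`, where `c = cos φ`, `d = cos ψ`, `X = sin φ`, `Y = sin ψ`, and
with the shifts `s` and `t` of the slow variable. -/
def conjDerivRe (p : QCoeffs) (c d X Y s t : ℝ) : ℝ :=
  let S := p.α₁ + p.β₁
  let H := p.α₁ - p.β₁
  let U := p.α₂ - p.β₂
  let V := p.α₂ + p.β₂
  (2 * c * d + 1) * ((4 * S * c * d - 4 * H * X * Y + 2 * p.γ₂ * (d ^ 2 - Y ^ 2))
        * (2 * (V * s * d - U * t * c))
      + (2 * s * (V * c * d - U * X * Y) + 2 * t * (V * X * Y - U * c * d))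
        * (2 * S * (c + d) + 2 * p.γ₂ * d)
      - (X * d * (-2 * S * s - 2 * H * t) + c * Y * (-2 * H * s - 2 * S * t)
          - 4 * p.γ₂ * t * Y * d) * (2 * (V * X - U * Y)))
    - ((2 * S * c * d + 2 * H * X * Y + p.γ₂)
        * (2 * s * (V * c * (d ^ 2 - Y ^ 2) - 2 * U * d * X * Y)
          + 2 * t * (-U * d * (c ^ 2 - X ^ 2) + 2 * V * c * X * Y))
      - 2 * (V * X * d - U * Y * c)
        * (-2 * t * (2 * H * X * c * d + S * (c ^ 2 - X ^ 2) * Y)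
          - 2 * s * (2 * H * Y * c * d + S * (d ^ 2 - Y ^ 2) * X)
          - 2 * p.γ₂ * t * Y * (3 * d ^ 2 - Y ^ 2)))
    - 2 * (p.a₁ + p.a₂) * (2 * c * d + 1)
      * (-(p.ξ₁ - p.ξ₂ - p.ξ₃ + p.ξ₄) * (4 * t * d * X * Y + s * c)
        + (p.ξ₁ - p.ξ₂ + p.ξ₃ - p.ξ₄) * (4 * s * c * X * Y + t * d))

theorem conjDerivRe_smul (p : QCoeffs) (c d X Y s t k : ℝ) :
    p.conjDerivRe c d X Y (k * s) (k * t) = k * p.conjDerivRe c d X Y s t := by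
  simp only [conjDerivRe]
  ring

section sums

theorem inv_add_mul_I {c X : ℝ} (h : X ^ 2 + c ^ 2 = 1) :
    ((c : ℂ) + X * Complex.I)⁻¹ = c - X * Complex.I := by
  apply inv_eq_of_mul_eq_one_right
  have h' : (X : ℂ) ^ 2 + c ^ 2 = 1 := mod_cast h
  linear_combination h' - X ^ 2 * Complex.I_sq

theorem inv_centred (A D : ℂ) (i : Fin 4) : (centred A D i)⁻¹ = centred A⁻¹ D⁻¹ i := by
  fin_cases i <;> simp [centred]

variable (p : QCoeffs) {c d X Y : ℝ} (s t : ℝ) (hX : X ^ 2 + c ^ 2 = 1) (hY : Y ^ 2 + d ^ 2 = 1)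
include hX hY

local notation "z" => centred (c + X * Complex.I) (d + Y * Complex.I)

theorem im_tripleSum : (p.tripleSum fun i j k =>
    z i * z j * (z k)⁻¹ + z i * z k * (z j)⁻¹ + z j * z k * (z i)⁻¹).im =
      (p.ξ₁ - p.ξ₂ - p.ξ₃ + p.ξ₄) * X * (1 - 2 * (d ^ 2 - Y ^ 2))
        + (p.ξ₁ - p.ξ₂ + p.ξ₃ - p.ξ₄) * Y * (2 * (c ^ 2 - X ^ 2) - 1) := by
  simp only [tripleSum, inv_centred]
  simp only [centred, Complex.real_smul, Matrix.cons_val, inv_inv]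
  simp only [inv_add_mul_I hX, inv_add_mul_I hY]
  simp [sq]
  linear_combination (p.ξ₁ - p.ξ₂ - p.ξ₃ + p.ξ₄) * X * hY - (p.ξ₁ - p.ξ₂ + p.ξ₃ - p.ξ₄) * Y * hX

theorem re_tripleSum_mul_shifts : (p.tripleSum fun i j k => z i * z j * (z k)⁻¹ * shifts s t k
    + z i * z k * (z j)⁻¹ * shifts s t j + z j * z k * (z i)⁻¹ * shifts s t i).re =
      -(p.ξ₁ - p.ξ₂ - p.ξ₃ + p.ξ₄) * (4 * t * d * X * Y + s * c)
        + (p.ξ₁ - p.ξ₂ + p.ξ₃ - p.ξ₄) * (4 * s * c * X * Y + t * d) := by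
  simp only [tripleSum, inv_centred]
  simp only [centred, shifts, Complex.real_smul, Matrix.cons_val, inv_inv]
  simp only [inv_add_mul_I hX, inv_add_mul_I hY]
  simp
  linear_combination -(p.ξ₁ - p.ξ₂ - p.ξ₃ + p.ξ₄) * s * c * hY
    + (p.ξ₁ - p.ξ₂ + p.ξ₃ - p.ξ₄) * t * d * hX

variable {p} (hγ₁ : p.γ₁ = 0)
include hγ₁

theorem pairSum_ratio : p.pairSum (fun i j => z i * (z j)⁻¹ + z j * (z i)⁻¹) =
    (4 * (p.α₁ + p.β₁) * c * d - 4 * (p.α₁ - p.β₁) * X * Y + 2 * p.γ₂ * (d ^ 2 - Y ^ 2) : ℝ) := by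
  simp only [pairSum, inv_centred, hγ₁]
  simp only [centred, Complex.real_smul, Matrix.cons_val, inv_inv]
  simp only [inv_add_mul_I hX, inv_add_mul_I hY]
  apply Complex.ext <;> simp [sq] <;> ring

theorem pairSum_add_eq : p.pairSum (fun i j => z i + z j) =
    ⟨2 * (p.α₁ + p.β₁) * (c + d) + 2 * p.γ₂ * d,
      2 * ((p.α₂ + p.β₂) * X - (p.α₂ - p.β₂) * Y)⟩ := by
  simp only [pairSum, hγ₁]
  simp only [centred, Complex.real_smul, Matrix.cons_val, inv_add_mul_I hX, inv_add_mul_I hY]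
  apply Complex.ext <;> simp <;> ring

theorem pairSum_mul_eq : p.pairSum (fun i j => z i * z j) =
    ⟨2 * (p.α₁ + p.β₁) * c * d + 2 * (p.α₁ - p.β₁) * X * Y + p.γ₂,
      2 * ((p.α₂ + p.β₂) * X * d - (p.α₂ - p.β₂) * Y * c)⟩ := by
  simp only [pairSum, hγ₁]
  simp only [centred, Complex.real_smul, Matrix.cons_val, inv_add_mul_I hX, inv_add_mul_I hY]
  apply Complex.ext <;> simp
  · linear_combination p.γ₂ * hY
  · ring

theorem pairSum_sq_ratio : p.pairSum (fun i j => z i ^ 2 * (z j)⁻¹ + z j ^ 2 * (z i)⁻¹) =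
    ⟨2 * (p.α₁ + p.β₁) * ((c ^ 2 - X ^ 2) * d + (d ^ 2 - Y ^ 2) * c)
        - 4 * (p.α₁ - p.β₁) * X * Y * (c + d) + 2 * p.γ₂ * d * (d ^ 2 - 3 * Y ^ 2),
      2 * (p.α₂ + p.β₂) * X * (2 * c * d - (d ^ 2 - Y ^ 2))
        - 2 * (p.α₂ - p.β₂) * Y * (2 * c * d - (c ^ 2 - X ^ 2))⟩ := by
  simp only [pairSum, inv_centred, hγ₁]
  simp only [centred, Complex.real_smul, Matrix.cons_val, inv_inv]
  simp only [inv_add_mul_I hX, inv_add_mul_I hY]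
  apply Complex.ext <;> simp [sq] <;> ring

theorem pairSum_ratio_mul_shifts : p.pairSum (fun i j =>
    z i * (z j)⁻¹ * shifts s t j + z j * (z i)⁻¹ * shifts s t i) =
      ⟨2 * s * ((p.α₂ + p.β₂) * c * d - (p.α₂ - p.β₂) * X * Y)
        + 2 * t * ((p.α₂ + p.β₂) * X * Y - (p.α₂ - p.β₂) * c * d),
      X * d * (-2 * (p.α₁ + p.β₁) * s - 2 * (p.α₁ - p.β₁) * t)
        + c * Y * (-2 * (p.α₁ - p.β₁) * s - 2 * (p.α₁ + p.β₁) * t) - 4 * p.γ₂ * t * Y * d⟩ := by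
  simp only [pairSum, inv_centred, hγ₁]
  simp only [centred, shifts, Complex.real_smul, Matrix.cons_val, inv_inv]
  simp only [inv_add_mul_I hX, inv_add_mul_I hY]
  apply Complex.ext <;> simp <;> ring

theorem pairSum_mul_shifts : p.pairSum (fun i j => z i * shifts s t j + z j * shifts s t i) =
    ⟨2 * ((p.α₂ + p.β₂) * s * d - (p.α₂ - p.β₂) * t * c),
      -2 * (p.α₁ - p.β₁) * (t * X + s * Y) - 2 * p.γ₂ * t * Y⟩ := by
  simp only [pairSum, hγ₁]
  simp only [centred, shifts, Complex.real_smul, Matrix.cons_val, inv_add_mul_I hX,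
    inv_add_mul_I hY]
  apply Complex.ext <;> simp <;> ring

theorem pairSum_sq_ratio_mul_shifts : p.pairSum (fun i j =>
    z i ^ 2 * (z j)⁻¹ * shifts s t j + z j ^ 2 * (z i)⁻¹ * shifts s t i) =
      ⟨2 * s * ((p.α₂ + p.β₂) * c * (d ^ 2 - Y ^ 2) - 2 * (p.α₂ - p.β₂) * d * X * Y)
        + 2 * t * (-(p.α₂ - p.β₂) * d * (c ^ 2 - X ^ 2) + 2 * (p.α₂ + p.β₂) * c * X * Y),
      -2 * t * (2 * (p.α₁ - p.β₁) * X * c * d + (p.α₁ + p.β₁) * (c ^ 2 - X ^ 2) * Y)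
        - 2 * s * (2 * (p.α₁ - p.β₁) * Y * c * d + (p.α₁ + p.β₁) * (d ^ 2 - Y ^ 2) * X)
        - 2 * p.γ₂ * t * Y * (3 * d ^ 2 - Y ^ 2)⟩ := by
  simp only [pairSum, inv_centred, hγ₁]
  simp only [centred, shifts, Complex.real_smul, Matrix.cons_val, inv_inv]
  simp only [inv_add_mul_I hX, inv_add_mul_I hY]
  apply Complex.ext <;> simp [sq] <;> ring

end sums

theorem cubicCoeff_eq (p : QCoeffs) (z : Fin 4 → ℂ) (μ ν : ℂ) :
    p.cubicCoeff z μ ν = μ * p.pairSum (fun i j => z i + z j)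
      + ν * p.pairSum (fun i j => z i ^ 2 * (z j)⁻¹ + z j ^ 2 * (z i)⁻¹)
      + p.tripleSum fun i j k =>
        z i * z j * (z k)⁻¹ + z i * z k * (z j)⁻¹ + z j * z k * (z i)⁻¹ := by
  rw [cubicCoeff, pairSum_add, mul_pairSum, mul_pairSum]

theorem cubicCoeffConjDeriv_eq (p : QCoeffs) (z s : Fin 4 → ℂ) (μ ν σ : ℂ) :
    p.cubicCoeffConjDeriv z s μ ν σ = μ * p.pairSum (fun i j => z i * s j + z j * s i)
      + σ * p.pairSum (fun i j => z i + z j)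
      + ν * p.pairSum (fun i j => z i ^ 2 * (z j)⁻¹ * s j + z j ^ 2 * (z i)⁻¹ * s i)
      + p.tripleSum fun i j k => z i * z j * (z k)⁻¹ * s k
        + z i * z k * (z j)⁻¹ * s j + z j * z k * (z i)⁻¹ * s i := by
  rw [cubicCoeffConjDeriv, pairSum_add, pairSum_add, mul_pairSum, mul_pairSum, mul_pairSum]

section elimination

variable {l n q : ℝ} {μ ν g m e w : ℂ}
  (hμ : l * μ + q = 0) (hν : (-(l * n) : ℝ) * ν + g = 0)
include hμ hν

theorem im_eq_zero_of_elimination {W r : ℝ}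
    (h : Complex.I * W * (-Complex.I * r) + (μ * e + ν * m + w) = 0) :
    n * q * e.im - (g * m).im - l * n * w.im = 0 := by
  have eliminated : (-(l * n * W * r) : ℝ) + (n * q : ℝ) * e - g * m - (l * n : ℝ) * w = 0 := by
    push_cast at hν ⊢
    linear_combination (-l * n) * h + n * e * hμ - m * hν - l * n * W * r * Complex.I_sq
  simpa only [Complex.sub_im, Complex.add_im, Complex.im_ofReal_mul, Complex.ofReal_im, zero_add,
    Complex.zero_im] using congrArg Complex.im eliminated

theorem re_eq_zero_of_elimination {σ f x : ℂ} {W b G r : ℝ} (hσ : l * σ + x = 0)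
    (h : Complex.I * W * b + G * (-Complex.I * r) + (μ * f + σ * e + ν * m + w) = 0) :
    n * (q * f.re + (x * e).re) - (g * m).re - l * n * w.re = 0 := by
  have eliminated : (-(l * n * (W * b - G * r)) : ℝ) * Complex.I
      + (n : ℝ) * ((q : ℝ) * f + x * e) - g * m - (l * n : ℝ) * w = 0 := by
    push_cast at hν ⊢
    linear_combination (-l * n) * h + n * f * hμ + n * e * hσ - m * hν
  simpa only [Complex.sub_re, Complex.add_re, Complex.re_ofReal_mul, Complex.I_re, mul_zero,
    zero_add, Complex.zero_re] using congrArg Complex.re eliminated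

end elimination

section carrier

variable {p : QCoeffs} {φ ψ : ℝ}

theorem IsCarrier.linSum_centred_sq (hc : p.IsCarrier (φ + ψ) (ψ - φ)) :
    p.linSum (fun c => centred (phase φ) (phase ψ) c ^ 2) =
      (-(2 * (p.a₁ + p.a₂) * (2 * Real.cos φ * Real.cos ψ + 1)) : ℝ) := by
  have cos_eq := congrArg Complex.ofReal hc.cos_eq
  have hφ := Complex.sin_sq_add_cos_sq φ
  have hψ := Complex.sin_sq_add_cos_sq ψ
  simp only [linSum, centred, Complex.real_smul, Matrix.cons_val, inv_phase_eq]
  simp only [phase_eq]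
  push_cast at cos_eq ⊢
  linear_combination (2 * p.a₁ * Complex.sin φ ^ 2 + 2 * p.a₂ * Complex.sin ψ ^ 2) * Complex.I_sq
    + (4 * Complex.cos φ + 4 * Complex.cos ψ) * cos_eq - 2 * p.a₁ * hφ - 2 * p.a₂ * hψ

theorem IsCarrier.cubicIm_eq_zero (hγ₁ : p.γ₁ = 0) (hc : p.IsCarrier (φ + ψ) (ψ - φ))
    {s : Fin 4 → ℂ} {ρ₁ ρ₂ B a b μ ν σ σ' τ : ℂ}
    (H : p.ReducedEqs (centred (phase φ) (phase ψ)) s (shifts (1 / 2) (-1 / 2)) ρ₁ ρ₂ B a b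
      μ ν σ σ' τ) (hρ₂ : ρ₂.im = 0) :
    p.cubicIm (Real.cos φ) (Real.cos ψ) (Real.sin φ) (Real.sin ψ) = 0 := by
  have hX := Real.sin_sq_add_cos_sq φ
  have hY := Real.sin_sq_add_cos_sq ψ
  have hμ := H.eq_μ
  have hν := H.eq_ν
  have cubic := H.cubic
  lift ρ₂ to ℝ using hρ₂
  rw [linSum_one] at hμ
  rw [hc.linSum_centred_sq] at hν
  rw [linSum_centred_phase_mul_half_shifts, cubicCoeff_eq] at cubic
  simp only [phase_eq] at hμ hν cubic
  rw [pairSum_ratio hX hY hγ₁] at hμ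
  have key := im_eq_zero_of_elimination hμ hν cubic
  rw [pairSum_add_eq hX hY hγ₁, pairSum_mul_eq hX hY hγ₁, pairSum_sq_ratio hX hY hγ₁,
    p.im_tripleSum hX hY, Complex.mul_im] at key
  unfold cubicIm
  linear_combination key

theorem IsCarrier.conjDerivRe_eq_zero (hγ₁ : p.γ₁ = 0) (hc : p.IsCarrier (φ + ψ) (ψ - φ))
    {s t : ℝ} {ρ₁ ρ₂ B a b μ ν σ σ' τ : ℂ}
    (H : p.ReducedEqs (centred (phase φ) (phase ψ)) (shifts s t) (shifts (1 / 2) (-1 / 2))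
      ρ₁ ρ₂ B a b μ ν σ σ' τ) (hρ₂ : ρ₂.im = 0) (hb : b.im = 0) :
    p.conjDerivRe (Real.cos φ) (Real.cos ψ) (Real.sin φ) (Real.sin ψ) s t = 0 := by
  have hX := Real.sin_sq_add_cos_sq φ
  have hY := Real.sin_sq_add_cos_sq ψ
  have hμ := H.eq_μ
  have hν := H.eq_ν
  have hσ' := H.eq_σ'
  have conjDeriv := H.conjDeriv
  lift ρ₂ to ℝ using hρ₂
  lift b to ℝ using hb
  have hs : p.linSum (shifts s t) = 0 := by simp [linSum, shifts]
  have hst : p.linSum (fun c => centred (phase φ) (phase ψ) c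
      * (shifts s t c * shifts (1 / 2) (-1 / 2) c)) =
      (p.a₁ * Real.cos φ * s - p.a₂ * Real.cos ψ * t : ℝ) := by
    rw [linSum_centred_phase_mul_shifts_mul_shifts]
    push_cast
    ring
  rw [linSum_one] at hμ
  rw [hc.linSum_centred_sq] at hν
  rw [linSum_one, hs, mul_zero, zero_add] at hσ'
  rw [linSum_centred_phase_mul_half_shifts, hst, cubicCoeffConjDeriv_eq] at conjDeriv
  simp only [phase_eq] at hμ hν hσ' conjDeriv
  rw [pairSum_ratio hX hY hγ₁] at hμ
  have key := re_eq_zero_of_elimination hμ hν hσ' conjDeriv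
  rw [pairSum_mul_shifts s t hX hY hγ₁, pairSum_ratio_mul_shifts s t hX hY hγ₁,
    pairSum_add_eq hX hY hγ₁, pairSum_mul_eq hX hY hγ₁, pairSum_sq_ratio_mul_shifts s t hX hY hγ₁,
    p.re_tripleSum_mul_shifts s t hX hY, Complex.mul_re, Complex.mul_re] at key
  unfold conjDerivRe
  linear_combination key

end carrier

section limit

variable (p : QCoeffs) {S H U V F K x X Y : ℝ} (hS : p.α₁ + p.β₁ = S) (hH : p.α₁ - p.β₁ = H)
  (hU : p.α₂ - p.β₂ = U) (hV : p.α₂ + p.β₂ = V) (hF : p.ξ₁ - p.ξ₂ - p.ξ₃ + p.ξ₄ = F)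
  (hK : p.ξ₁ - p.ξ₂ + p.ξ₃ - p.ξ₄ = K) (hX : X ^ 2 + (p.a₂ * x) ^ 2 = 1)
  (hY : Y ^ 2 + (p.a₁ * x) ^ 2 = 1)
include hS hH hU hV hF hK hX hY

local notation "a" => p.a₁
local notation "b" => p.a₂
local notation "G" => p.γ₂

theorem cubicIm_eq : p.cubicIm (b * x) (-(a * x)) X Y =
    X * ((-6 * (a + b) * F + 12 * (H * U) - 6 * (V * G))
        + (4 * a * (a + b) * (2 * a + 3 * b) * F + 4 * a * (a - 2 * b) * (S * V)
          - 4 * (3 * a ^ 2 + 4 * a * b + 4 * b ^ 2) * (H * U)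
          + 12 * a * (2 * a + b) * (V * G)) * x ^ 2
        + -16 * a ^ 2 * (a + b) * (a * b * F - b * (H * U) + a * (V * G)) * x ^ 4)
      + Y * ((6 * (a + b) * K - 12 * (H * V) + 6 * (U * G))
        + (-4 * b * (a + b) * (3 * a + 2 * b) * K + 4 * b * (2 * a - b) * (S * U)
          + 4 * (4 * a ^ 2 + 4 * a * b + 3 * b ^ 2) * (H * V)
          - 4 * (2 * a ^ 2 + b ^ 2) * (U * G)) * x ^ 2
        + 16 * a * b ^ 2 * (a + b) * (b * K - H * V) * x ^ 4) := by
  simp only [cubicIm, hS, hH, hU, hV, hF, hK]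
  grind

theorem conjDerivRe_eq : p.conjDerivRe (b * x) (-(a * x)) X Y (b * Y) (-(a * X)) =
    x * (X * ((-2 * (a + b) * (a ^ 2 + 4 * b ^ 2) * K + 8 * b * (2 * a - b) * (S * U)
          + 4 * (a ^ 2 + 4 * a * b + 2 * b ^ 2) * (H * V) - 10 * a ^ 2 * (U * G))
        + (4 * a * b * (a + b) * (a ^ 2 + 2 * a * b + 4 * b ^ 2) * K
          - 4 * a ^ 2 * b * (2 * a + 3 * b) * (S * U)
          - 4 * a * b * (4 * a ^ 2 + 11 * a * b + 4 * b ^ 2) * (H * V)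
          + 4 * a ^ 2 * (2 * a ^ 2 + 2 * a * b + b ^ 2) * (U * G)) * x ^ 2
        + -16 * a ^ 3 * b ^ 2 * (b * (a + b) * K - b * (S * U) - (2 * a + b) * (H * V)
          + a * (U * G)) * x ^ 4)
      + Y * ((2 * (a + b) * (4 * a ^ 2 + b ^ 2) * F + 8 * a * (a - 2 * b) * (S * V)
          - 4 * (2 * a ^ 2 + 4 * a * b + b ^ 2) * (H * U)
          + 2 * (8 * a ^ 2 + 4 * a * b + b ^ 2) * (V * G))
        + (-4 * a * b * (a + b) * (4 * a ^ 2 + 2 * a * b + b ^ 2) * F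
          + 4 * a * b ^ 2 * (3 * a + 2 * b) * (S * V)
          + 4 * a * b * (4 * a ^ 2 + 11 * a * b + 4 * b ^ 2) * (H * U)
          - 4 * a * (4 * a ^ 3 + 8 * a ^ 2 * b + 6 * a * b ^ 2 + b ^ 3) * (V * G)) * x ^ 2
        + 16 * a ^ 2 * b ^ 2 * (a * b * (a + b) * F - a * b * (S * V)
          - b * (a + 2 * b) * (H * U) + a * (2 * a + b) * (V * G)) * x ^ 4)) := by
  simp only [conjDerivRe, hS, hH, hU, hV, hF, hK]
  grind

end limit

end QCoeffs

/-! ### Carriers near the limit -/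

open Filter Topology

section separation

theorem infinite_setOf_of_eventually_nhdsGT {x₀ : ℝ} {P : ℝ → Prop} (h : ∀ᶠ x in 𝓝[>] x₀, P x) :
    {x | P x}.Infinite := by
  obtain ⟨u, hu, hP⟩ := mem_nhdsGT_iff_exists_Ioo_subset.1 h
  exact (Set.Ioo_infinite hu).mono hP

theorem coeffs_eq_zero_of_eventually_nhdsGT {x₀ c₀ c₁ c₂ : ℝ}
    (h : ∀ᶠ x in 𝓝[>] x₀, c₀ + c₁ * x ^ 2 + c₂ * x ^ 4 = 0) : c₀ = 0 ∧ c₁ = 0 ∧ c₂ = 0 := by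
  open Polynomial in
  have polynomial_eq_zero : C c₀ + C c₁ * X ^ 2 + C c₂ * X ^ 4 = 0 :=
    eq_zero_of_infinite_isRoot _ <| (infinite_setOf_of_eventually_nhdsGT h).mono fun x hx => by
      simpa using hx
  have coeff_eq_zero (n : ℕ) := congrArg (Polynomial.coeff · n) polynomial_eq_zero
  simp only [Polynomial.coeff_add, Polynomial.coeff_C_mul, Polynomial.coeff_C,
    Polynomial.coeff_X_pow, Polynomial.coeff_zero] at coeff_eq_zero
  exact ⟨by simpa using coeff_eq_zero 0, by simpa using coeff_eq_zero 2,
    by simpa using coeff_eq_zero 4⟩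

theorem eventually_one_sub_sq_pos (a : ℝ) : ∀ᶠ x in 𝓝[>] (0 : ℝ), 0 < 1 - (a * x) ^ 2 := by
  have continuous : ContinuousAt (fun x : ℝ => 1 - (a * x) ^ 2) 0 := by fun_prop
  exact (continuous.eventually (lt_mem_nhds (by norm_num))).filter_mono nhdsWithin_le_nhds

/-- The four choices of signs in `X = ±√(1 - a²x²)` and `Y = ±√(1 - b²x²)` separate the two
polynomials. -/
theorem coeffs_eq_zero_of_forall_sign {a b c₀ c₁ c₂ d₀ d₁ d₂ : ℝ}
    (h : ∀ᶠ x in 𝓝[>] (0 : ℝ), ∀ X Y : ℝ, X ^ 2 + (a * x) ^ 2 = 1 → Y ^ 2 + (b * x) ^ 2 = 1 →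
      X * (c₀ + c₁ * x ^ 2 + c₂ * x ^ 4) + Y * (d₀ + d₁ * x ^ 2 + d₂ * x ^ 4) = 0) :
    (c₀ = 0 ∧ c₁ = 0 ∧ c₂ = 0) ∧ (d₀ = 0 ∧ d₁ = 0 ∧ d₂ = 0) := by
  have separated : ∀ᶠ x in 𝓝[>] (0 : ℝ), c₀ + c₁ * x ^ 2 + c₂ * x ^ 4 = 0 ∧
      d₀ + d₁ * x ^ 2 + d₂ * x ^ 4 = 0 := by
    filter_upwards [h, eventually_one_sub_sq_pos a, eventually_one_sub_sq_pos b] with x h ha hb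
    have hX : √(1 - (a * x) ^ 2) ^ 2 + (a * x) ^ 2 = 1 := by rw [Real.sq_sqrt ha.le]; ring
    have hY : √(1 - (b * x) ^ 2) ^ 2 + (b * x) ^ 2 = 1 := by rw [Real.sq_sqrt hb.le]; ring
    have plus := h _ _ hX hY
    have minus := h (-√(1 - (a * x) ^ 2)) _ (by rwa [neg_sq]) hY
    constructor
    · apply mul_left_cancel₀ (Real.sqrt_ne_zero'.2 ha)
      linear_combination (plus - minus) / 2
    · apply mul_left_cancel₀ (Real.sqrt_ne_zero'.2 hb)
      linear_combination (plus + minus) / 2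
  exact ⟨coeffs_eq_zero_of_eventually_nhdsGT (separated.mono fun _ h => h.1),
    coeffs_eq_zero_of_eventually_nhdsGT (separated.mono fun _ h => h.2)⟩

end separation

theorem cos_four_mul (θ : ℝ) : Real.cos (4 * θ) = 8 * Real.cos θ ^ 4 - 8 * Real.cos θ ^ 2 + 1 := by
  rw [show 4 * θ = 2 * (2 * θ) by ring, Real.cos_two_mul, Real.cos_two_mul]
  ring

theorem exists_cos_eq_and_sin_eq {c X : ℝ} (h : X ^ 2 + c ^ 2 = 1) :
    ∃ φ, Real.cos φ = c ∧ Real.sin φ = X := by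
  have norm_eq_one : ‖(⟨c, X⟩ : ℂ)‖ = 1 := by
    rw [Complex.norm_def, Complex.normSq_mk, Real.sqrt_eq_one]
    linarith
  have ne_zero : (⟨c, X⟩ : ℂ) ≠ 0 := norm_ne_zero_iff.1 (by rw [norm_eq_one]; exact one_ne_zero)
  exact ⟨Complex.arg ⟨c, X⟩, by rw [Complex.cos_arg ne_zero, norm_eq_one, div_one],
    by rw [Complex.sin_arg, norm_eq_one, div_one]⟩

namespace QCoeffs

theorem phase_pow (φ : ℝ) (k : ℕ) : phase φ ^ k = phase (k * φ) := by
  rw [phase, phase, ← Complex.exp_nat_mul]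
  push_cast
  ring_nf

section carrier

variable {p : QCoeffs}

theorem linSymbol_half_angles_eq_zero_iff (φ ψ : ℝ) (k : ℕ) :
    p.linSymbol (φ + ψ) (ψ - φ) k = 0 ↔
      p.a₁ * Real.cos (k * φ) + p.a₂ * Real.cos (k * ψ) = 0 := by
  have centred_pow : (fun c => centred (phase φ) (phase ψ) c ^ k) =
      centred (phase (k * φ)) (phase (k * ψ)) := by
    funext c
    fin_cases c <;> simp [centred, phase_pow]
  rw [linSymbol_half_angles, centred_pow, linSum_centred_phase, mul_eq_zero,
    or_iff_right (pow_ne_zero k (phase_ne_zero φ)), mul_eq_zero, or_iff_right two_ne_zero]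
  norm_cast

theorem IsDispersive.eventually_ne_zero (hp : p.IsDispersive) : ∀ᶠ x in 𝓝[>] (0 : ℝ),
    2 * p.a₁ * p.a₂ * x ^ 2 - 1 ≠ 0 ∧
      p.a₁ * (8 * (p.a₂ * x) ^ 4 - 8 * (p.a₂ * x) ^ 2 + 1)
        + p.a₂ * (8 * (p.a₁ * x) ^ 4 - 8 * (p.a₁ * x) ^ 2 + 1) ≠ 0 := by
  refine Eventually.filter_mono nhdsWithin_le_nhds (.and ?_ ?_) <;>
    refine ContinuousAt.eventually_ne (by fun_prop) ?_
  · norm_num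
  · simpa using hp.add_ne_zero

theorem IsDispersive.eventually_isCarrier (hp : p.IsDispersive) :
    ∀ᶠ x in 𝓝[>] (0 : ℝ), ∀ φ ψ : ℝ, Real.cos φ = p.a₂ * x → Real.cos ψ = -(p.a₁ * x) →
      p.IsCarrier (φ + ψ) (ψ - φ) := by
  filter_upwards [hp.eventually_ne_zero, self_mem_nhdsWithin] with x ⟨h₂, h₄⟩ hx φ ψ hφ hψ
  have hx₀ : x ≠ 0 := ne_of_gt hx
  have cos_eq : p.a₁ * Real.cos φ + p.a₂ * Real.cos ψ = 0 := by
    rw [hφ, hψ]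
    ring
  refine ⟨(linSymbol_half_angles_eq_zero_iff φ ψ 1).2 (by simpa using cos_eq), ?_,
    fun k hk hk' => mt (linSymbol_half_angles_eq_zero_iff φ ψ k).1 ?_⟩
  · rw [Real.sin_add, hφ, hψ]
    convert mul_ne_zero (neg_ne_zero.2 hx₀) (sin_ne_zero_of_cos_eq hp cos_eq).1 using 1
    ring
  · rw [← ne_eq]
    interval_cases k <;> push_cast
    · rw [Real.cos_two_mul, Real.cos_two_mul, hφ, hψ]
      convert mul_ne_zero hp.add_ne_zero h₂ using 1
      ring
    · rw [Real.cos_three_mul, Real.cos_three_mul, hφ, hψ]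
      convert mul_ne_zero (mul_ne_zero (mul_ne_zero hp.1 hp.2.1) (pow_ne_zero 3 hx₀))
        (mul_ne_zero (neg_ne_zero.2 four_ne_zero) hp.sq_sub_sq_ne_zero) using 1
      ring
    · rw [cos_four_mul, cos_four_mul, hφ, hψ]
      convert h₄ using 1
      ring

theorem IsA2Integrable.cubicIm_eq_zero_and_conjDerivRe_eq_zero (h : p.IsA2Integrable)
    (hp : p.IsDispersive) (hγ₁ : p.γ₁ = 0) {φ ψ : ℝ} (hc : p.IsCarrier (φ + ψ) (ψ - φ)) :
    p.cubicIm (Real.cos φ) (Real.cos ψ) (Real.sin φ) (Real.sin ψ) = 0 ∧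
      p.conjDerivRe (Real.cos φ) (Real.cos ψ) (Real.sin φ) (Real.sin ψ)
        (p.a₂ * Real.sin ψ) (-(p.a₁ * Real.sin φ)) = 0 := by
  obtain ⟨v, ρ₁, ρ₂, B, a, b, hred, hρ₂, -, hb⟩ := h _ _ hc
  obtain ⟨-, μ, ν, σ, σ', τ, H⟩ := (hc.hasReduction_iff hp).1 hred
  refine ⟨hc.cubicIm_eq_zero hγ₁ H hρ₂, ?_⟩
  have ofReal_shifts : shifts ((1 - v) / 2) ((1 + v) / 2) =
      shifts (((1 - v) / 2 : ℝ) : ℂ) (((1 + v) / 2 : ℝ) : ℂ) := by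
    push_cast
    rfl
  rw [ofReal_shifts] at H
  have velocity : p.a₁ * Real.sin φ * ((1 - v) / 2) + p.a₂ * Real.sin ψ * ((1 + v) / 2) = 0 := by
    have hv := H.velocity
    rw [linSum_centred_phase_mul_shifts, mul_eq_zero, or_iff_right (by simp)] at hv
    exact_mod_cast hv
  have shift_eq : p.a₂ * Real.sin ψ =
      -(p.a₁ * Real.sin φ - p.a₂ * Real.sin ψ) * ((1 - v) / 2) := by linear_combination velocity
  have shift_eq' : -(p.a₁ * Real.sin φ) =
      -(p.a₁ * Real.sin φ - p.a₂ * Real.sin ψ) * ((1 + v) / 2) := by linear_combination -velocity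
  generalize -(p.a₁ * Real.sin φ - p.a₂ * Real.sin ψ) = W at shift_eq shift_eq'
  rw [shift_eq', shift_eq, conjDerivRe_smul, hc.conjDerivRe_eq_zero hγ₁ H hρ₂ hb, mul_zero]

theorem IsA2Integrable.eventually_eq_zero (h : p.IsA2Integrable) (hp : p.IsDispersive)
    (hγ₁ : p.γ₁ = 0) : ∀ᶠ x in 𝓝[>] (0 : ℝ), ∀ X Y : ℝ, X ^ 2 + (p.a₂ * x) ^ 2 = 1 →
      Y ^ 2 + (p.a₁ * x) ^ 2 = 1 → p.cubicIm (p.a₂ * x) (-(p.a₁ * x)) X Y = 0 ∧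
        p.conjDerivRe (p.a₂ * x) (-(p.a₁ * x)) X Y (p.a₂ * Y) (-(p.a₁ * X)) = 0 := by
  filter_upwards [hp.eventually_isCarrier] with x hx X Y hX hY
  rw [← neg_sq (p.a₁ * x)] at hY
  obtain ⟨φ, hφ, rfl⟩ := exists_cos_eq_and_sin_eq hX
  obtain ⟨ψ, hψ, rfl⟩ := exists_cos_eq_and_sin_eq hY
  rw [← hφ, ← hψ]
  exact h.cubicIm_eq_zero_and_conjDerivRe_eq_zero hp hγ₁ (hx φ ψ hφ hψ)

end carrier

/-! ### The classification -/

section products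

variable {a b : ℝ} (ha : a ≠ 0) (hb : b ≠ 0) (hab : a ^ 2 - b ^ 2 ≠ 0)
include ha hb hab

theorem even_products_eq_zero {F HU VG SV : ℝ} (h₁ : -6 * (a + b) * F + 12 * HU - 6 * VG = 0)
    (h₂ : a * b * F - b * HU + a * VG = 0)
    (h₃ : 2 * (a + b) * (4 * a ^ 2 + b ^ 2) * F + 8 * a * (a - 2 * b) * SV
      - 4 * (2 * a ^ 2 + 4 * a * b + b ^ 2) * HU + 2 * (8 * a ^ 2 + 4 * a * b + b ^ 2) * VG = 0)
    (h₄ : a * b * (a + b) * F - a * b * SV - b * (a + 2 * b) * HU + a * (2 * a + b) * VG = 0) :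
    F = 0 ∧ HU = 0 ∧ VG = 0 ∧ SV = 0 := by
  have F_eq : a ^ 2 * F = (2 * a - b) * HU := by linear_combination -h₂ - a / 6 * h₁
  have VG_eq : a ^ 2 * VG = b * (b - a) * HU := by linear_combination a * h₂ - b * F_eq
  have SV_eq : SV = -HU := by
    apply mul_left_cancel₀ (mul_ne_zero (pow_ne_zero 2 ha) hb)
    linear_combination b * (a + b) * F_eq + (2 * a + b) * VG_eq - a * h₄
  have HU_eq : HU = 0 := by
    apply mul_left_cancel₀ (mul_ne_zero (mul_ne_zero ha hb) hab)
    linear_combination (-a ^ 2 * h₃ + 2 * (a + b) * (4 * a ^ 2 + b ^ 2) * F_eq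
      + (16 * a ^ 2 + 8 * a * b + 2 * b ^ 2) * VG_eq
      + a ^ 2 * (8 * a ^ 2 - 16 * a * b) * SV_eq) / 8
  rw [HU_eq, mul_zero] at F_eq VG_eq
  rw [HU_eq, neg_zero] at SV_eq
  exact ⟨(mul_eq_zero.1 F_eq).resolve_left (pow_ne_zero 2 ha), HU_eq,
    (mul_eq_zero.1 VG_eq).resolve_left (pow_ne_zero 2 ha), SV_eq⟩

theorem odd_products_eq_zero {K HV UG SU : ℝ} (h₁ : 6 * (a + b) * K - 12 * HV + 6 * UG = 0)
    (h₂ : b * K - HV = 0)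
    (h₃ : -2 * (a + b) * (a ^ 2 + 4 * b ^ 2) * K + 8 * b * (2 * a - b) * SU
      + 4 * (a ^ 2 + 4 * a * b + 2 * b ^ 2) * HV - 10 * a ^ 2 * UG = 0)
    (h₄ : b * (a + b) * K - b * SU - (2 * a + b) * HV + a * UG = 0) :
    K = 0 ∧ HV = 0 ∧ UG = 0 ∧ SU = 0 := by
  have K_eq : b * K = HV := by linear_combination h₂
  have UG_eq : b * UG = (b - a) * HV := by linear_combination b / 6 * h₁ - (a + b) * h₂
  have SU_eq : b ^ 2 * SU = -a ^ 2 * HV := by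
    linear_combination b * (a + b) * K_eq + a * UG_eq - b * h₄
  have HV_eq : HV = 0 := by
    apply mul_left_cancel₀ (mul_ne_zero (mul_ne_zero ha hb) hab)
    linear_combination (-b ^ 2 * h₃ - 2 * (a + b) * (a ^ 2 + 4 * b ^ 2) * b * K_eq
      - 10 * a ^ 2 * b * UG_eq + (16 * a * b - 8 * b ^ 2) * SU_eq) / 8
  rw [HV_eq] at K_eq
  rw [HV_eq, mul_zero] at UG_eq SU_eq
  exact ⟨(mul_eq_zero.1 K_eq).resolve_left hb, HV_eq, (mul_eq_zero.1 UG_eq).resolve_left hb,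
    (mul_eq_zero.1 SU_eq).resolve_left (pow_ne_zero 2 hb)⟩

end products

theorem IsA2Integrable.products_eq_zero {p : QCoeffs} (h : p.IsA2Integrable) (hp : p.IsDispersive)
    (hγ₁ : p.γ₁ = 0) :
    (p.ξ₁ - p.ξ₂ - p.ξ₃ + p.ξ₄ = 0 ∧ (p.α₁ - p.β₁) * (p.α₂ - p.β₂) = 0 ∧
      (p.α₂ + p.β₂) * p.γ₂ = 0 ∧ (p.α₁ + p.β₁) * (p.α₂ + p.β₂) = 0) ∧
    (p.ξ₁ - p.ξ₂ + p.ξ₃ - p.ξ₄ = 0 ∧ (p.α₁ - p.β₁) * (p.α₂ + p.β₂) = 0 ∧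
      (p.α₂ - p.β₂) * p.γ₂ = 0 ∧ (p.α₁ + p.β₁) * (p.α₂ - p.β₂) = 0) := by
  have zero := h.eventually_eq_zero hp hγ₁
  obtain ⟨⟨nX₀, -, nX₄⟩, nY₀, -, nY₄⟩ := coeffs_eq_zero_of_forall_sign <| zero.mono
    fun x hx X Y hX hY =>
      (p.cubicIm_eq rfl rfl rfl rfl rfl rfl hX hY).symm.trans (hx X Y hX hY).1
  obtain ⟨⟨rX₀, -, rX₄⟩, rY₀, -, rY₄⟩ := coeffs_eq_zero_of_forall_sign <| by
    filter_upwards [zero, self_mem_nhdsWithin] with x hx hx₀ X Y hX hY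
    exact (mul_eq_zero.1 <| (p.conjDerivRe_eq rfl rfl rfl rfl rfl rfl hX hY).symm.trans
      (hx X Y hX hY).2).resolve_left (ne_of_gt hx₀)
  obtain ⟨ha, hb, -⟩ := id hp
  have hs := hp.add_ne_zero
  simp only [mul_eq_zero, neg_eq_zero, pow_eq_zero_iff, ne_eq, OfNat.ofNat_ne_zero,
    not_false_eq_true, ha, hb, hs, false_or] at nX₄ nY₄ rX₄ rY₄
  exact ⟨even_products_eq_zero ha hb hp.sq_sub_sq_ne_zero nX₀ nX₄ rY₀ rY₄,
    odd_products_eq_zero ha hb hp.sq_sub_sq_ne_zero nY₀ nY₄ rX₀ rX₄⟩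

theorem IsA2Integrable.case1_or_case4 {p : QCoeffs} (h : p.IsA2Integrable) (hp : p.IsDispersive)
    (hγ₁ : p.γ₁ = 0) : p.Case1 ∨ p.Case4 := by
  obtain ⟨⟨hF, hHU, hVG, hSV⟩, hK, hHV, hUG, hSU⟩ := h.products_eq_zero hp hγ₁
  have hξ₁ : p.ξ₁ = p.ξ₂ := by linarith
  have hξ₃ : p.ξ₃ = p.ξ₄ := by linarith
  by_cases h₀ : (p.α₂, p.β₂) = (0, 0)
  · exact .inl ⟨congrArg Prod.fst h₀, congrArg Prod.snd h₀, hξ₁, hξ₃⟩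
  have eq_zero_of_mul {x : ℝ} (hU : x * (p.α₂ - p.β₂) = 0) (hV : x * (p.α₂ + p.β₂) = 0) :
      x = 0 := by
    by_contra hx
    have hU := (mul_eq_zero.1 hU).resolve_left hx
    have hV := (mul_eq_zero.1 hV).resolve_left hx
    exact h₀ (Prod.ext (by linarith) (by linarith))
  have hS : p.α₁ + p.β₁ = 0 := eq_zero_of_mul hSU hSV
  have hH : p.α₁ - p.β₁ = 0 := eq_zero_of_mul hHU hHV
  have hγ₂ : p.γ₂ = 0 := eq_zero_of_mul (mul_comm _ _ |>.trans hUG) (mul_comm _ _ |>.trans hVG)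
  have hα₁ : p.α₁ = 0 := by linarith
  have hβ₁ : p.β₁ = 0 := by linarith
  exact .inr ⟨by simp [hα₁, hγ₁], by simp [hβ₁, hγ₁], by simp [hγ₁, hγ₂], by simp [hγ₁, hξ₁],
    by simp [hγ₁, hξ₃], h₀⟩

theorem not_case1_and_case4 (p : QCoeffs) : ¬(p.Case1 ∧ p.Case4) :=
  fun ⟨⟨hα₂, hβ₂, _⟩, h⟩ => h.2.2.2.2.2 (Prod.ext hα₂ hβ₂)

theorem isA2Integrable_iff {p : QCoeffs} (hp : p.IsDispersive) :
    p.IsA2Integrable ↔ p.Case1 ∨ p.Case4 := by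
  let C := -p.γ₁ / (2 * p.a₁)
  have hC := hp.mobius C one_ne_zero
  have hγ₁ : (p.mobius C 1).γ₁ = 0 := by
    have ha₁ := hp.1
    simp only [QCoeffs.mobius, C]
    field_simp
    ring
  rw [← isA2Integrable_mobius hp C, ← p.case1_mobius C one_ne_zero,
    ← case4_mobius hp.1 C one_ne_zero]
  constructor
  · exact fun h => h.case1_or_case4 hC hγ₁
  · rintro (h | h)
    · exact h.isReversible.isA2Integrable hC
    · exact (h.isReversible hC.1 hγ₁).isA2Integrable hC

theorem existsUnique_case1 (a₁ a₂ α₁ β₁ γ₁ γ₂ ξ₁ ξ₃ ζ : ℝ) : ∃! p : QCoeffs, p.Case1 ∧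
    p.a₁ = a₁ ∧ p.a₂ = a₂ ∧ p.α₁ = α₁ ∧ p.β₁ = β₁ ∧ p.γ₁ = γ₁ ∧ p.γ₂ = γ₂ ∧
    p.ξ₁ = ξ₁ ∧ p.ξ₃ = ξ₃ ∧ p.ζ = ζ := by
  refine ⟨⟨a₁, a₂, α₁, 0, β₁, 0, γ₁, γ₂, ξ₁, ξ₁, ξ₃, ξ₃, ζ⟩,
    ⟨⟨rfl, rfl, rfl, rfl⟩, rfl, rfl, rfl, rfl, rfl, rfl, rfl, rfl, rfl⟩, ?_⟩
  rintro ⟨⟩ ⟨⟨hα₂, hβ₂, hξ₂, hξ₄⟩, rfl, rfl, rfl, rfl, rfl, rfl, rfl, rfl, rfl⟩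
  simp only at hα₂ hβ₂ hξ₂ hξ₄
  simp only [hα₂, hβ₂, hξ₂, hξ₄]

theorem existsUnique_case4 (a₁ a₂ α₂ β₂ γ₁ ξ₁ ξ₃ ζ : ℝ) (ha₁ : a₁ ≠ 0)
    (h : (α₂, β₂) ≠ (0, 0)) :
    ∃! p : QCoeffs, p.Case4 ∧ p.a₁ = a₁ ∧ p.a₂ = a₂ ∧ p.α₂ = α₂ ∧ p.β₂ = β₂ ∧ p.γ₁ = γ₁ ∧
      p.ξ₁ = ξ₁ ∧ p.ξ₃ = ξ₃ ∧ p.ζ = ζ := by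
  refine ⟨⟨a₁, a₂, (a₁ + a₂) * γ₁ / (2 * a₁), α₂, (a₁ + a₂) * γ₁ / (2 * a₁), β₂, γ₁,
    a₂ * γ₁ / a₁, ξ₁, ξ₁ + α₂ * γ₁ / a₁, ξ₃, ξ₃ - β₂ * γ₁ / a₁, ζ⟩,
    ⟨⟨rfl, rfl, rfl, ?_, ?_, h⟩, rfl, rfl, rfl, rfl, rfl, rfl, rfl, rfl⟩, ?_⟩
  · field_simp
    ring
  · field_simp
    ring
  · rintro ⟨⟩ ⟨⟨hα₁, hβ₁, hγ₂, hξ₂, hξ₄, -⟩, rfl, rfl, rfl, rfl, rfl, rfl, rfl, rfl⟩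
    simp only at hα₁ hβ₁ hγ₂ hξ₂ hξ₄ ha₁
    simp only [mk.injEq, true_and, and_true, hα₁, hβ₁, hγ₂]
    constructor
    · field_simp
      linear_combination -hξ₂
    · field_simp
      linear_combination -hξ₄

end QCoeffs

end

theorem mainTheorem3 :
    -- the conditions at order `ε⁴`
    (∀ p : QCoeffs, p.IsDispersive → (p.IsA2Integrable ↔ p.Case1 ∨ p.Case4)) ∧
    -- the two subclasses do not overlap
    (∀ p : QCoeffs, ¬ (p.Case1 ∧ p.Case4)) ∧
    -- invariance under the restricted Möbius transformations
    (∀ p : QCoeffs, p.IsDispersive → ∀ C D : ℝ, D ≠ 0 →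
      (p.mobius C D).IsDispersive ∧
      ((p.mobius C D).Case1 ↔ p.Case1) ∧ ((p.mobius C D).Case4 ↔ p.Case4)) ∧
    -- Case 1 has nine free parameters
    (∀ a₁ a₂ α₁ β₁ γ₁ γ₂ ξ₁ ξ₃ ζ : ℝ, ∃! p : QCoeffs, p.Case1 ∧
      p.a₁ = a₁ ∧ p.a₂ = a₂ ∧ p.α₁ = α₁ ∧ p.β₁ = β₁ ∧ p.γ₁ = γ₁ ∧ p.γ₂ = γ₂ ∧
      p.ξ₁ = ξ₁ ∧ p.ξ₃ = ξ₃ ∧ p.ζ = ζ) ∧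
    -- the restricted Case 4 has eight free parameters
    (∀ a₁ a₂ α₂ β₂ γ₁ ξ₁ ξ₃ ζ : ℝ, a₁ ≠ 0 → (α₂, β₂) ≠ (0, 0) → ∃! p : QCoeffs, p.Case4 ∧
      p.a₁ = a₁ ∧ p.a₂ = a₂ ∧ p.α₂ = α₂ ∧ p.β₂ = β₂ ∧ p.γ₁ = γ₁ ∧
      p.ξ₁ = ξ₁ ∧ p.ξ₃ = ξ₃ ∧ p.ζ = ζ) :=
  ⟨fun _ hp => QCoeffs.isA2Integrable_iff hp, QCoeffs.not_case1_and_case4,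
    fun p hp C _ hD => ⟨hp.mobius C hD, p.case1_mobius C hD, QCoeffs.case4_mobius hp.1 C hD⟩,
    QCoeffs.existsUnique_case1, QCoeffs.existsUnique_case4⟩
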